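/- Let $n\ge k\ge 1$ and $N\ge 0$ be integers, $K=k(n-k+1)$, $\mathbb O=\mathbb C[[\epsilon]]$, $\mathbb K=\mathbb C((\epsilon))$. Let $e_1,\dots,e_K$ be the standard basis of $\mathbb K^K$, extended to $e_j$, $j\in\mathbb Z$, by $e_{j+K}=\epsilon e_j$, and let $\gamma=\gamma_{n,k,N}$ be the $\mathbb K$-linear operator with $\gamma e_i=e_{i+k}$ for $1\le i\le (n-k)k$, $\gamma e_i=e_{i+k+1}$ for $(n-k)k<i<K$, and $\gamma e_K=\epsilon^{N+1}e_1$. Put $\Lambda_i^{\mathrm{std}}=\mathbb O\{e_{i+1},\dots,e_{i+K}\}$. The affine flag variety $\widetilde{\mathrm{Fl}}$ is the set of flags of lattices $(g\Lambda^{\mathrm{std}}_i)_{0\le i\le K}$, $g\in \mathrm{GL}_K(\mathbb K)$; keeping only $\Lambda_0\supset\Lambda_{K-n}\supset\Lambda_{K-n+1}\supset\dots\supset\Lambda_K=\epsilon\Lambda_0$ gives the partial affine flag variety $\widetilde{\mathrm{Fl}}_{(K-n,1^n)}$, and keeping only $\Lambda_0$ gives the affine Grassmannian $\widetilde{\mathrm{Gr}}$.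 Let $I^-\subset\mathrm{GL}_K(\mathbb O)$ be the group of matrices that are lower triangular modulo $\epsilon$, let $C\subset\widetilde{\mathrm{Fl}}$ be the union of the Schubert cells $I^-\omega I^- /I^-$ over all bijections $\omega:\mathbb Z\to\mathbb Z$ with $\omega(i+K)=\omega(i)+K$, $\omega(i)>0$ for $1\le i\le K$, and $1\le\omega^{-1}(1)\le K$ (acting by $e_j\mapsto e_{\omega(j)}$), and let $C'$ be the image of $C$ in $\widetilde{\mathrm{Fl}}_{(K-n,1^n)}$. Define $$Y_{n,k,N}=C'\cap\{\Lambda_\bullet\in\widetilde{\mathrm{Fl}}_{(K-n,1^n)} : \gamma\Lambda_i\subseteq\Lambda_i\ \forall i,\ \mathrm{JT}(\gamma|_{\Lambda_0/\Lambda_{K-n}})\le (n-k)^{k-1}\},$$ where $\mathrm{JT}$ denotes the Jordan type (the partition given by the sizes of the Jordan blocks of a nilpotent operator) and $\le$ is dominance order, and let $\pi:Y_{n,k,N}\to\widetilde{\mathrm{Gr}}$ be the map $\Lambda_\bullet\mapsto\Lambda_0$. For a partition $\mu$ with $|\mu|\le n$ and at most $s$ parts, let $\nu=((n-|\mu|)^s)+\mu$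 (add $n-|\mu|$ to each of the $s$ parts of $\mu$, padded by zeros), and let $T$ be a nilpotent operator on $\mathbb C^{|\nu|}$ with Jordan type $\nu$. The $\Delta$-Springer fiber $Z_{n,\mu,s}$ is the variety of partial flags $\mathbb C^{|\nu|}=F_0\supset F_{|\nu|-n}\supset F_{|\nu|-n+1}\supset\dots\supset F_{|\nu|}=0$ with $\dim F_i=|\nu|-i$, $TF_i\subseteq F_i$ for all $i$, and $\mathrm{JT}(T|_{F_0/F_{|\nu|-n}})\le (n-|\mu|)^{s-1}$. **Theorem.** Let $\Lambda\in\widetilde{\mathrm{Gr}}$ be such that the fiber $\pi^{-1}(\Lambda)$ is nonempty. Then $\gamma$ preserves $\Lambda$ and $\epsilon\Lambda$ and acts on $\Lambda/\epsilon\Lambda$ nilpotently with Jordan type having at most $k$ parts, and there is a partition $\mu$ with $|\mu|\le n$ and at most $k$ parts such that $\pi^{-1}(\Lambda)$ is isomorphic, as a complex (reduced) algebraic variety, to the $\Delta$-Springer fiber $Z_{n,\mu,k}$ (for any choice of $T$). -/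

import Mathlib

open scoped PowerSeries LaurentSeries Topology

noncomputable section

namespace AffineDelta

/-! ### Jordan types -/

/-- `HasJordanType T lam`: the endomorphism `T` is nilpotent with Jordan blocks of sizes
`lam 0 ≥ lam 1 ≥ ⋯`, i.e. there is a basis consisting of Jordan chains of these lengths.
Partitions are written as weakly decreasing sequences of natural numbers, padded by zeros. -/
def HasJordanType {V : Type*} [AddCommGroup V] [Module ℂ V] (T : Module.End ℂ V)
    (lam : ℕ → ℕ) : Prop :=
  Antitone lam ∧
    ∃ b : Module.Basis (Σ i : ℕ, Fin (lam i)) ℂ V,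
      (∀ (i : ℕ) (h : 0 < lam i), T (b ⟨i, ⟨0, h⟩⟩) = 0) ∧
      (∀ (i j : ℕ) (h : j + 1 < lam i),
        T (b ⟨i, ⟨j + 1, h⟩⟩) = b ⟨i, ⟨j, (Nat.lt_succ_self j).trans h⟩⟩)

/-- Dominance order (for sequences representing partitions of the same number). -/
def DominanceLE (kap lam : ℕ → ℕ) : Prop :=
  ∀ j : ℕ, ∑ i ∈ Finset.range j, kap i ≤ ∑ i ∈ Finset.range j, lam i

/-- The rectangular partition `(r^m)`, with `m` parts equal to `r`. -/
def rectangle (r m : ℕ) : ℕ → ℕ := fun i => if i < m then r else 0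

/-- The Jordan type of `T` is at most `lam` in dominance order. -/
def JordanTypeLE {V : Type*} [AddCommGroup V] [Module ℂ V] (T : Module.End ℂ V)
    (lam : ℕ → ℕ) : Prop :=
  ∃ kap : ℕ → ℕ, HasJordanType T kap ∧ DominanceLE kap lam

/-- The endomorphism induced by `T` on the quotient `W / (W ∩ W')` of `T`-stable subspaces
(used for `W' ≤ W`, where it is `W / W'`). -/
def inducedEnd {E : Type*} [AddCommGroup E] [Module ℂ E] (T : Module.End ℂ E)
    (W W' : Submodule ℂ E) (hW : W ≤ W.comap T) (hW' : W' ≤ W'.comap T) :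
    Module.End ℂ (W ⧸ W'.submoduleOf W) :=
  (W'.submoduleOf W).mapQ (W'.submoduleOf W) (T.restrict hW) (fun _ hx => hW' hx)

/-! ### Complex varieties as spaces with functions

A complex variety is regarded, classically, as a topological space together with the knowledge of
which `ℂ`-valued functions on its open subsets are regular.  An isomorphism is a
homeomorphism which, together with its inverse, pulls back regular functions to regular
functions. -/

/-- A topology on `X` together with a notion of regular function on (open) subsets: `regular U f`
means that the restriction of `f` to `U` is regular. -/
structure FunctionSpace (X : Type*) where
  topology : TopologicalSpace X
  regular : Set X → (X → ℂ) → Prop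

/-- Isomorphism of spaces with functions. -/
def FunctionSpace.Isomorphic {X Y : Type*} (SX : FunctionSpace X) (SY : FunctionSpace Y) : Prop :=
  ∃ e : X ≃ Y,
    (∀ U : Set Y, IsOpen[SY.topology] U ↔ IsOpen[SX.topology] (e ⁻¹' U)) ∧
    (∀ U : Set Y, IsOpen[SY.topology] U → ∀ f : Y → ℂ,
      SY.regular U f ↔ SX.regular (e ⁻¹' U) (f ∘ e))

/-- The Zariski topology on the affine space `ℂ^σ`. -/
@[reducible] def zariski (σ : Type*) : TopologicalSpace (σ → ℂ) :=
  TopologicalSpace.generateFrom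
    {D | ∃ P : MvPolynomial σ ℂ, D = {x | MvPolynomial.eval x P ≠ 0}}

/-- Coordinates of a family of vectors: for each `i`, `d i` vectors in `ℂ^ι`. -/
abbrev FrameCoord (I ι : Type*) (d : I → ℕ) : Type _ := Σ i : I, Fin (d i) × ι

/-- `b` consists of a basis of each of the subspaces `F i` of `ℂ^ι`. -/
def IsFrame {I ι : Type*} {d : I → ℕ} (F : I → Submodule ℂ (ι → ℂ))
    (b : FrameCoord I ι d → ℂ) : Prop :=
  ∀ i : I, LinearIndependent ℂ (fun (r : Fin (d i)) (c : ι) => b ⟨i, (r, c)⟩) ∧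
    Submodule.span ℂ (Set.range (fun (r : Fin (d i)) (c : ι) => b ⟨i, (r, c)⟩)) = F i

/-- Given a family `F` of subspaces of `ℂ^ι` depending on a point of `X`, the space of pairs
`(x, b)` where `x ∈ A` and `b` is a frame of the family `F x` with dimension vector `d`.  If `F`
is injective on `A`, this is the preimage, in the product of the
spaces of full rank matrices, of the image of `A` in the product of the Grassmannians
`Gr(d i, ℂ^ι)`. -/
abbrev Frames {X I ι : Type*} (A : Set X) (F : X → I → Submodule ℂ (ι → ℂ)) (d : I → ℕ) : Type _ :=
  {p : X × (FrameCoord I ι d → ℂ) // p.1 ∈ A ∧ IsFrame (F p.1) p.2}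

/-- The topology on `A` (as a subset of a product of Grassmannians, via `F`): the quotient of the
Zariski topology on frames. -/
@[reducible] def grassmannTopology {X I ι : Type*} (A : Set X) (F : X → I → Submodule ℂ (ι → ℂ)) :
    TopologicalSpace X :=
  ⨆ d : I → ℕ, TopologicalSpace.coinduced (fun p : Frames A F d => p.1.1)
    (TopologicalSpace.induced (fun p : Frames A F d => p.1.2) (zariski (FrameCoord I ι d)))

/-- Regular functions on `U ∩ A` (as a subset of a product of Grassmannians, via `F`): those which
are locally quotients of polynomials in the entries of a frame. -/
def grassmannRegular {X I ι : Type*} (A : Set X) (F : X → I → Submodule ℂ (ι → ℂ))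
    (U : Set X) (f : X → ℂ) : Prop :=
  ∀ (d : I → ℕ) (p : Frames A F d), p.1.1 ∈ U →
    ∃ P Q : MvPolynomial (FrameCoord I ι d) ℂ,
      MvPolynomial.eval p.1.2 Q ≠ 0 ∧
      ∀ q : Frames A F d, q.1.1 ∈ U → MvPolynomial.eval q.1.2 Q ≠ 0 →
        f q.1.1 = MvPolynomial.eval q.1.2 P / MvPolynomial.eval q.1.2 Q

/-! ### Delta-Springer fibers -/

/-- Positions of the members of a partial flag of type `(M - n, 1^n)`: `0, M - n, …, M`. -/
def flagIndex (M n : ℕ) : Set ℕ := {i | i = 0 ∨ (M - n ≤ i ∧ i ≤ M)}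

/-- The position `0`. -/
def flagIndex.first (M n : ℕ) : flagIndex M n := ⟨0, Or.inl rfl⟩

/-- The position `M - n`. -/
def flagIndex.second (M n : ℕ) : flagIndex M n := ⟨M - n, Or.inr ⟨le_rfl, Nat.sub_le M n⟩⟩

/-- The partition `ν = ((n - |μ|)^s) + μ`, for a partition `μ` with at most `s` parts. -/
def nuRow (n s : ℕ) (μ : YoungDiagram) : ℕ → ℕ :=
  fun i => if i < s then (n - μ.card) + μ.rowLen i else 0

/-- The size `|ν|` of `ν = ((n - |μ|)^s) + μ`. -/
def nuSize (n s : ℕ) (μ : YoungDiagram) : ℕ := s * (n - μ.card) + μ.card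

/-- The Delta-Springer fiber `Z_{n,μ,s}` defined by a nilpotent operator `T` on `ℂ^|ν|` of Jordan
type `ν`: the `T`-stable partial flags `ℂ^|ν| = F_0 ⊃ F_{|ν|-n} ⊃ ⋯ ⊃ F_|ν| = 0` with
`dim F_i = |ν| - i` such that the Jordan type of `T` on `F_0 / F_{|ν|-n}` is at most
`(n - |μ|)^(s-1)`. -/
def DeltaSpringer (n s : ℕ) (μ : YoungDiagram) (T : Module.End ℂ (Fin (nuSize n s μ) → ℂ)) :
    Type :=
  {F : flagIndex (nuSize n s μ) n → Submodule ℂ (Fin (nuSize n s μ) → ℂ) //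
    Antitone F ∧ (∀ i, Module.finrank ℂ (F i) = nuSize n s μ - (i : ℕ)) ∧
    ∃ h : ∀ i, F i ≤ (F i).comap T,
      JordanTypeLE
        (inducedEnd T (F (flagIndex.first _ n)) (F (flagIndex.second _ n)) (h _) (h _))
        (rectangle (n - μ.card) (s - 1))}

/-- `Z_{n,μ,s}` as a subvariety of the partial flag variety (in a product of Grassmannians). -/
def DeltaSpringer.variety (n s : ℕ) (μ : YoungDiagram)
    (T : Module.End ℂ (Fin (nuSize n s μ) → ℂ)) : FunctionSpace (DeltaSpringer n s μ T) where
  topology := grassmannTopology Set.univ (fun F => F.1)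
  regular := grassmannRegular Set.univ (fun F => F.1)

/-! ### Affine flags -/

/-- The space `𝕂^K` of vectors of Laurent series in `ε` over `ℂ`. -/
abbrev LVec (K : ℕ) : Type := Fin K → ℂ⸨X⸩

instance : IsScalarTower ℂ ℂ⸨X⸩ ℂ⸨X⸩ := ⟨fun c p f => by
  rw [smul_eq_mul, smul_eq_mul, ← HahnSeries.C_mul_eq_smul, ← HahnSeries.C_mul_eq_smul, mul_assoc]⟩

instance : IsScalarTower ℂ ℂ⟦X⟧ ℂ⸨X⸩ := ⟨fun c p f => by
  rw [PowerSeries.smul_eq_C_mul, Algebra.smul_def, Algebra.smul_def, LaurentSeries.coe_algebraMap,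
    map_mul, HahnSeries.ofPowerSeries_C, mul_assoc, HahnSeries.C_mul_eq_smul]⟩

/-- The vectors `e_j`, `j ∈ ℤ`: `e_1, …, e_K` is the standard basis of `𝕂^K`, and
`e_{j+K} = ε e_j`. -/
def e (K : ℕ) (j : ℤ) : LVec K :=
  fun r => if (r : ℤ) = (j - 1) % (K : ℤ) then HahnSeries.single ((j - 1) / (K : ℤ)) 1 else 0

/-- `Λ_i^std`, the lattice spanned by `e_{i+1}, …, e_{i+K}`. -/
def stdLattice (K : ℕ) (i : ℤ) : Submodule ℂ⟦X⟧ (LVec K) :=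
  Submodule.span ℂ⟦X⟧ (e K '' Set.Ioc i (i + K))

/-- The image `g Λ` of a lattice under an invertible matrix. -/
def translate {K : ℕ} (g : GL (Fin K) ℂ⸨X⸩) (L : Submodule ℂ⟦X⟧ (LVec K)) :
    Submodule ℂ⟦X⟧ (LVec K) :=
  L.map ((Matrix.toLin' (g : Matrix (Fin K) (Fin K) ℂ⸨X⸩)).restrictScalars ℂ⟦X⟧)

/-- Affine flags with members in the positions `s ⊆ {0, …, K}`, i.e. families `(g Λ_i^std)_{i ∈ s}`
with `g ∈ GL_K(𝕂)`.  For `s = {0, …, K}` this is the affine flag variety, for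
`s = {0, K - n, …, K}` the partial affine flag variety of type `(K - n, 1^n)`, and for `s = {0}`
the affine Grassmannian. -/
def AffineFlag (K : ℕ) (s : Set ℕ) : Type :=
  {L : s → Submodule ℂ⟦X⟧ (LVec K) //
    ∃ g : GL (Fin K) ℂ⸨X⸩, ∀ i : s, L i = translate g (stdLattice K ((i : ℕ) : ℤ))}

/-- Forgetting some of the members of an affine flag. -/
def AffineFlag.forget {K : ℕ} {s t : Set ℕ} (h : s ⊆ t) (L : AffineFlag K t) : AffineFlag K s :=
  ⟨fun i => L.1 ⟨i, h i.2⟩, by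
    obtain ⟨g, hg⟩ := L.2
    exact ⟨g, fun i => hg ⟨i, h i.2⟩⟩⟩

/-- The affine Grassmannian. -/
abbrev AffineGrassmannian (K : ℕ) : Type := AffineFlag K {0}

/-- The lattice `Λ` underlying a point of the affine Grassmannian. -/
def AffineGrassmannian.lattice {K : ℕ} (L : AffineGrassmannian K) : Submodule ℂ⟦X⟧ (LVec K) :=
  L.1 ⟨0, rfl⟩

/-- Truncation `𝕂^K → ℂ^(K × 2a)`, keeping the coefficients of `ε^(-a), …, ε^(a-1)`.  It identifies
`ε^(-a) 𝕆^K / ε^a 𝕆^K` with `ℂ^(K × 2a)`. -/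
def truncation (K a : ℕ) : LVec K →ₗ[ℂ] (Fin K × Fin (2 * a) → ℂ) where
  toFun v := fun rj => (v rj.1).coeff ((rj.2 : ℤ) - a)
  map_add' v w := by ext; simp
  map_smul' c v := by ext; simp

/-- The flags with all members between `ε^a 𝕆^K` and `ε^(-a) 𝕆^K`. -/
def AffineFlag.bounded (K : ℕ) (s : Set ℕ) (a : ℕ) : Set (AffineFlag K s) :=
  {L | ∀ i : s, stdLattice K ((a : ℤ) * K) ≤ L.1 i ∧ L.1 i ≤ stdLattice K (-((a : ℤ) * K))}

/-- The subspaces of `ε^(-a) 𝕆^K / ε^a 𝕆^K` given by the members of a flag bounded by `a`. -/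
def AffineFlag.subspaces {K : ℕ} {s : Set ℕ} (a : ℕ) (L : AffineFlag K s) (i : s) :
    Submodule ℂ (Fin K × Fin (2 * a) → ℂ) :=
  ((L.1 i).restrictScalars ℂ).map (truncation K a)

/-- The structure of space with functions on a subset `S` of an (ind-)variety of affine flags,
which is the increasing union over `a` of the closed subvarieties of flags bounded by `a`, each
of them embedded in products of Grassmannians of `ε^(-a) 𝕆^K / ε^a 𝕆^K`: a subset
is open, and a function is regular, if it is so after restriction to each of these. -/
def AffineFlag.subvariety {K : ℕ} {s : Set ℕ} (S : Set (AffineFlag K s)) : FunctionSpace S where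
  topology := ⨆ a : ℕ, grassmannTopology (Subtype.val ⁻¹' AffineFlag.bounded K s a)
    (fun L : S => AffineFlag.subspaces a L.1)
  regular := fun U f => ∀ a : ℕ, grassmannRegular (Subtype.val ⁻¹' AffineFlag.bounded K s a)
    (fun L : S => AffineFlag.subspaces a L.1) U f

/-! ### Schubert cells -/

/-- Extended affine permutations. -/
def IsAffinePerm (K : ℕ) (ω : Equiv.Perm ℤ) : Prop := ∀ i : ℤ, ω (i + K) = ω i + K

/-- Positive affine permutations. -/
def IsPositive (K : ℕ) (ω : Equiv.Perm ℤ) : Prop := ∀ i : ℤ, 1 ≤ i → i ≤ K → 0 < ω i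

/-- Normalized affine permutations. -/
def IsNormalized (K : ℕ) (ω : Equiv.Perm ℤ) : Prop := 1 ≤ ω.symm 1 ∧ ω.symm 1 ≤ K

/-- The opposite Iwahori group: invertible matrices over `𝕆` whose reduction modulo `ε` is lower
triangular. -/
def iwahoriMinus (K : ℕ) : Set (GL (Fin K) ℂ⸨X⸩) :=
  {g | ∃ h : GL (Fin K) ℂ⟦X⟧,
    (∀ i j : Fin K, i < j → PowerSeries.constantCoeff (h.1 i j) = 0) ∧
    g = Matrix.GeneralLinearGroup.map (algebraMap ℂ⟦X⟧ ℂ⸨X⸩) h}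

/-- The Schubert cell `C_ω = I⁻ ω I⁻ / I⁻`: the flags `Λ_i = g ω Λ_i^std` with `g ∈ I⁻`, where `ω`
sends `e_j` to `e_{ω(j)}`. -/
def schubertCell (K : ℕ) (ω : Equiv.Perm ℤ) : Set (AffineFlag K {i | i ≤ K}) :=
  {L | ∃ g ∈ iwahoriMinus K, ∀ i, L.1 i = translate g
    (Submodule.span ℂ⟦X⟧ ((fun j => e K (ω j)) '' Set.Ioc ((i : ℕ) : ℤ) ((i : ℕ) + K)))}

/-- The union `C` of the Schubert cells of positive normalized affine permutations. -/
def positiveCells (K : ℕ) : Set (AffineFlag K {i | i ≤ K}) :=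
  {L | ∃ ω : Equiv.Perm ℤ, IsAffinePerm K ω ∧ IsPositive K ω ∧ IsNormalized K ω ∧
    L ∈ schubertCell K ω}

lemma flagIndex_subset (M n : ℕ) : flagIndex M n ⊆ {i | i ≤ M} := by
  rintro i (rfl | ⟨_, h⟩)
  · exact Nat.zero_le M
  · exact h

/-- `C'`, the image of `C` in the partial affine flag variety of type `(K - n, 1^n)`. -/
def positivePartialCells (K n : ℕ) : Set (AffineFlag K (flagIndex K n)) :=
  AffineFlag.forget (flagIndex_subset K n) '' positiveCells K

/-! ### The affine Delta-Springer fiber -/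

/-- `K = k (n - k + 1)`. -/
def bigK (n k : ℕ) : ℕ := k * (n - k + 1)

/-- The values `γ(x)`, `1 ≤ x ≤ K`, of the affine permutation `γ_{n,k,N}`. -/
def gammaIndex (n k N x : ℕ) : ℕ :=
  if x ≤ (n - k) * k then x + k
  else if x < bigK n k then x + k + 1
  else 1 + bigK n k * (N + 1)

/-- The operator `γ = γ_{n,k,N}` on `𝕂^K`, with `γ e_x = e_{γ(x)}` for `1 ≤ x ≤ K`; in particular
`γ e_K = ε^(N+1) e_1`. -/
def gamma (n k N : ℕ) : Module.End ℂ⸨X⸩ (LVec (bigK n k)) :=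
  (Pi.basisFun ℂ⸨X⸩ (Fin (bigK n k))).constr ℂ⸨X⸩
    (fun r => e (bigK n k) (gammaIndex n k N ((r : ℕ) + 1)))

/-- `γ` as a `ℂ`-linear operator. -/
abbrev gammaC (n k N : ℕ) : Module.End ℂ (LVec (bigK n k)) := (gamma n k N).restrictScalars ℂ

/-- `L` regarded as a `ℂ`-subspace. -/
abbrev asC {K : ℕ} (L : Submodule ℂ⟦X⟧ (LVec K)) : Submodule ℂ (LVec K) := L.restrictScalars ℂ

/-- The affine Borho-MacPherson variety: `γ`-stable flags of type `(K - n, 1^n)` such that the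
Jordan type of `γ` on `Λ_0 / Λ_{K-n}` is at most `(n - k)^(k-1)`. -/
def borhoMacPherson (n k N : ℕ) : Set (AffineFlag (bigK n k) (flagIndex (bigK n k) n)) :=
  {L | ∃ h : ∀ i, asC (L.1 i) ≤ (asC (L.1 i)).comap (gammaC n k N),
    JordanTypeLE
      (inducedEnd (gammaC n k N) (asC (L.1 (flagIndex.first _ n)))
        (asC (L.1 (flagIndex.second _ n))) (h _) (h _))
      (rectangle (n - k) (k - 1))}

/-- The affine Delta-Springer fiber `Y_{n,k,N}`. -/
def affineDeltaSpringer (n k N : ℕ) : Set (AffineFlag (bigK n k) (flagIndex (bigK n k) n)) :=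
  borhoMacPherson n k N ∩ positivePartialCells (bigK n k) n

/-- The projection to the affine Grassmannian, `Λ_• ↦ Λ_0`. -/
def toGrassmannian (K n : ℕ) : AffineFlag K (flagIndex K n) → AffineGrassmannian K :=
  AffineFlag.forget (by rintro i rfl; exact Or.inl rfl)

/-- The fiber of `π : Y_{n,k,N} → Gr` over `Λ`. -/
def fiber (n k N : ℕ) (Λ : AffineGrassmannian (bigK n k)) :
    Set (AffineFlag (bigK n k) (flagIndex (bigK n k) n)) :=
  {L | L ∈ affineDeltaSpringer n k N ∧ toGrassmannian (bigK n k) n L = Λ}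

/-- The lattice `ε Λ`. -/
def epsMul {K : ℕ} (L : Submodule ℂ⟦X⟧ (LVec K)) : Submodule ℂ⟦X⟧ (LVec K) :=
  L.map (LinearMap.lsmul ℂ⟦X⟧ (LVec K) (PowerSeries.X : ℂ⟦X⟧))

end AffineDelta

end

open scoped PowerSeries LaurentSeries Topology

noncomputable section

namespace AffineDelta

/-! ### Jordan types, and dominance below a rectangle -/

section

open Polynomial

/-! Write r = n - k. Since dim Λ_0/Λ_{K-n} = (k-1)r, a Jordan type on this quotient is dominated by
r^(k-1) exactly when all its blocks have size at most r, i.e. when γ^r Λ_0 ⊆ Λ_{K-n}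
(`jordanTypeLE_inducedEnd_iff`). So a point of the fiber over Λ gives a γ-stable flag of type (K-n,
1^n) in Λ/εΛ whose n-dimensional member W contains R = im γ^r. Conversely every such flag comes from
the fiber. Membership in C' costs nothing once Λ is positive: by Gaussian elimination
(`exists_echelon_basis`, `exists_iwahori_flag`) every flag between Λ = gωΛ_0 and εΛ is g'ω'Λ_• with
ω' obtained from ω by permuting its window {1, …, K}, which preserves positivity and normalization.

Let λ be the Jordan type of γ on Λ/εΛ, μ_i = max(λ_i - r, 0) and u = n - |μ|. Then |μ| = dim R,
hence |μ| ≤ n. As W/R has dimension u and γ is nilpotent, γ^u W ⊆ R (`pow_mem_of_finrank`), so the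
whole flag from W downwards lies in V_0 = {x : γ^u x ∈ R}. On V_0 the operator has Jordan type ν =
(u^k) + μ, and its u-th power has image exactly R (`exists_jordan_embedding`). Because |ν| - n =
(k-1)u, containing R is in turn the rectangle condition defining the Δ-Springer fiber. Intersecting
with V_0 therefore identifies the two sets of flags. The inequalities needed, u ≤ r and u ≤ λ_i,
follow from |λ| = K = k(n-k) + k.

That λ has at most k parts is the arithmetic input. Positivity puts Λ inside 𝕆^K, and normalization
gives v in Λ with invertible first coordinate. The cokernel of γ on 𝕆^K has dimension at most k + N,
and passing to the stable sublattice Λ preserves this bound. The N vectors εv, …, ε^N v are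
independent modulo γΛ, since first coordinates of γΛ are divisible by ε^(N+1), but they die modulo
ε. Hence dim Λ/(γΛ + εΛ) ≤ k (`not_forall_eq_zero_of_gammaO`).

The bijection is an isomorphism of varieties because in both directions each member of the new flag
is ψ(F_i) + S, with F_i a member of the old flag and ψ, S fixed. Such maps lift locally to
polynomial maps of frames (`exists_polynomial_basis`, `grassmann_iff_of_linear`). In the ind-variety
structure, each truncation level sees either all of the fiber or none of it. -/

/-- The basis of `ℂ[X] / (X^m)` given by the powers of `X` in decreasing order. -/
lemma exists_chainBasis_quotient (m : ℕ) :
    ∃ b : Module.Basis (Fin m) ℂ (ℂ[X] ⧸ ℂ[X] ∙ ((X : ℂ[X]) ^ m)),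
      ∀ j : Fin m, b j = Submodule.Quotient.mk ((X : ℂ[X]) ^ (m - 1 - (j : ℕ))) := by
  have hm : ((X : ℂ[X]) ^ m).Monic := monic_X_pow m
  have hd : (AdjoinRoot.powerBasis' hm).dim = m := natDegree_X_pow m
  have key : ∃ b : Module.Basis (Fin m) ℂ (AdjoinRoot ((X : ℂ[X]) ^ m)),
      ∀ j : Fin m, b j = AdjoinRoot.mk _ ((X : ℂ[X]) ^ (m - 1 - (j : ℕ))) := by
    refine ⟨(AdjoinRoot.powerBasis' hm).basis.reindex
      ((finCongr hd).trans Fin.revPerm), fun j => ?_⟩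
    rw [Module.Basis.reindex_apply, PowerBasis.basis_eq_pow, AdjoinRoot.powerBasis'_gen, map_pow,
      AdjoinRoot.mk_X]
    congr 1
    simp [Fin.revPerm]
    omega
  obtain ⟨b, hb⟩ := key
  exact ⟨b, hb⟩

/-- The structure theorem over the principal ideal domain ℂ[X], applied to V with X acting as T:
nilpotency makes it X-power torsion, so it is a sum of modules ℂ[X]/(X^m), each a Jordan chain. -/
lemma exists_chainBasis {V : Type*} [AddCommGroup V] [Module ℂ V] [FiniteDimensional ℂ V]
    (T : Module.End ℂ V) (hT : IsNilpotent T) :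
    ∃ (d : ℕ) (m : Fin d → ℕ) (b : Module.Basis (Σ i : Fin d, Fin (m i)) ℂ V),
      (∀ (i : Fin d) (h : 0 < m i), T (b ⟨i, ⟨0, h⟩⟩) = 0) ∧
      (∀ (i : Fin d) (j : ℕ) (h : j + 1 < m i),
        T (b ⟨i, ⟨j + 1, h⟩⟩) = b ⟨i, ⟨j, (Nat.lt_succ_self j).trans h⟩⟩) := by
  obtain ⟨N, hN⟩ := hT
  have htor : Module.IsTorsion' (Module.AEval' T) (Submonoid.powers (X : ℂ[X])) := by
    intro x
    refine ⟨⟨X ^ N, ⟨N, rfl⟩⟩, ?_⟩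
    obtain ⟨y, rfl⟩ := (Module.AEval'.of T).surjective x
    change (X ^ N : ℂ[X]) • Module.AEval'.of T y = 0
    rw [Module.AEval'.X_pow_smul_of, hN]
    simp
  have : Module.Finite ℂ[X] (Module.AEval' T) := inferInstance
  obtain ⟨d, m, ⟨f⟩⟩ := Module.torsion_by_prime_power_decomposition
    (p := (X : ℂ[X])) irreducible_X htor
  choose c hc using fun i => exists_chainBasis_quotient (m i)
  let f' : V ≃ₗ[ℂ] (Π₀ i : Fin d, ℂ[X] ⧸ ℂ[X] ∙ ((X : ℂ[X]) ^ (m i))) :=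
    (Module.AEval'.of T).trans (f.restrictScalars ℂ)
  have hf' : ∀ v, f' (T v) = (X : ℂ[X]) • f' v := by
    intro v
    change f (Module.AEval'.of T (T v)) = (X : ℂ[X]) • f (Module.AEval'.of T v)
    rw [← Module.AEval'.X_smul_of, map_smul]
  let b := (DFinsupp.basis c).map f'.symm
  have hb : ∀ i (j : Fin (m i)), f' (b ⟨i, j⟩) = DFinsupp.single i (c i j) := by
    intro i j
    simp only [b, Module.Basis.map_apply, LinearEquiv.apply_symm_apply]
    simp [DFinsupp.basis]
  refine ⟨d, m, b, ?_, ?_⟩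
  · intro i h
    apply f'.injective
    rw [hf', hb, map_zero, ← DFinsupp.single_smul, hc]
    have : (X : ℂ[X]) • (Submodule.Quotient.mk (X ^ (m i - 1 - 0)) :
      ℂ[X] ⧸ ℂ[X] ∙ ((X : ℂ[X]) ^ m i)) = 0 := by
      rw [← Submodule.Quotient.mk_smul, Submodule.Quotient.mk_eq_zero, smul_eq_mul, ← pow_succ',
        show m i - 1 - 0 + 1 = m i by omega]
      exact Submodule.mem_span_singleton_self _
    rw [this, DFinsupp.single_zero]
  · intro i j h
    apply f'.injective
    rw [hf', hb, hb, ← DFinsupp.single_smul, hc, hc, ← Submodule.Quotient.mk_smul, smul_eq_mul,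
      ← pow_succ']
    congr 4
    simp only
    omega

/-- Every nilpotent endomorphism of a finite-dimensional space has a Jordan type. -/
lemma exists_hasJordanType {V : Type*} [AddCommGroup V] [Module ℂ V] [FiniteDimensional ℂ V]
    (T : Module.End ℂ V) (hT : IsNilpotent T) : ∃ lam : ℕ → ℕ, HasJordanType T lam := by
  obtain ⟨d, m, b, hb0, hb1⟩ := exists_chainBasis T hT
  -- Sorting in the order dual makes the chain lengths weakly decreasing.
  let σ := Tuple.sort (fun i => OrderDual.toDual (m i))
  have hσ : ∀ i j, i ≤ j → m (σ j) ≤ m (σ i) := fun i j hij =>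
    OrderDual.toDual_le_toDual.1 (Tuple.monotone_sort (fun i => OrderDual.toDual (m i)) hij)
  let lam : ℕ → ℕ := fun i => if h : i < d then m (σ ⟨i, h⟩) else 0
  have hlam : ∀ i (h : i < d), lam i = m (σ ⟨i, h⟩) := fun i h => dif_pos h
  have hlt : ∀ i, 0 < lam i → i < d := by
    intro i h
    by_contra h'
    simp [lam, h'] at h
  let φ : (Σ i : ℕ, Fin (lam i)) → Σ i : Fin d, Fin (m i) := fun x =>
    ⟨σ ⟨x.1, hlt x.1 x.2.pos⟩, ⟨x.2, hlam x.1 (hlt x.1 x.2.pos) ▸ x.2.2⟩⟩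
  have hφ : Function.Bijective φ := by
    constructor
    · rintro ⟨i, j, hj⟩ ⟨i', j', hj'⟩ h
      simp only [φ, Sigma.mk.injEq, EmbeddingLike.apply_eq_iff_eq, Fin.mk.injEq] at h
      obtain ⟨rfl, h⟩ := h
      simpa using h
    · rintro ⟨i, j, hj⟩
      obtain ⟨⟨i', hi'⟩, rfl⟩ := σ.surjective i
      exact ⟨⟨i', ⟨j, (hlam i' hi').symm ▸ hj⟩⟩, rfl⟩
  refine ⟨lam, ?_, b.reindex (Equiv.ofBijective φ hφ).symm, ?_, ?_⟩
  · intro i j hij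
    by_cases hj : j < d
    · rw [hlam j hj, hlam i (hij.trans_lt hj)]
      exact hσ _ _ hij
    · simp [lam, hj]
  · intro i h
    simp only [Module.Basis.reindex_apply, Equiv.symm_symm, Equiv.ofBijective_apply, φ]
    exact hb0 _ _
  · intro i j h
    simp only [Module.Basis.reindex_apply, Equiv.symm_symm, Equiv.ofBijective_apply, φ]
    exact hb1 _ _ _

/-- The powers of `T` on a Jordan basis. -/
lemma jordan_pow_apply {V : Type*} [AddCommGroup V] [Module ℂ V] {T : Module.End ℂ V}
    {lam : ℕ → ℕ} {b : (Σ i : ℕ, Fin (lam i)) → V}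
    (h0 : ∀ (i : ℕ) (h : 0 < lam i), T (b ⟨i, ⟨0, h⟩⟩) = 0)
    (h1 : ∀ (i j : ℕ) (h : j + 1 < lam i),
      T (b ⟨i, ⟨j + 1, h⟩⟩) = b ⟨i, ⟨j, (Nat.lt_succ_self j).trans h⟩⟩)
    (r i j : ℕ) (h : j < lam i) :
    (T ^ r) (b ⟨i, ⟨j, h⟩⟩) =
      if r ≤ j then b ⟨i, ⟨j - r, (Nat.sub_le j r).trans_lt h⟩⟩ else 0 := by
  induction r generalizing j with
  | zero => simp
  | succ r ih =>
    rw [pow_succ, Module.End.mul_apply]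
    cases j with
    | zero => simp [h0 i h]
    | succ j => rw [h1 i j h, ih]; simp

/-- Sums of the first parts of a Jordan type are bounded by the dimension. -/
lemma sum_range_le_finrank {V : Type*} [AddCommGroup V] [Module ℂ V] [FiniteDimensional ℂ V]
    {lam : ℕ → ℕ} (b : Module.Basis (Σ i : ℕ, Fin (lam i)) ℂ V) (j : ℕ) :
    ∑ i ∈ Finset.range j, lam i ≤ Module.finrank ℂ V := by
  have hinj : Function.Injective
      (fun x : Σ i : Fin j, Fin (lam i) => (⟨x.1, x.2⟩ : Σ i : ℕ, Fin (lam i))) := by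
    rintro ⟨i, a⟩ ⟨i', a'⟩ h
    simp only [Sigma.mk.injEq, Fin.val_inj] at h
    obtain ⟨rfl, h⟩ := h
    simpa using h
  have := (b.linearIndependent.comp _ hinj).fintype_card_le_finrank
  simpa [Fintype.card_sigma, Finset.sum_range] using this

lemma sum_range_eq_finrank {V : Type*} [AddCommGroup V] [Module ℂ V]
    {lam : ℕ → ℕ} (hanti : Antitone lam) (b : Module.Basis (Σ i : ℕ, Fin (lam i)) ℂ V) (j : ℕ)
    (hj : lam j = 0) :
    ∑ i ∈ Finset.range j, lam i = Module.finrank ℂ V := by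
  have hbij : Function.Bijective
      (fun x : Σ i : Fin j, Fin (lam i) => (⟨x.1, x.2⟩ : Σ i : ℕ, Fin (lam i))) := by
    constructor
    · rintro ⟨i, a⟩ ⟨i', a'⟩ h
      simp only [Sigma.mk.injEq, Fin.val_inj] at h
      obtain ⟨rfl, h⟩ := h
      simpa using h
    · rintro ⟨i, a⟩
      have hi : i < j := by
        by_contra h
        have := hanti (not_lt.1 h)
        have := a.pos
        omega
      exact ⟨⟨⟨i, hi⟩, a⟩, rfl⟩
  rw [Module.finrank_eq_card_basis (b.reindex (Equiv.ofBijective _ hbij).symm)]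
  simp [Fintype.card_sigma, Finset.sum_range]

lemma inducedEnd_mk {E : Type*} [AddCommGroup E] [Module ℂ E] (T : Module.End ℂ E)
    (W W' : Submodule ℂ E) (hW : W ≤ W.comap T) (hW' : W' ≤ W'.comap T) (x : W) :
    inducedEnd T W W' hW hW' (Submodule.Quotient.mk x) =
      Submodule.Quotient.mk ⟨T x, hW x.2⟩ := rfl

lemma pow_mem_of_le_comap {E : Type*} [AddCommGroup E] [Module ℂ E] {T : Module.End ℂ E}
    {W : Submodule ℂ E} (hW : W ≤ W.comap T) (r : ℕ) {x : E} (hx : x ∈ W) : (T ^ r) x ∈ W := by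
  induction r with
  | zero => simpa
  | succ r ih => rw [pow_succ', Module.End.mul_apply]; exact hW ih

lemma inducedEnd_pow_mk {E : Type*} [AddCommGroup E] [Module ℂ E] (T : Module.End ℂ E)
    (W W' : Submodule ℂ E) (hW : W ≤ W.comap T) (hW' : W' ≤ W'.comap T) (r : ℕ) (x : W) :
    (inducedEnd T W W' hW hW' ^ r) (Submodule.Quotient.mk x) =
      Submodule.Quotient.mk ⟨(T ^ r) x, pow_mem_of_le_comap hW r x.2⟩ := by
  induction r with
  | zero => simp
  | succ r ih =>
    rw [pow_succ', Module.End.mul_apply, ih, inducedEnd_mk]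
    simp [pow_succ', Module.End.mul_apply]

lemma sum_rectangle (r m j : ℕ) : ∑ i ∈ Finset.range j, rectangle r m i = min j m * r := by
  induction j with
  | zero => simp
  | succ j ih =>
    rw [Finset.sum_range_succ, ih, rectangle]
    split_ifs with h
    · rw [min_eq_left h.le, min_eq_left (by omega)]; ring
    · rw [min_eq_right (by omega), min_eq_right (by omega)]; ring

/-- Dominance at the first partial sum already bounds every block by r. Conversely, if all blocks
are at most r, a sum of j parts is at most jr, and it never exceeds the total dimension mr. The
dimension hypothesis is what makes the partial sums beyond m harmless. -/
lemma jordanTypeLE_rectangle_iff_pow_eq_zero {V : Type*} [AddCommGroup V] [Module ℂ V]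
    [FiniteDimensional ℂ V] (T : Module.End ℂ V) (r m : ℕ) (hV : Module.finrank ℂ V = m * r) :
    JordanTypeLE T (rectangle r m) ↔ T ^ r = 0 := by
  constructor
  · rintro ⟨kap, ⟨hanti, b, h0, h1⟩, hdom⟩
    -- For m = 0 the first part of the rectangle is 0, which is still at most r.
    have hk : kap 0 ≤ r := by
      have := hdom 1
      simp only [Finset.sum_range_one, rectangle] at this
      split_ifs at this <;> omega
    refine b.ext ?_
    rintro ⟨i, j, hj⟩
    rw [jordan_pow_apply h0 h1, if_neg (by have := hanti (Nat.zero_le i); omega)]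
    rfl
  · intro hT
    obtain ⟨kap, hkap⟩ := exists_hasJordanType T ⟨r, hT⟩
    refine ⟨kap, hkap, ?_⟩
    obtain ⟨hanti, b, h0, h1⟩ := hkap
    have hr : ∀ i, kap i ≤ r := by
      intro i
      by_contra h
      have := jordan_pow_apply h0 h1 r i r (not_le.1 h)
      rw [hT, if_pos le_rfl] at this
      exact b.ne_zero _ this.symm
    intro j
    rw [sum_rectangle]
    rcases le_total j m with h | h
    · rw [min_eq_left h]
      simpa using Finset.sum_le_sum (s := Finset.range j) fun i _ => hr i
    · rw [min_eq_right h, ← hV]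
      exact sum_range_le_finrank b j

lemma jordanTypeLE_inducedEnd_iff {E : Type*} [AddCommGroup E] [Module ℂ E] (T : Module.End ℂ E)
    (W W' : Submodule ℂ E) (hW : W ≤ W.comap T) (hW' : W' ≤ W'.comap T) (r m : ℕ)
    [FiniteDimensional ℂ (W ⧸ W'.submoduleOf W)]
    (hV : Module.finrank ℂ (W ⧸ W'.submoduleOf W) = m * r) :
    JordanTypeLE (inducedEnd T W W' hW hW') (rectangle r m) ↔ ∀ x ∈ W, (T ^ r) x ∈ W' := by
  rw [jordanTypeLE_rectangle_iff_pow_eq_zero _ _ _ hV]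
  constructor
  · intro h x hx
    have := inducedEnd_pow_mk T W W' hW hW' r ⟨x, hx⟩
    rw [h, LinearMap.zero_apply, eq_comm, Submodule.Quotient.mk_eq_zero] at this
    exact this
  · intro h
    ext x
    change (inducedEnd T W W' hW hW' ^ r) (Submodule.Quotient.mk x) = 0
    rw [inducedEnd_pow_mk, Submodule.Quotient.mk_eq_zero]
    exact h x x.2

end

/-! ### Linear constructions on subspaces are morphisms -/

/-- If `ψ(F) + S` has fixed dimension `m`, then near a given frame of `F` it has a basis whose
coordinates are polynomials in the coordinates of a frame of `F`. -/
lemma exists_polynomial_basis {X ι κ σ : Type*} [Fintype ι] [Fintype κ] (m n : ℕ)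
    (coord : Fin n × ι → σ) (A : Set X) (b : X → σ → ℂ)
    (ψ : (ι → ℂ) →ₗ[ℂ] (κ → ℂ)) (S : Submodule ℂ (κ → ℂ)) (G : X → Submodule ℂ (κ → ℂ))
    (hG : ∀ x ∈ A, G x =
      (Submodule.span ℂ (Set.range fun (r : Fin n) (c : ι) => b x (coord (r, c)))).map ψ ⊔ S)
    (hm : ∀ x ∈ A, Module.finrank ℂ (G x) = m) (x₀ : X) (hx₀ : x₀ ∈ A) :
    ∃ (Φ : Fin m × κ → MvPolynomial σ ℂ) (Q : MvPolynomial σ ℂ),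
      MvPolynomial.eval (b x₀) Q ≠ 0 ∧ ∀ x ∈ A, MvPolynomial.eval (b x) Q ≠ 0 →
        LinearIndependent ℂ (fun (r : Fin m) (c : κ) => MvPolynomial.eval (b x) (Φ (r, c))) ∧
        Submodule.span ℂ (Set.range
          (fun (r : Fin m) (c : κ) => MvPolynomial.eval (b x) (Φ (r, c)))) = G x := by
  classical
  obtain ⟨l, s, hs⟩ := Submodule.fg_iff_exists_fin_generating_family.1
    (IsNoetherian.noetherian S)
  -- Generators of ψ(F) + S: the images of the frame vectors, linear in the coordinates, followed by
  -- constant generators of S.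
  let u : Fin n ⊕ Fin l → κ → MvPolynomial σ ℂ := Sum.elim
    (fun r c => ∑ c', MvPolynomial.C (ψ (Pi.single c' 1) c) * MvPolynomial.X (coord (r, c')))
    (fun t c => MvPolynomial.C (s t c))
  let w : X → Fin n ⊕ Fin l → κ → ℂ := fun x t c => MvPolynomial.eval (b x) (u t c)
  have hw : ∀ x, w x = Sum.elim (fun r => ψ (fun c => b x (coord (r, c)))) s := by
    intro x
    ext t c
    rcases t with r | t
    · simp only [w, u, Sum.elim_inl, map_sum, map_mul, MvPolynomial.eval_C, MvPolynomial.eval_X]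
      conv_rhs => rw [← LinearMap.sum_single_apply (φ := fun _ : ι => ℂ)
        (fun c => b x (coord (r, c)))]
      rw [map_sum, Finset.sum_apply]
      refine Finset.sum_congr rfl fun c' _ => ?_
      have : (Pi.single c' (b x (coord (r, c'))) : ι → ℂ)
          = b x (coord (r, c')) • Pi.single c' 1 := by
        rw [← Pi.single_smul, smul_eq_mul, mul_one]
      rw [this, map_smul, Pi.smul_apply, smul_eq_mul, mul_comm]
    · simp [w, u]
  have hspan : ∀ x ∈ A, Submodule.span ℂ (Set.range (w x)) = G x := by
    intro x hx
    rw [hw, Set.Sum.elim_range, Submodule.span_union, hs, hG x hx, Submodule.map_span,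
      ← Set.range_comp]
    rfl
  -- Select a subfamily of the generators that is a basis at `x₀`. The same selection is used at
  -- nearby points.
  obtain ⟨τ, a, -, ha, hli⟩ := exists_linearIndependent' ℂ (w x₀)
  have : Finite τ := hli.finite
  have := Fintype.ofFinite τ
  have hcard : Fintype.card τ = m := by
    rw [← finrank_span_eq_card hli, ha, hspan x₀ hx₀, hm x₀ hx₀]
  let ε : Fin m ≃ τ := (Fintype.equivFinOfCardEq hcard).symm
  have hli' : LinearIndependent ℂ (fun t : Fin m => w x₀ (a (ε t))) :=
    hli.comp ε ε.injective
  -- Projecting by a left inverse of the basis at `x₀` produces a square matrix of polynomials that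
  -- is the identity at `x₀`. Where its determinant is nonzero the selected vectors are independent,
  -- and they span by the dimension hypothesis.
  obtain ⟨L, hL⟩ := LinearMap.exists_leftInverse_of_injective
    (Fintype.linearCombination ℂ (fun t : Fin m => w x₀ (a (ε t))))
    (LinearMap.ker_eq_bot.2 hli'.fintypeLinearCombination_injective)
  let D : Matrix (Fin m) (Fin m) (MvPolynomial σ ℂ) := Matrix.of fun t t' =>
    ∑ c, MvPolynomial.C (L (Pi.single c 1) t') * u (a (ε t)) c
  have hD : ∀ x, MvPolynomial.eval (b x) D.det =
      (Matrix.of fun t => L (w x (a (ε t)))).det := by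
    intro x
    rw [RingHom.map_det]
    congr 1
    ext t t'
    simp only [D, RingHom.mapMatrix_apply, Matrix.map_apply, Matrix.of_apply, map_sum, map_mul,
      MvPolynomial.eval_C]
    conv_rhs => rw [← LinearMap.sum_single_apply (φ := fun _ : κ => ℂ)
        (w x (a (ε t)))]
    rw [map_sum, Finset.sum_apply]
    refine Finset.sum_congr rfl fun c' _ => ?_
    have : (Pi.single c' (w x (a (ε t)) c') : κ → ℂ)
        = w x (a (ε t)) c' • Pi.single c' 1 := by
      rw [← Pi.single_smul, smul_eq_mul, mul_one]
    rw [this, map_smul, Pi.smul_apply, smul_eq_mul, mul_comm]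
  refine ⟨fun rc => u (a (ε rc.1)) rc.2, D.det, ?_, ?_⟩
  · rw [hD]
    have : (Matrix.of fun t => L (w x₀ (a (ε t)))) = 1 := by
      ext t t'
      have h := LinearMap.congr_fun hL (Pi.single t 1)
      rw [LinearMap.comp_apply, Fintype.linearCombination_apply_single, one_smul] at h
      rw [Matrix.of_apply, h, LinearMap.id_apply, Matrix.one_apply, Pi.single_apply]
      simp [eq_comm]
    rw [this, Matrix.det_one]
    exact one_ne_zero
  · intro x hx hQ
    rw [hD] at hQ
    have hind : LinearIndependent ℂ (fun t : Fin m => w x (a (ε t))) :=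
      LinearIndependent.of_comp L (Matrix.linearIndependent_rows_of_det_ne_zero hQ)
    refine ⟨hind, ?_⟩
    refine Submodule.eq_of_le_of_finrank_eq ?_ ?_
    · rw [← hspan x hx]
      apply Submodule.span_mono
      rintro _ ⟨t, rfl⟩
      exact ⟨a (ε t), rfl⟩
    · rw [hm x hx]
      exact (finrank_span_eq_card hind).trans (Fintype.card_fin m)

/-- A map between families of subspaces which is given by linear maps and sums with fixed
subspaces lifts locally to a polynomial map between frames. -/
lemma exists_polynomial_frame {X Y I J ι κ : Type*} [Finite J] [Fintype ι] [Fintype κ]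
    (F : X → I → Submodule ℂ (ι → ℂ)) (G : Y → J → Submodule ℂ (κ → ℂ)) (e : X → Y)
    (d' : J → ℕ) (hd' : ∀ y j, Module.finrank ℂ (G y j) = d' j)
    (h : ∀ j, ∃ (i : I) (ψ : (ι → ℂ) →ₗ[ℂ] (κ → ℂ)) (S : Submodule ℂ (κ → ℂ)),
      ∀ x, G (e x) j = (F x i).map ψ ⊔ S)
    (d : I → ℕ) (p : Frames Set.univ F d) :
    ∃ (Φ : FrameCoord J κ d' → MvPolynomial (FrameCoord I ι d) ℂ)
      (Q : MvPolynomial (FrameCoord I ι d) ℂ), MvPolynomial.eval p.1.2 Q ≠ 0 ∧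
      ∀ q : Frames Set.univ F d, MvPolynomial.eval q.1.2 Q ≠ 0 →
        IsFrame (G (e q.1.1)) (fun c => MvPolynomial.eval q.1.2 (Φ c)) := by
  choose i ψ S hS using h
  have := Fintype.ofFinite J
  choose Φ Q hQ hΦ using fun j => exists_polynomial_basis (d' j) (d (i j))
    (fun rc => (⟨i j, rc⟩ : FrameCoord I ι d)) Set.univ
    (fun q : Frames Set.univ F d => q.1.2) (ψ j) (S j) (fun q => G (e q.1.1) j)
    (fun q _ => by rw [hS j, ← (q.2.2 (i j)).2]) (fun q _ => hd' _ _) p trivial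
  refine ⟨fun c => Φ c.1 c.2, ∏ j, Q j, ?_, ?_⟩
  · rw [map_prod]
    exact Finset.prod_ne_zero_iff.2 fun j _ => hQ j
  · intro q hq j
    rw [map_prod] at hq
    exact hΦ j q trivial (Finset.prod_ne_zero_iff.1 hq j (Finset.mem_univ j))

lemma continuous_zariski_eval {σ τ : Type*} (Φ : τ → MvPolynomial σ ℂ) :
    @Continuous _ _ (zariski σ) (zariski τ) (fun x c => MvPolynomial.eval x (Φ c)) := by
  refine (@continuous_generateFrom_iff _ _ _ (zariski σ) _).2 ?_
  rintro _ ⟨P, rfl⟩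
  refine TopologicalSpace.isOpen_generateFrom_of_mem ⟨MvPolynomial.bind₁ Φ P, ?_⟩
  ext x
  simp only [Set.mem_preimage, Set.mem_ofPred_eq, MvPolynomial.eval, MvPolynomial.eval₂Hom_bind₁]

lemma eval_bind₁_eq {σ τ : Type*} (Φ : τ → MvPolynomial σ ℂ) (x : σ → ℂ)
    (P : MvPolynomial τ ℂ) : MvPolynomial.eval x (MvPolynomial.bind₁ Φ P) =
      MvPolynomial.eval (fun c => MvPolynomial.eval x (Φ c)) P := by
  simp only [MvPolynomial.eval, MvPolynomial.eval₂Hom_bind₁]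

lemma isOpen_grassmannTopology_iff {X I ι : Type*} (A : Set X)
    (F : X → I → Submodule ℂ (ι → ℂ)) (U : Set X) :
    IsOpen[grassmannTopology A F] U ↔ ∀ d : I → ℕ, ∃ O : Set (FrameCoord I ι d → ℂ),
      IsOpen[zariski _] O ∧ ∀ p : Frames A F d, p.1.1 ∈ U ↔ p.1.2 ∈ O := by
  rw [grassmannTopology, isOpen_iSup_iff]
  refine forall_congr' fun d => ?_
  rw [isOpen_coinduced]
  refine (@isOpen_induced_iff _ _ (zariski _) _ _).trans ?_
  refine exists_congr fun O => and_congr_right fun _ => ?_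
  rw [Set.ext_iff]
  exact forall_congr' fun p => iff_comm

/-- Openness is tested on frames. Around each frame over the preimage, the polynomial lift pulls the
open condition on target frames back to an open condition on source frames, and these neighbourhoods
are glued. -/
lemma isOpen_preimage_of_linear {X Y I J ι κ : Type*} [Finite J] [Fintype ι] [Fintype κ]
    (F : X → I → Submodule ℂ (ι → ℂ)) (G : Y → J → Submodule ℂ (κ → ℂ)) (e : X → Y)
    (d' : J → ℕ) (hd' : ∀ y j, Module.finrank ℂ (G y j) = d' j)
    (h : ∀ j, ∃ (i : I) (ψ : (ι → ℂ) →ₗ[ℂ] (κ → ℂ)) (S : Submodule ℂ (κ → ℂ)),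
      ∀ x, G (e x) j = (F x i).map ψ ⊔ S)
    {U : Set Y}
    (hU : IsOpen[grassmannTopology Set.univ G] U) :
    IsOpen[grassmannTopology Set.univ F] (e ⁻¹' U) := by
  obtain ⟨O, hO, hOU⟩ := (isOpen_grassmannTopology_iff _ _ _).1 hU d'
  refine (isOpen_grassmannTopology_iff _ _ _).2 fun d => ?_
  choose Φ Q hQ hΦ using exists_polynomial_frame F G e d' hd' h d
  refine ⟨⋃ p : {p : Frames Set.univ F d // e p.1.1 ∈ U},
    {x | MvPolynomial.eval x (Q p) ≠ 0} ∩
      (fun x c => MvPolynomial.eval x (Φ p c)) ⁻¹' O, ?_, ?_⟩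
  · refine @isOpen_iUnion _ _ (zariski _) _ fun p => @IsOpen.inter _ (zariski _) _ _ ?_ ?_
    · exact TopologicalSpace.isOpen_generateFrom_of_mem ⟨Q p, rfl⟩
    · exact @IsOpen.preimage _ _ (zariski _) (zariski _) _ (continuous_zariski_eval _) _ hO
  · intro q
    have key : ∀ p : Frames Set.univ F d, MvPolynomial.eval q.1.2 (Q p) ≠ 0 →
        (e q.1.1 ∈ U ↔ (fun c => MvPolynomial.eval q.1.2 (Φ p c)) ∈ O) := fun p hp =>
      hOU ⟨(e q.1.1, _), trivial, hΦ p q hp⟩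
    simp only [Set.mem_preimage, Set.mem_iUnion, Set.mem_inter_iff, Set.mem_ofPred_eq]
    constructor
    · intro hq
      exact ⟨⟨q, hq⟩, hQ q, (key q (hQ q)).1 hq⟩
    · rintro ⟨p, hp, hpO⟩
      exact (key p hp).2 hpO

/-- Substitute the local polynomial lift of frames into a local fraction. -/
lemma grassmannRegular_comp_of_linear {X Y I J ι κ : Type*} [Finite J] [Fintype ι] [Fintype κ]
    (F : X → I → Submodule ℂ (ι → ℂ)) (G : Y → J → Submodule ℂ (κ → ℂ)) (e : X → Y)
    (d' : J → ℕ) (hd' : ∀ y j, Module.finrank ℂ (G y j) = d' j)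
    (h : ∀ j, ∃ (i : I) (ψ : (ι → ℂ) →ₗ[ℂ] (κ → ℂ)) (S : Submodule ℂ (κ → ℂ)),
      ∀ x, G (e x) j = (F x i).map ψ ⊔ S)
    {U : Set Y} {f : Y → ℂ}
    (hf : grassmannRegular Set.univ G U f) :
    grassmannRegular Set.univ F (e ⁻¹' U) (f ∘ e) := by
  intro d p hp
  obtain ⟨Φ, Q, hQ, hΦ⟩ := exists_polynomial_frame F G e d' hd' h d p
  obtain ⟨P', Q', hQ', hf'⟩ := hf d' ⟨(e p.1.1, _), trivial, hΦ p hQ⟩ hp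
  -- The common factor `Q` does not change the quotient, but confines it to the locus where `Φ`
  -- really produces a frame.
  refine ⟨Q * MvPolynomial.bind₁ Φ P', Q * MvPolynomial.bind₁ Φ Q', ?_, ?_⟩
  · rw [map_mul, eval_bind₁_eq]
    exact mul_ne_zero hQ hQ'
  · intro q hq hqQ
    rw [map_mul, eval_bind₁_eq] at hqQ
    have hQq := left_ne_zero_of_mul hqQ
    rw [map_mul, map_mul, eval_bind₁_eq, eval_bind₁_eq, mul_div_mul_left _ _ hQq]
    exact hf' ⟨(e q.1.1, _), trivial, hΦ q hQq⟩ hq (right_ne_zero_of_mul hqQ)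



/-- A bijection between families of subspaces which is given by linear maps and sums with fixed
subspaces in both directions identifies the topologies and the regular functions. -/
lemma grassmann_iff_of_linear {X Y I J ι κ : Type*} [Finite I] [Finite J] [Fintype ι] [Fintype κ]
    (F : X → I → Submodule ℂ (ι → ℂ)) (G : Y → J → Submodule ℂ (κ → ℂ)) (e : X ≃ Y)
    (d : I → ℕ) (hd : ∀ x i, Module.finrank ℂ (F x i) = d i)
    (d' : J → ℕ) (hd' : ∀ y j, Module.finrank ℂ (G y j) = d' j)
    (h : ∀ j, ∃ (i : I) (ψ : (ι → ℂ) →ₗ[ℂ] (κ → ℂ)) (S : Submodule ℂ (κ → ℂ)),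
      ∀ x, G (e x) j = (F x i).map ψ ⊔ S)
    (h' : ∀ i, ∃ (j : J) (ψ : (κ → ℂ) →ₗ[ℂ] (ι → ℂ)) (S : Submodule ℂ (ι → ℂ)),
      ∀ y, F (e.symm y) i = (G y j).map ψ ⊔ S) (U : Set Y) :
    (IsOpen[grassmannTopology Set.univ G] U ↔
      IsOpen[grassmannTopology Set.univ F] (e ⁻¹' U)) ∧
    ∀ f : Y → ℂ, grassmannRegular Set.univ G U f ↔
      grassmannRegular Set.univ F (e ⁻¹' U) (f ∘ e) := by
  have hU : e.symm ⁻¹' (e ⁻¹' U) = U := by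
    ext y
    simp
  refine ⟨⟨isOpen_preimage_of_linear F G e d' hd' h, fun hO => ?_⟩,
    fun f => ⟨grassmannRegular_comp_of_linear F G e d' hd' h, fun hf => ?_⟩⟩
  · have := isOpen_preimage_of_linear G F e.symm d hd h' hO
    rwa [hU] at this
  · have := grassmannRegular_comp_of_linear G F e.symm d hd h' hf
    have hfe : (f ∘ e) ∘ e.symm = f := by
      ext y
      simp
    rwa [hU, hfe] at this

/-- For the truncation levels that contain no point of the fiber, where openness and regularity
impose nothing. -/
lemma isOpen_grassmannTopology_empty {X I ι : Type*} (F : X → I → Submodule ℂ (ι → ℂ))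
    (U : Set X) : IsOpen[grassmannTopology ∅ F] U := by
  rw [isOpen_grassmannTopology_iff]
  exact fun d => ⟨∅, @isOpen_empty _ (zariski _), fun p => p.2.1.elim⟩

lemma grassmannRegular_empty {X I ι : Type*} (F : X → I → Submodule ℂ (ι → ℂ))
    (U : Set X) (f : X → ℂ) : grassmannRegular ∅ F U f := fun _ p => p.2.1.elim

/-! ### Images and kernels of powers, and the submodule of Jordan type ν -/

section JordanChains

variable {V : Type*} [AddCommGroup V] [Module ℂ V] {T : Module.End ℂ V} {lam : ℕ → ℕ}
  (b : Module.Basis (Σ i : ℕ, Fin (lam i)) ℂ V)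
  (h0 : ∀ (i : ℕ) (h : 0 < lam i), T (b ⟨i, ⟨0, h⟩⟩) = 0)
  (h1 : ∀ (i j : ℕ) (h : j + 1 < lam i),
    T (b ⟨i, ⟨j + 1, h⟩⟩) = b ⟨i, ⟨j, (Nat.lt_succ_self j).trans h⟩⟩)

include h0 h1

/-- The power shifts each chain down by r, so on coordinates it acts as a shift up. -/
lemma jordan_repr_pow (r i j : ℕ) (h : j + r < lam i) (x : V) :
    b.repr ((T ^ r) x) ⟨i, ⟨j, (Nat.le_add_right j r).trans_lt h⟩⟩ = b.repr x ⟨i, ⟨j + r, h⟩⟩ := by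
  classical
  have : (b.coord ⟨i, ⟨j, (Nat.le_add_right j r).trans_lt h⟩⟩) ∘ₗ (T ^ r) =
      b.coord ⟨i, ⟨j + r, h⟩⟩ := by
    refine b.ext ?_
    rintro ⟨i', j', hj'⟩
    rw [LinearMap.comp_apply, jordan_pow_apply h0 h1]
    simp only [Module.Basis.coord_apply, Module.Basis.repr_self]
    split_ifs with hr
    · simp only [Module.Basis.repr_self, Finsupp.single_apply]
      refine if_congr ?_ rfl rfl
      constructor
      · intro h
        simp only [Sigma.mk.injEq] at h
        obtain ⟨rfl, h⟩ := h
        simp only [heq_eq_eq, Fin.mk.injEq] at h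
        simp
        omega
      · intro h
        simp only [Sigma.mk.injEq] at h
        obtain ⟨rfl, h⟩ := h
        simp only [heq_eq_eq, Fin.mk.injEq] at h
        simp
        omega
    · rw [map_zero, Finsupp.zero_apply, Finsupp.single_apply, if_neg]
      intro h
      simp only [Sigma.mk.injEq] at h
      obtain ⟨rfl, h⟩ := h
      simp only [heq_eq_eq, Fin.mk.injEq] at h
      omega
  exact LinearMap.congr_fun this x

lemma jordan_ker_pow_le (r : ℕ) :
    LinearMap.ker (T ^ r) ≤ Submodule.span ℂ {x | ∃ i j, ∃ h : j < lam i, j < r ∧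
      b ⟨i, ⟨j, h⟩⟩ = x} := by
  intro x hx
  rw [LinearMap.mem_ker] at hx
  rw [← b.linearCombination_repr x, Finsupp.linearCombination_apply, Finsupp.sum]
  refine Submodule.sum_mem _ ?_
  rintro ⟨i, j, hj⟩ -
  by_cases hjr : j < r
  · exact Submodule.smul_mem _ _ (Submodule.subset_span ⟨i, j, hj, hjr, rfl⟩)
  · have hj' : j - r + r = j := by omega
    have := jordan_repr_pow b h0 h1 r i (j - r) (by omega) x
    simp only [hx, map_zero, Finsupp.zero_apply, hj'] at this
    rw [← this, zero_smul]
    exact zero_mem _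

lemma jordan_range_pow (r : ℕ) :
    LinearMap.range (T ^ r) = Submodule.span ℂ {x | ∃ i j, ∃ h : j < lam i, j + r < lam i ∧
      b ⟨i, ⟨j, h⟩⟩ = x} := by
  apply le_antisymm
  · rw [LinearMap.range_eq_map, ← b.span_eq, Submodule.map_span, Submodule.span_le]
    rintro _ ⟨_, ⟨⟨i, j, hj⟩, rfl⟩, rfl⟩
    rw [jordan_pow_apply h0 h1]
    split_ifs with h
    · exact Submodule.subset_span ⟨i, j - r, _, by omega, rfl⟩
    · exact zero_mem _
  · rw [Submodule.span_le]
    rintro _ ⟨i, j, h, hj, rfl⟩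
    refine ⟨b ⟨i, ⟨j + r, hj⟩⟩, ?_⟩
    rw [jordan_pow_apply h0 h1, if_pos (by omega)]
    simp

/-- A chain of length `lam i` leaves its lowest `lam i - r` vectors in the image. -/
lemma finrank_range_jordan_pow (hanti : Antitone lam) {k : ℕ} (hk : lam k = 0) (r : ℕ) :
    Module.finrank ℂ (LinearMap.range (T ^ r)) = ∑ i ∈ Finset.range k, (lam i - r) := by
  let g : (Σ i : Fin k, Fin (lam i - r)) → Σ i : ℕ, Fin (lam i) :=
    fun x => ⟨x.1, ⟨x.2, x.2.2.trans_le (Nat.sub_le _ _)⟩⟩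
  have hg : Function.Injective g := by
    rintro ⟨i, j⟩ ⟨i', j'⟩ h
    simp only [g, Sigma.mk.injEq, Fin.val_inj] at h
    obtain ⟨rfl, h⟩ := h
    simp only [heq_eq_eq, Fin.mk.injEq, Fin.val_inj] at h
    rw [h]
  have hs : {x | ∃ i j, ∃ h : j < lam i, j + r < lam i ∧ b ⟨i, ⟨j, h⟩⟩ = x} =
      Set.range (b ∘ g) := by
    ext x
    constructor
    · rintro ⟨i, j, h, hj, rfl⟩
      have hi : i < k := by
        by_contra hi
        have := hanti (not_lt.1 hi)
        omega
      exact ⟨⟨⟨i, hi⟩, ⟨j, by simp only; omega⟩⟩, rfl⟩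
    · rintro ⟨⟨i, j⟩, rfl⟩
      exact ⟨i, j, _, by have := j.2; omega, rfl⟩
  rw [jordan_range_pow b h0 h1, hs,
    finrank_span_eq_card (b.linearIndependent.comp g hg)]
  simp [Fintype.card_sigma, Finset.sum_range]

end JordanChains

/-- A module of Jordan type `((u + (lam_i - r)^+)_i)` embeds into a module of Jordan type `lam`
as the set of `x` such that `T^u x` is in the image of `T^r`. -/
lemma exists_jordan_embedding {V V₀ : Type*} [AddCommGroup V] [Module ℂ V] [AddCommGroup V₀]
    [Module ℂ V₀] {T : Module.End ℂ V} {T₀ : Module.End ℂ V₀} {lam nu : ℕ → ℕ} {k u r : ℕ}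
    (hT : HasJordanType T lam) (hT₀ : HasJordanType T₀ nu) (hk : lam k = 0)
    (hnu : ∀ i < k, nu i = u + (lam i - r)) (hnu' : ∀ i, k ≤ i → nu i = 0) (hur : u ≤ r)
    (hu : ∀ i < k, u ≤ lam i) :
    ∃ σ : V₀ →ₗ[ℂ] V, Function.Injective σ ∧ (∀ x, T (σ x) = σ (T₀ x)) ∧
      (∀ x, (T ^ u) x ∈ LinearMap.range (T ^ r) → x ∈ LinearMap.range σ) ∧
      (∀ x, (T ^ r) x ∈ (LinearMap.range (T₀ ^ u)).map σ) ∧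
      (∀ z, σ ((T₀ ^ u) z) ∈ LinearMap.range (T ^ r)) := by
  obtain ⟨hanti, b, h0, h1⟩ := hT
  obtain ⟨-, t, t0, t1⟩ := hT₀
  -- Each chain of `T₀` is to be the bottom part of a chain of `T`, so it must fit: u ≤ λ_i covers
  -- λ_i ≤ r, and u ≤ r covers the other case.
  have hle : ∀ i, nu i ≤ lam i := by
    intro i
    by_cases hi : i < k
    · have := hu i hi
      rw [hnu i hi]
      omega
    · rw [hnu' i (not_lt.1 hi)]
      exact Nat.zero_le _
  have hlt : ∀ i, 0 < lam i → i < k := by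
    intro i h
    by_contra hi
    have := hanti (not_lt.1 hi)
    omega
  let g : (Σ i : ℕ, Fin (nu i)) → Σ i : ℕ, Fin (lam i) :=
    fun x => ⟨x.1, ⟨x.2, x.2.2.trans_le (hle _)⟩⟩
  have hg : Function.Injective g := by
    rintro ⟨i, j⟩ ⟨i', j'⟩ h
    simp only [g, Sigma.mk.injEq] at h
    obtain ⟨rfl, h⟩ := h
    simp only [heq_eq_eq, Fin.mk.injEq, Fin.val_inj] at h
    rw [h]
  let σ : V₀ →ₗ[ℂ] V := t.constr ℂ (b ∘ g)
  have hσ : ∀ i j (h : j < nu i), σ (t ⟨i, ⟨j, h⟩⟩) = b ⟨i, ⟨j, h.trans_le (hle i)⟩⟩ :=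
    fun i j h => t.constr_basis ℂ _ _
  have hinj : Function.Injective σ := by
    have h : LinearIndependent ℂ (b ∘ g) := b.linearIndependent.comp g hg
    rw [linearIndependent_iff_injective_finsuppLinearCombination] at h
    intro x y hxy
    simp only [σ, Module.Basis.constr_apply, ← Finsupp.linearCombination_apply] at hxy
    exact t.repr.injective (h hxy)
  have hcomm : ∀ x, T (σ x) = σ (T₀ x) := by
    intro x
    refine LinearMap.congr_fun (f := T ∘ₗ σ) (g := σ ∘ₗ T₀) (t.ext ?_) x
    rintro ⟨i, j, hj⟩
    rw [LinearMap.comp_apply, LinearMap.comp_apply, hσ]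
    cases j with
    | zero => rw [h0, t0, map_zero]
    | succ j => rw [h1, t1, hσ]
  have hcommp : ∀ p x, (T ^ p) (σ x) = σ ((T₀ ^ p) x) := by
    intro p x
    induction p with
    | zero => rfl
    | succ p ih => rw [pow_succ', pow_succ', Module.End.mul_apply, Module.End.mul_apply, ih, hcomm]
  have he : ∀ x, (T ^ r) x ∈ (LinearMap.range (T₀ ^ u)).map σ := by
    intro x
    have hx : (T ^ r) x ∈ LinearMap.range (T ^ r) := ⟨x, rfl⟩
    rw [jordan_range_pow b h0 h1] at hx
    refine Submodule.span_le.2 ?_ hx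
    rintro _ ⟨i, j, h, hj, rfl⟩
    have hi : j + u < nu i := by
      rw [hnu i (hlt i (by omega))]
      omega
    refine ⟨t ⟨i, ⟨j, by omega⟩⟩, ⟨t ⟨i, ⟨j + u, hi⟩⟩, ?_⟩, hσ _ _ _⟩
    rw [jordan_pow_apply t0 t1, if_pos (by omega)]
    simp
  refine ⟨σ, hinj, hcomm, ?_, he, ?_⟩
  · rintro x ⟨y, hy⟩
    obtain ⟨_, ⟨z, rfl⟩, hz⟩ := he y
    -- Correct x by z with the same u-th power. The difference lies in the kernel of T^u, spanned by
    -- the chain vectors at heights below u, all of which lie in the image of `σ` because every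
    -- chain of `T₀` has length at least u.
    have hker : x - σ z ∈ LinearMap.ker (T ^ u) := by
      rw [LinearMap.mem_ker, map_sub, hcommp, hz, hy, sub_self]
    have hr : x - σ z ∈ LinearMap.range σ := by
      refine Submodule.span_le.2 ?_ (jordan_ker_pow_le b h0 h1 u hker)
      rintro _ ⟨i, j, h, hj, rfl⟩
      have hi : j < nu i := by
        rw [hnu i (hlt i (by omega))]
        omega
      exact ⟨_, hσ i j hi⟩
    have := add_mem hr (LinearMap.mem_range_self σ z)
    rwa [sub_add_cancel] at this
  · intro z
    have : σ ((T₀ ^ u) z) ∈ (LinearMap.range (T₀ ^ u)).map σ := ⟨_, ⟨z, rfl⟩, rfl⟩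
    rw [jordan_range_pow t t0 t1, Submodule.map_span] at this
    refine Submodule.span_le.2 ?_ this
    rintro _ ⟨_, ⟨i, j, h, hj, rfl⟩, rfl⟩
    have hi : i < k := hlt i ((Nat.zero_le j).trans_lt (h.trans_le (hle i)))
    rw [hnu i hi] at hj
    refine ⟨b ⟨i, ⟨j + r, by omega⟩⟩, ?_⟩
    rw [hσ, jordan_pow_apply h0 h1, if_pos (by omega)]
    simp

/-- A `T`-stable subspace of dimension `dim R + u` containing the stable subspace `R` is mapped
into `R` by `T^u`. -/
lemma pow_mem_of_finrank {V : Type*} [AddCommGroup V] [Module ℂ V] [FiniteDimensional ℂ V]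
    {T : Module.End ℂ V} (hT : IsNilpotent T) {R W : Submodule ℂ V} (hRW : R ≤ W)
    (hR : R ≤ R.comap T) (hW : W ≤ W.comap T) {u : ℕ}
    (hu : Module.finrank ℂ W = Module.finrank ℂ R + u) : ∀ x ∈ W, (T ^ u) x ∈ R := by
  intro x hx
  have hq : Module.finrank ℂ (W ⧸ R.submoduleOf W) = u := by
    have h1 := (R.submoduleOf W).finrank_quotient_add_finrank
    have h2 := (Submodule.submoduleOfEquivOfLe hRW).finrank_eq
    omega
  obtain ⟨m, hm⟩ := hT
  have hnil : IsNilpotent (inducedEnd T W R hW hR) := by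
    refine ⟨m, LinearMap.ext fun y => ?_⟩
    obtain ⟨y, rfl⟩ := Submodule.Quotient.mk_surjective _ y
    rw [inducedEnd_pow_mk, LinearMap.zero_apply, Submodule.Quotient.mk_eq_zero]
    change (T ^ m) (y : V) ∈ R
    rw [hm]
    exact zero_mem _
  -- Cayley–Hamilton: a nilpotent operator on a u-dimensional space has characteristic polynomial
  -- X^u.
  have h0 : inducedEnd T W R hW hR ^ u = 0 := by
    have := LinearMap.aeval_self_charpoly (inducedEnd T W R hW hR)
    rwa [(LinearMap.isNilpotent_iff_charpoly _).1 hnil, map_pow, Polynomial.aeval_X, hq] at this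
  have := inducedEnd_pow_mk T W R hW hR u ⟨x, hx⟩
  rw [h0, LinearMap.zero_apply, eq_comm, Submodule.Quotient.mk_eq_zero] at this
  exact this

/-! ### Subquotients, and lifting the embedding to the ambient space -/

section Quotients

variable {E : Type*} [AddCommGroup E] [Module ℂ E]

lemma eq_of_map_mkQ_eq {P' A B : Submodule ℂ E} (hA : P' ≤ A) (hB : P' ≤ B)
    (h : A.map P'.mkQ = B.map P'.mkQ) : A = B := by
  have := congrArg (Submodule.comap P'.mkQ) h
  rwa [Submodule.comap_map_mkQ, Submodule.comap_map_mkQ, sup_eq_right.2 hA, sup_eq_right.2 hB]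
    at this

lemma eq_of_le_of_finrank_map_mkQ_eq {P' A B : Submodule ℂ E}
    [FiniteDimensional ℂ (B.map P'.mkQ)] (hA : P' ≤ A) (hAB : A ≤ B)
    (h : Module.finrank ℂ (A.map P'.mkQ) = Module.finrank ℂ (B.map P'.mkQ)) : A = B :=
  eq_of_map_mkQ_eq hA (hA.trans hAB)
    (Submodule.eq_of_le_of_finrank_eq (Submodule.map_mono hAB) h)

/-- The subquotient `W / W'`, for `P' ≤ W' ≤ W`, as a quotient of images in `E / P'`. -/
lemma exists_equiv_subquotient {P' W' W : Submodule ℂ E} (hP' : P' ≤ W') :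
    Nonempty ((W ⧸ W'.submoduleOf W) ≃ₗ[ℂ]
      ((W.map P'.mkQ) ⧸ (W'.map P'.mkQ).submoduleOf (W.map P'.mkQ))) := by
  let f : W →ₗ[ℂ] W.map P'.mkQ := P'.mkQ.restrict fun x hx => Submodule.mem_map_of_mem hx
  let g := ((W'.map P'.mkQ).submoduleOf (W.map P'.mkQ)).mkQ ∘ₗ f
  have hf : Function.Surjective f := by
    rintro ⟨_, x, hx, rfl⟩
    exact ⟨⟨x, hx⟩, rfl⟩
  have hker : LinearMap.ker g = W'.submoduleOf W := by
    ext x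
    rw [LinearMap.mem_ker, LinearMap.comp_apply, Submodule.mkQ_apply, Submodule.Quotient.mk_eq_zero]
    change P'.mkQ x ∈ W'.map P'.mkQ ↔ (x : E) ∈ W'
    rw [← Submodule.mem_comap, Submodule.comap_map_mkQ, sup_eq_right.2 hP']
  rw [← hker]
  exact ⟨g.quotKerEquivOfSurjective ((Submodule.mkQ_surjective _).comp hf)⟩

lemma finiteDimensional_subquotient {P' W' W : Submodule ℂ E} (hP' : P' ≤ W')
    [FiniteDimensional ℂ (W.map P'.mkQ)] : FiniteDimensional ℂ (W ⧸ W'.submoduleOf W) := by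
  obtain ⟨e⟩ := exists_equiv_subquotient (W := W) hP'
  exact e.symm.finiteDimensional

lemma finrank_subquotient {P' W' W : Submodule ℂ E} (hP' : P' ≤ W') (hW : W' ≤ W)
    [FiniteDimensional ℂ (W.map P'.mkQ)] :
    Module.finrank ℂ (W ⧸ W'.submoduleOf W) + Module.finrank ℂ (W'.map P'.mkQ) =
      Module.finrank ℂ (W.map P'.mkQ) := by
  obtain ⟨e⟩ := exists_equiv_subquotient (W := W) hP'
  have h1 := ((W'.map P'.mkQ).submoduleOf (W.map P'.mkQ)).finrank_quotient_add_finrank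
  have h2 := (Submodule.submoduleOfEquivOfLe (Submodule.map_mono (f := P'.mkQ) hW)).finrank_eq
  rw [e.finrank_eq]
  omega

/-- The dimension of `W / P'` computed in `P / P'`. -/
lemma finrank_map_submoduleOf {P' W P : Submodule ℂ E} (hW : W ≤ P) :
    Module.finrank ℂ ((W.submoduleOf P).map (P'.submoduleOf P).mkQ) =
      Module.finrank ℂ (W.map P'.mkQ) := by
  let ι : (P ⧸ P'.submoduleOf P) →ₗ[ℂ] E ⧸ P' := (P'.submoduleOf P).mapQ P' P.subtype le_rfl
  have hι : Function.Injective ι := by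
    rw [← LinearMap.ker_eq_bot]
    exact Submodule.ker_liftQ_eq_bot _ _ _ (by
      intro x hx
      rwa [LinearMap.mem_ker, LinearMap.comp_apply, Submodule.mkQ_apply,
        Submodule.Quotient.mk_eq_zero] at hx)
  have : ((W.submoduleOf P).map (P'.submoduleOf P).mkQ).map ι = W.map P'.mkQ := by
    rw [← Submodule.map_comp, show ι ∘ₗ (P'.submoduleOf P).mkQ = P'.mkQ ∘ₗ P.subtype from
      Submodule.mapQ_mkQ _ _ _, Submodule.map_comp]
    congr 1
    rw [Submodule.submoduleOf, Submodule.map_comap_subtype, inf_eq_right.2 hW]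
  rw [← this]
  exact ((Submodule.equivMapOfInjective ι hι _).finrank_eq)

end Quotients

/-- A lift to `P` of an embedding of `V₀` in `P / P'` which identifies the stable subspaces of
dimension `n` of `P / P'` which contain the image of `T^r` with those of `V₀` which contain the
image of `T₀^u`. -/
structure JordanSection {E V₀ : Type*} [AddCommGroup E] [Module ℂ E] [AddCommGroup V₀]
    [Module ℂ V₀] (T : Module.End ℂ E) (P P' : Submodule ℂ E) (T₀ : Module.End ℂ V₀) (n r u : ℕ)
    (σ : V₀ →ₗ[ℂ] E) : Prop where
  mem : ∀ x, σ x ∈ P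
  eq_zero : ∀ x, σ x ∈ P' → x = 0
  comm : ∀ x, T (σ x) - σ (T₀ x) ∈ P'
  le : ∀ W : Submodule ℂ E, P' ≤ W → W ≤ P → W ≤ W.comap T →
    Module.finrank ℂ (W.map P'.mkQ) = n → (∀ y ∈ P, (T ^ r) y ∈ W) → W ≤ LinearMap.range σ ⊔ P'
  iff : ∀ W : Submodule ℂ E, P' ≤ W → ((∀ y ∈ P, (T ^ r) y ∈ W) ↔ ∀ z, σ ((T₀ ^ u) z) ∈ W)

/-- Compose the Jordan embedding into P/P' with a linear section of P → P/P'. The section need not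
commute with T, so commutation holds only modulo P'. This suffices, because every subspace
considered contains P'. -/
lemma exists_jordanSection {E V₀ : Type*} [AddCommGroup E] [Module ℂ E] [AddCommGroup V₀]
    [Module ℂ V₀] {T : Module.End ℂ E} {P P' : Submodule ℂ E}
    [FiniteDimensional ℂ (P.map P'.mkQ)]
    (hP : P ≤ P.comap T) (hP'T : P' ≤ P'.comap T) {T₀ : Module.End ℂ V₀} {lam nu : ℕ → ℕ}
    {k u r n : ℕ} (hT : HasJordanType (inducedEnd T P P' hP hP'T) lam)
    (hnil : IsNilpotent (inducedEnd T P P' hP hP'T)) (hT₀ : HasJordanType T₀ nu)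
    (hk : lam k = 0) (hnu : ∀ i < k, nu i = u + (lam i - r)) (hnu' : ∀ i, k ≤ i → nu i = 0)
    (hur : u ≤ r) (hu : ∀ i < k, u ≤ lam i) (hn : n = ∑ i ∈ Finset.range k, (lam i - r) + u) :
    ∃ σ : V₀ →ₗ[ℂ] E, JordanSection T P P' T₀ n r u σ := by
  set Tq := inducedEnd T P P' hP hP'T with hTq
  have hfin : FiniteDimensional ℂ (P ⧸ P'.submoduleOf P) := finiteDimensional_subquotient le_rfl
  obtain ⟨τ, hinj, hcomm, hker, him, him'⟩ := exists_jordan_embedding hT hT₀ hk hnu hnu' hur hu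
  obtain ⟨s, hs⟩ := (P'.submoduleOf P).mkQ.exists_rightInverse_of_surjective
    (LinearMap.range_eq_top.2 (Submodule.mkQ_surjective _))
  let σ' : V₀ →ₗ[ℂ] P := s ∘ₗ τ
  have hσ' : ∀ x, (Submodule.Quotient.mk (σ' x) : P ⧸ P'.submoduleOf P) = τ x :=
    fun x => LinearMap.congr_fun hs (τ x)
  have hmem : ∀ (x y : P), (Submodule.Quotient.mk x : P ⧸ P'.submoduleOf P) =
      Submodule.Quotient.mk y ↔ (x : E) - y ∈ P' := fun x y =>
    (Submodule.Quotient.eq (P'.submoduleOf P))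
  have hiff : ∀ W : Submodule ℂ E, P' ≤ W →
      ((∀ y ∈ P, (T ^ r) y ∈ W) ↔ ∀ z, ((σ' ((T₀ ^ u) z) : P) : E) ∈ W) := by
    intro W hW
    constructor
    · intro h z
      obtain ⟨y, hy⟩ := him' z
      obtain ⟨y, rfl⟩ := Submodule.Quotient.mk_surjective _ y
      rw [hTq, inducedEnd_pow_mk, ← hσ', hmem] at hy
      have := sub_mem (h y y.2) (hW hy)
      simpa using this
    · intro h y hy
      obtain ⟨_, ⟨z, rfl⟩, hz⟩ := him (Submodule.Quotient.mk ⟨y, hy⟩)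
      rw [hTq, inducedEnd_pow_mk, ← hσ', hmem] at hz
      have := sub_mem (h z) (hW hz)
      simpa using this
  refine ⟨P.subtype ∘ₗ σ', fun x => (σ' x).2, ?_, ?_, ?_, hiff⟩
  · intro x hx
    apply hinj
    rw [← hσ', map_zero, Submodule.Quotient.mk_eq_zero]
    exact hx
  · intro x
    have := hcomm x
    rw [← hσ', ← hσ', hTq, inducedEnd_mk, hmem] at this
    exact this
  · intro W hW hWP hWT hdim hr x hx
    set Wq := (W.submoduleOf P).map (P'.submoduleOf P).mkQ with hWq
    have hmemW : ∀ y : P, (y : E) ∈ W → (Submodule.Quotient.mk y : P ⧸ P'.submoduleOf P) ∈ Wq :=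
      fun y hy => ⟨y, hy, rfl⟩
    -- dim W/P' exceeds the rank of T^r by exactly u, so T^u maps W/P' into the image of T^r, and
    -- the embedding contains all vectors with that property.
    have hpow := pow_mem_of_finrank hnil (R := LinearMap.range (Tq ^ r)) (W := Wq) (u := u)
      (by
        rintro _ ⟨y, rfl⟩
        obtain ⟨y, rfl⟩ := Submodule.Quotient.mk_surjective _ y
        rw [hTq, inducedEnd_pow_mk]
        exact hmemW _ (hr y y.2))
      (by
        rintro _ ⟨y, rfl⟩
        exact ⟨Tq y, by rw [← Module.End.mul_apply, ← pow_succ, pow_succ', Module.End.mul_apply]⟩)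
      (by
        rintro _ ⟨y, hy, rfl⟩
        exact hmemW ⟨T y, hP y.2⟩ (hWT hy))
      (by
        obtain ⟨hanti, b, h0, h1⟩ := hT
        rw [finrank_range_jordan_pow b h0 h1 hanti hk, hWq, finrank_map_submoduleOf hWP, hdim, hn])
    obtain ⟨z, hz⟩ := hker _ (hpow _ (hmemW ⟨x, hWP hx⟩ hx))
    rw [← hσ', hmem] at hz
    rw [← sub_sub_cancel ((σ' z : P) : E) x]
    exact sub_mem (Submodule.mem_sup_left ⟨z, rfl⟩) (Submodule.mem_sup_right hz)

/-! ### Transfer of flags between P/P' and the smaller space -/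

instance finite_flagIndex (M n : ℕ) : Finite (flagIndex M n) :=
  Set.Finite.to_subtype ((Set.finite_Iic M).subset (flagIndex_subset M n))

/-- `T`-stable flags between `P` and `P'`, of type `(K - n, 1^n)`, such that the second member
contains the image of `T^r`. -/
structure IsSubquotientFlag {E : Type*} [AddCommGroup E] [Module ℂ E] (T : Module.End ℂ E)
    (P P' : Submodule ℂ E) (K n r : ℕ) (L : flagIndex K n → Submodule ℂ E) : Prop where
  antitone : Antitone L
  first : L (flagIndex.first K n) = P
  le : ∀ i, P' ≤ L i
  finrank : ∀ i, Module.finrank ℂ ((L i).map P'.mkQ) = K - i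
  stable : ∀ i, L i ≤ (L i).comap T
  pow_mem : ∀ y ∈ P, (T ^ r) y ∈ L (flagIndex.second K n)

/-- `T`-stable flags in `V` of type `(M - n, 1^n)` such that the second member contains the image
of `T^u`. -/
structure IsStableFlag {V : Type*} [AddCommGroup V] [Module ℂ V] (T : Module.End ℂ V)
    (M n u : ℕ) (F : flagIndex M n → Submodule ℂ V) : Prop where
  antitone : Antitone F
  finrank : ∀ i, Module.finrank ℂ (F i) = M - i
  stable : ∀ i, F i ≤ (F i).comap T
  pow_mem : ∀ z, (T ^ u) z ∈ F (flagIndex.second M n)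

section Transfer

variable {E V : Type*} [AddCommGroup E] [Module ℂ E] [AddCommGroup V] [Module ℂ V]

lemma flagIndex_add {M n K : ℕ} (hMK : M ≤ K) {i : ℕ} (hi : i ∈ flagIndex M n)
    (h : M - n ≤ i) : i + (K - M) ∈ flagIndex K n := by
  refine Or.inr ?_
  have := flagIndex_subset M n hi
  simp only [Set.mem_ofPred_eq] at this
  omega

lemma flagIndex_sub {M n K : ℕ} (hnM : n ≤ M) (hMK : M ≤ K) {i : ℕ} (hi : i ∈ flagIndex K n)
    (h : K - n ≤ i) : i - (K - M) ∈ flagIndex M n := by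
  refine Or.inr ?_
  have := flagIndex_subset K n hi
  simp only [Set.mem_ofPred_eq] at this
  omega

lemma flagIndex_eq_zero {M n i : ℕ} (hi : i ∈ flagIndex M n) (h : ¬ M - n ≤ i) : i = 0 := by
  rcases hi with hi | hi
  · exact hi
  · exact absurd hi.1 h

/-- Pull back a flag in `P / P'` along `σ : V → P`. -/
def pullFlag (σ : V →ₗ[ℂ] E) {M n K : ℕ} (hMK : M ≤ K) (L : flagIndex K n → Submodule ℂ E)
    (i : flagIndex M n) : Submodule ℂ V :=
  if h : M - n ≤ i then (L ⟨i + (K - M), flagIndex_add hMK i.2 h⟩).comap σ else ⊤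

/-- Push forward a flag in `V` along `σ : V → P` to a flag between `P` and `P'`. -/
def pushFlag (σ : V →ₗ[ℂ] E) (P P' : Submodule ℂ E) {M n K : ℕ} (hnM : n ≤ M) (hMK : M ≤ K)
    (F : flagIndex M n → Submodule ℂ V) (i : flagIndex K n) : Submodule ℂ E :=
  if h : K - n ≤ i then (F ⟨i - (K - M), flagIndex_sub hnM hMK i.2 h⟩).map σ ⊔ P' else P

lemma pullFlag_of_le (σ : V →ₗ[ℂ] E) {M n K : ℕ} (hMK : M ≤ K)
    (L : flagIndex K n → Submodule ℂ E) {i : flagIndex M n} (h : M - n ≤ i) :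
    pullFlag σ hMK L i = (L ⟨i + (K - M), flagIndex_add hMK i.2 h⟩).comap σ := dif_pos h

lemma pullFlag_of_not_le (σ : V →ₗ[ℂ] E) {M n K : ℕ} (hMK : M ≤ K)
    (L : flagIndex K n → Submodule ℂ E) {i : flagIndex M n} (h : ¬ M - n ≤ i) :
    pullFlag σ hMK L i = ⊤ := dif_neg h

lemma pushFlag_of_le (σ : V →ₗ[ℂ] E) (P P' : Submodule ℂ E) {M n K : ℕ} (hnM : n ≤ M)
    (hMK : M ≤ K) (F : flagIndex M n → Submodule ℂ V) {i : flagIndex K n} (h : K - n ≤ i) :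
    pushFlag σ P P' hnM hMK F i =
      (F ⟨i - (K - M), flagIndex_sub hnM hMK i.2 h⟩).map σ ⊔ P' := dif_pos h

lemma pushFlag_of_not_le (σ : V →ₗ[ℂ] E) (P P' : Submodule ℂ E) {M n K : ℕ} (hnM : n ≤ M)
    (hMK : M ≤ K) (F : flagIndex M n → Submodule ℂ V) {i : flagIndex K n} (h : ¬ K - n ≤ i) :
    pushFlag σ P P' hnM hMK F i = P := dif_neg h

variable {T : Module.End ℂ E} {P P' : Submodule ℂ E} {T₀ : Module.End ℂ V} {M n K r u : ℕ}
  {σ : V →ₗ[ℂ] E}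

namespace JordanSection

lemma injective_mkQ (hσ : JordanSection T P P' T₀ n r u σ) :
    Function.Injective (P'.mkQ ∘ₗ σ) := by
  refine (injective_iff_map_eq_zero _).2 fun x hx => hσ.eq_zero x ?_
  rwa [LinearMap.comp_apply, Submodule.mkQ_apply, Submodule.Quotient.mk_eq_zero] at hx

lemma finrank_map_sup (hσ : JordanSection T P P' T₀ n r u σ) (G : Submodule ℂ V) :
    Module.finrank ℂ ((G.map σ ⊔ P').map P'.mkQ) = Module.finrank ℂ G := by
  have : (G.map σ ⊔ P').map P'.mkQ = G.map (P'.mkQ ∘ₗ σ) := by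
    rw [Submodule.map_sup, Submodule.mkQ_map_self, sup_bot_eq, Submodule.map_comp]
  rw [this]
  exact ((Submodule.equivMapOfInjective _ hσ.injective_mkQ G).finrank_eq).symm

lemma comap_map_sup (hσ : JordanSection T P P' T₀ n r u σ) (G : Submodule ℂ V) :
    (G.map σ ⊔ P').comap σ = G := by
  apply le_antisymm
  · intro x hx
    obtain ⟨_, ⟨y, hy, rfl⟩, p, hp, h⟩ := Submodule.mem_sup.1 hx
    have : x - y = 0 := hσ.eq_zero _ (by
      rw [map_sub, ← h, add_sub_cancel_left]
      exact hp)
    rwa [sub_eq_zero.1 this]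
  · exact fun x hx => Submodule.mem_sup_left ⟨x, hx, rfl⟩

lemma map_comap_sup {L : Submodule ℂ E} (h : P' ≤ L)
    (h' : L ≤ LinearMap.range σ ⊔ P') : (L.comap σ).map σ ⊔ P' = L := by
  apply le_antisymm
  · exact sup_le (Submodule.map_comap_le _ _) h
  · intro x hx
    obtain ⟨_, ⟨y, rfl⟩, p, hp, rfl⟩ := Submodule.mem_sup.1 (h' hx)
    refine Submodule.add_mem_sup ⟨y, ?_, rfl⟩ hp
    have := sub_mem hx (h hp)
    rwa [add_sub_cancel_right] at this

lemma map_sup_le (hσ : JordanSection T P P' T₀ n r u σ) (hP' : P' ≤ P) (G : Submodule ℂ V) :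
    G.map σ ⊔ P' ≤ P := by
  refine sup_le ?_ hP'
  rintro _ ⟨x, -, rfl⟩
  exact hσ.mem x

/-- By antitonicity it is enough to treat the n-dimensional second member. The first member is in
general too big, which is why it is handled separately in `pullFlag` and `pushFlag`. -/
lemma le_range (hσ : JordanSection T P P' T₀ n r u σ) (hnK : n ≤ K)
    {L : flagIndex K n → Submodule ℂ E} (hL : IsSubquotientFlag T P P' K n r L)
    {i : flagIndex K n} (h : K - n ≤ i) : L i ≤ LinearMap.range σ ⊔ P' := by
  refine (hL.antitone (show flagIndex.second K n ≤ i from h)).trans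
    (hσ.le _ (hL.le _) ?_ (hL.stable _) ?_ hL.pow_mem)
  · exact (hL.antitone (show flagIndex.first K n ≤ _ from Nat.zero_le _)).trans hL.first.le
  · rw [hL.finrank]
    simp only [flagIndex.second]
    omega

/-- The index shift by K - M matches members of equal dimension: M - i = K - (i + (K - M)).
Stability survives because the failure of `σ` to commute lies in P', hence in every member. -/
lemma isStableFlag_pullFlag (hσ : JordanSection T P P' T₀ n r u σ) (hnM : n ≤ M) (hMK : M ≤ K)
    (hM : Module.finrank ℂ V = M)
    {L : flagIndex K n → Submodule ℂ E} (hL : IsSubquotientFlag T P P' K n r L) :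
    IsStableFlag T₀ M n u (pullFlag σ hMK L) where
  antitone := by
    intro i j hij
    have hij' : (i : ℕ) ≤ j := hij
    unfold pullFlag
    split_ifs with hj hi
    · exact Submodule.comap_mono (hL.antitone (show _ ≤ _ from Nat.add_le_add_right hij' _))
    · exact le_top
    · omega
    · exact le_rfl
  finrank := by
    intro i
    have hi' := flagIndex_subset M n i.2
    simp only [Set.mem_ofPred_eq] at hi'
    by_cases hi : M - n ≤ i
    · rw [pullFlag_of_le _ _ _ hi, ← hσ.finrank_map_sup, map_comap_sup (hL.le _)
        (hσ.le_range (hnM.trans hMK) hL (by simp only; omega)), hL.finrank]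
      simp only
      omega
    · rw [pullFlag_of_not_le _ _ _ hi, flagIndex_eq_zero i.2 hi, finrank_top, hM, Nat.sub_zero]
  stable := by
    intro i
    unfold pullFlag
    split_ifs with hi
    · intro x hx
      rw [Submodule.mem_comap, Submodule.mem_comap]
      have h : T (σ x) ∈ L ⟨i + (K - M), flagIndex_add hMK i.2 hi⟩ := hL.stable _ hx
      have := sub_mem h (hL.le _ (hσ.comm x))
      rwa [sub_sub_cancel] at this
    · exact fun x _ => trivial
  pow_mem := by
    intro z
    have hle : M - n ≤ (flagIndex.second M n : ℕ) := le_rfl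
    have hidx : (⟨(flagIndex.second M n : ℕ) + (K - M), flagIndex_add hMK (Subtype.prop _) hle⟩ :
        flagIndex K n) = flagIndex.second K n :=
      Subtype.ext (by simp only [flagIndex.second]; omega)
    rw [pullFlag_of_le _ _ _ hle, hidx, Submodule.mem_comap]
    exact (hσ.iff _ (hL.le _)).1 hL.pow_mem z

lemma isSubquotientFlag_pushFlag (hσ : JordanSection T P P' T₀ n r u σ) (hnM : n ≤ M)
    (hMK : M ≤ K) (hP' : P' ≤ P) (hP : P ≤ P.comap T) (hP'T : P' ≤ P'.comap T)
    [FiniteDimensional ℂ (P.map P'.mkQ)] (hK : Module.finrank ℂ (P.map P'.mkQ) = K)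
    {F : flagIndex M n → Submodule ℂ V} (hF : IsStableFlag T₀ M n u F) :
    IsSubquotientFlag T P P' K n r (pushFlag σ P P' hnM hMK F) := by
  have hfin : ∀ i, Module.finrank ℂ ((pushFlag σ P P' hnM hMK F i).map P'.mkQ) = K - i := by
    intro i
    have hi' := flagIndex_subset K n i.2
    simp only [Set.mem_ofPred_eq] at hi'
    by_cases hi : K - n ≤ i
    · rw [pushFlag_of_le _ _ _ _ _ _ hi, hσ.finrank_map_sup, hF.finrank]
      simp only
      omega
    · rw [pushFlag_of_not_le _ _ _ _ _ _ hi, flagIndex_eq_zero i.2 hi, hK, Nat.sub_zero]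
  refine ⟨?_, ?_, ?_, hfin, ?_, ?_⟩
  · intro i j hij
    have hij' : (i : ℕ) ≤ j := hij
    unfold pushFlag
    split_ifs with hj hi
    · exact sup_le_sup_right (Submodule.map_mono
        (hF.antitone (show _ ≤ _ from Nat.sub_le_sub_right hij' _))) _
    · exact hσ.map_sup_le hP' _
    · omega
    · exact le_rfl
  -- When n = K the first and second positions coincide and `pushFlag` takes its other branch at
  -- position 0, so equality with P is derived from dimensions.
  · refine eq_of_le_of_finrank_map_mkQ_eq (P' := P') ?_ ?_ ?_
    · unfold pushFlag
      split_ifs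
      · exact le_sup_right
      · exact hP'
    · unfold pushFlag
      split_ifs
      · exact hσ.map_sup_le hP' _
      · exact le_rfl
    · rw [hfin, hK]
      rfl
  · intro i
    unfold pushFlag
    split_ifs
    · exact le_sup_right
    · exact hP'
  · intro i
    unfold pushFlag
    split_ifs with hi
    · rintro x hx
      obtain ⟨_, ⟨y, hy, rfl⟩, p, hp, rfl⟩ := Submodule.mem_sup.1 hx
      rw [Submodule.mem_comap, map_add, ← sub_add_cancel (T (σ y)) (σ (T₀ y))]
      exact add_mem (add_mem (Submodule.mem_sup_right (hσ.comm y))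
        (Submodule.mem_sup_left ⟨_, hF.stable _ hy, rfl⟩)) (Submodule.mem_sup_right (hP'T hp))
    · exact hP
  · have hle : K - n ≤ (flagIndex.second K n : ℕ) := le_rfl
    have hidx : (⟨(flagIndex.second K n : ℕ) - (K - M),
        flagIndex_sub hnM hMK (Subtype.prop _) hle⟩ : flagIndex M n) = flagIndex.second M n :=
      Subtype.ext (by simp only [flagIndex.second]; omega)
    rw [pushFlag_of_le _ _ _ _ _ _ hle, hidx]
    exact (hσ.iff _ le_sup_right).2 fun z => Submodule.mem_sup_left ⟨_, hF.pow_mem z, rfl⟩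

lemma pushFlag_pullFlag (hσ : JordanSection T P P' T₀ n r u σ) (hnM : n ≤ M) (hMK : M ≤ K)
    {L : flagIndex K n → Submodule ℂ E} (hL : IsSubquotientFlag T P P' K n r L) :
    pushFlag σ P P' hnM hMK (pullFlag σ hMK L) = L := by
  funext i
  have hi' := flagIndex_subset K n i.2
  simp only [Set.mem_ofPred_eq] at hi'
  unfold pushFlag
  split_ifs with hi
  · unfold pullFlag
    rw [dif_pos (by simp only; omega)]
    have : (⟨(i : ℕ) - (K - M) + (K - M), flagIndex_add hMK
        (flagIndex_sub hnM hMK i.2 hi) (by omega)⟩ : flagIndex K n) = i := by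
      ext
      simp only
      omega
    simp only [this]
    exact map_comap_sup (hL.le _) (hσ.le_range (hnM.trans hMK) hL hi)
  · rw [← hL.first]
    congr 1
    ext
    exact (flagIndex_eq_zero i.2 hi).symm

lemma pullFlag_pushFlag (hσ : JordanSection T P P' T₀ n r u σ) (hnM : n ≤ M) (hMK : M ≤ K)
    [FiniteDimensional ℂ V] (hM : Module.finrank ℂ V = M)
    {F : flagIndex M n → Submodule ℂ V} (hF : IsStableFlag T₀ M n u F) :
    pullFlag σ hMK (pushFlag σ P P' hnM hMK F) = F := by
  funext i
  have hi' := flagIndex_subset M n i.2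
  simp only [Set.mem_ofPred_eq] at hi'
  unfold pullFlag
  split_ifs with hi
  · unfold pushFlag
    rw [dif_pos (by simp only; omega), hσ.comap_map_sup]
    congr 1
    ext
    simp
  · symm
    apply Submodule.eq_top_of_finrank_eq
    rw [hF.finrank, hM, flagIndex_eq_zero i.2 hi, Nat.sub_zero]

end JordanSection

/-- Pulling back and pushing forward of flags is compatible with the structures of varieties,
where `E / P'` is embedded in a coordinate space by means of a linear map `τ`. -/
lemma JordanSection.grassmann_iff {κ ι X Y : Type*} [Fintype ι] [Fintype κ]
    {T₀ : Module.End ℂ (κ → ℂ)} {σ : (κ → ℂ) →ₗ[ℂ] E}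
    (hσ : JordanSection T P P' T₀ n r u σ) (hnM : n ≤ M) (hMK : M ≤ K) (hP' : P' ≤ P)
    (hM : Module.finrank ℂ (κ → ℂ) = M) (τ : E →ₗ[ℂ] (ι → ℂ))
    (hτ : ∀ x ∈ P, τ x = 0 → x ∈ P')
    (L : X → flagIndex K n → Submodule ℂ E) (hL : ∀ x, IsSubquotientFlag T P P' K n r (L x))
    (F : Y → flagIndex M n → Submodule ℂ (κ → ℂ)) (hF : ∀ y, IsStableFlag T₀ M n u (F y))
    (e : X ≃ Y) (he : ∀ x, F (e x) = pullFlag σ hMK (L x))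
    (he' : ∀ y, L (e.symm y) = pushFlag σ P P' hnM hMK (F y)) (U : Set Y) :
    (IsOpen[grassmannTopology Set.univ F] U ↔
      IsOpen[grassmannTopology Set.univ fun x i => (L x i).map τ] (e ⁻¹' U)) ∧
    ∀ f : Y → ℂ, grassmannRegular Set.univ F U f ↔
      grassmannRegular Set.univ (fun x i => (L x i).map τ) (e ⁻¹' U) (f ∘ e) := by
  have hinj : Function.Injective ((P'.map τ).mkQ ∘ₗ τ ∘ₗ σ) := by
    refine (injective_iff_map_eq_zero _).2 fun x hx => hσ.eq_zero x ?_
    rw [LinearMap.comp_apply, Submodule.mkQ_apply, Submodule.Quotient.mk_eq_zero] at hx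
    obtain ⟨p, hp, hpx⟩ := hx
    have := hτ (σ x - p) (sub_mem (hσ.mem x) (hP' hp)) (by
      rw [map_sub, hpx, LinearMap.comp_apply, sub_self])
    have := add_mem this hp
    rwa [sub_add_cancel] at this
  -- A linear retraction of `τ ∘ σ` that kills `τ P'`. It recovers F from τ(σF + P'), so pulling
  -- back is also of the form "apply a fixed linear map".
  obtain ⟨g, hg⟩ := LinearMap.exists_leftInverse_of_injective _ (LinearMap.ker_eq_bot.2 hinj)
  let ψ : (ι → ℂ) →ₗ[ℂ] (κ → ℂ) := g ∘ₗ (P'.map τ).mkQ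
  have hψσ : ψ ∘ₗ τ ∘ₗ σ = LinearMap.id := hg
  have hψP : (P'.map τ).map ψ = ⊥ := by
    rw [Submodule.map_comp, Submodule.mkQ_map_self, Submodule.map_bot]
  have hpush : ∀ G : Submodule ℂ (κ → ℂ),
      (G.map σ ⊔ P').map τ = G.map (τ ∘ₗ σ) ⊔ P'.map τ := fun G => by
    rw [Submodule.map_sup, Submodule.map_comp]
  have hfin : ∀ G : Submodule ℂ (κ → ℂ), Module.finrank ℂ ((G.map σ ⊔ P').map τ) =
      Module.finrank ℂ G + Module.finrank ℂ (P'.map τ) := by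
    intro G
    have hdisj : G.map (τ ∘ₗ σ) ⊓ P'.map τ = ⊥ := by
      rw [Submodule.eq_bot_iff]
      rintro _ ⟨⟨x, -, rfl⟩, hx⟩
      have : x = 0 := hinj (by
        rw [map_zero, LinearMap.comp_apply, Submodule.mkQ_apply, Submodule.Quotient.mk_eq_zero]
        exact hx)
      rw [this, map_zero]
    have hinj' : Function.Injective (τ ∘ₗ σ) := Function.Injective.of_comp hinj
    have h := Submodule.finrank_sup_add_finrank_inf_eq (G.map (τ ∘ₗ σ)) (P'.map τ)
    rw [hdisj, finrank_bot, add_zero,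
      ← (Submodule.equivMapOfInjective _ hinj' G).finrank_eq] at h
    rw [hpush, h]
  refine grassmann_iff_of_linear (fun x i => (L x i).map τ) F e
    (fun i => if K - n ≤ i then K - i + Module.finrank ℂ (P'.map τ)
      else Module.finrank ℂ (P.map τ)) ?_ (fun j => M - j) (fun y j => (hF y).finrank j) ?_ ?_ U
  · intro x i
    have hi' := flagIndex_subset K n i.2
    simp only [Set.mem_ofPred_eq] at hi'
    rw [← e.symm_apply_apply x, he']
    by_cases hi : K - n ≤ i
    · rw [pushFlag_of_le _ _ _ _ _ _ hi, hfin, (hF _).finrank, if_pos hi]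
      simp only
      omega
    · rw [pushFlag_of_not_le _ _ _ _ _ _ hi, if_neg hi]
  · intro j
    by_cases hj : M - n ≤ j
    · refine ⟨⟨j + (K - M), flagIndex_add hMK j.2 hj⟩, ψ, ⊥, fun x => ?_⟩
      have hi : K - n ≤ (j : ℕ) + (K - M) := by omega
      rw [he, pullFlag_of_le _ _ _ hj, sup_bot_eq]
      conv_rhs => rw [← map_comap_sup ((hL x).le ⟨j + (K - M), flagIndex_add hMK j.2 hj⟩)
        (hσ.le_range (hnM.trans hMK) (hL x) hi), hpush, Submodule.map_sup, hψP, sup_bot_eq,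
        ← Submodule.map_comp, hψσ, Submodule.map_id]
    -- The first member is constant: take ψ = 0 and put everything into S.
    · refine ⟨flagIndex.first K n, 0, ⊤, fun x => ?_⟩
      rw [he, pullFlag_of_not_le _ _ _ hj, sup_top_eq]
  · intro i
    by_cases hi : K - n ≤ i
    · refine ⟨⟨i - (K - M), flagIndex_sub hnM hMK i.2 hi⟩, τ ∘ₗ σ, P'.map τ, fun y => ?_⟩
      rw [he', pushFlag_of_le _ _ _ _ _ _ hi, hpush]
    · refine ⟨flagIndex.first M n, 0, P.map τ, fun y => ?_⟩
      rw [he', pushFlag_of_not_le _ _ _ _ _ _ hi, Submodule.map_zero, bot_sup_eq]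

end Transfer

/-! ### Lattices with periodic bases -/

section

variable {K : ℕ}

/-- A basis of `𝕂^K`, extended to a family indexed by `ℤ` by `v_{j+K} = ε v_j`. -/
structure IsPeriodicBasis (v : ℤ → LVec K) : Prop where
  add_period : ∀ j, v (j + K) = (PowerSeries.X : ℂ⟦X⟧) • v j
  linearIndependent : LinearIndependent ℂ⸨X⸩ (fun r : Fin K => v ((r : ℕ) + 1))

/-- The lattice spanned by `v_{i+1}, …, v_{i+K}`. -/
def periodicLattice (v : ℤ → LVec K) (i : ℤ) : Submodule ℂ⟦X⟧ (LVec K) :=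
  Submodule.span ℂ⟦X⟧ (v '' Set.Ioc i (i + K))

lemma X_smul_mem_epsMul {P : Submodule ℂ⟦X⟧ (LVec K)} {x : LVec K} (hx : x ∈ P) :
    (PowerSeries.X : ℂ⟦X⟧) • x ∈ epsMul P := ⟨x, hx, rfl⟩

lemma mem_epsMul {P : Submodule ℂ⟦X⟧ (LVec K)} {x : LVec K} :
    x ∈ epsMul P ↔ ∃ y ∈ P, (PowerSeries.X : ℂ⟦X⟧) • y = x := Iff.rfl

lemma epsMul_le (P : Submodule ℂ⟦X⟧ (LVec K)) : epsMul P ≤ P := by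
  rintro _ ⟨x, hx, rfl⟩
  exact P.smul_mem _ hx

lemma C_smul_eq (c : ℂ) (x : LVec K) : (PowerSeries.C c : ℂ⟦X⟧) • x = c • x := by
  rw [← mul_one (PowerSeries.C c), ← PowerSeries.smul_eq_C_mul, smul_assoc, one_smul]

/-- A complex subspace between `ε P` and `P` is stable under power series. -/
lemma smul_mem_of_between {P : Submodule ℂ⟦X⟧ (LVec K)} {W : Submodule ℂ (LVec K)}
    (h1 : asC (epsMul P) ≤ W) (h2 : W ≤ asC P) (p : ℂ⟦X⟧) {x : LVec K} (hx : x ∈ W) :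
    p • x ∈ W := by
  have h : p • x = (PowerSeries.X : ℂ⟦X⟧) •
      ((PowerSeries.mk fun m => PowerSeries.coeff (m + 1) p) • x) +
      PowerSeries.constantCoeff p • x := by
    conv_lhs => rw [PowerSeries.eq_X_mul_shift_add_const p]
    rw [← C_smul_eq, ← mul_smul, ← add_smul (PowerSeries.X * _ : ℂ⟦X⟧) (PowerSeries.C _) x]
  rw [h]
  exact add_mem (h1 (X_smul_mem_epsMul (P.smul_mem _ (h2 hx)))) (W.smul_mem _ hx)

/-- A complex subspace between `ε P` and `P`, as a module over the power series. -/
def latticeOfBetween {P : Submodule ℂ⟦X⟧ (LVec K)} (W : Submodule ℂ (LVec K))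
    (h1 : asC (epsMul P) ≤ W) (h2 : W ≤ asC P) : Submodule ℂ⟦X⟧ (LVec K) :=
  { W with smul_mem' := fun p _ hx => smul_mem_of_between h1 h2 p hx }

lemma single_mul_single_one (a b : ℤ) :
    (HahnSeries.single a (1 : ℂ) : ℂ⸨X⸩) * HahnSeries.single b 1 = HahnSeries.single (a + b) 1 := by
  rw [HahnSeries.single_mul_single, one_mul]

lemma X_smul_apply (x : LVec K) (r : Fin K) :
    ((PowerSeries.X : ℂ⟦X⟧) • x) r = HahnSeries.single 1 1 * x r := by
  rw [Pi.smul_apply, Algebra.smul_def, LaurentSeries.coe_algebraMap, HahnSeries.ofPowerSeries_X]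

lemma e_apply (j : ℤ) (r : Fin K) : e K j r = if (r : ℤ) = (j - 1) % (K : ℤ) then
    HahnSeries.single ((j - 1) / (K : ℤ)) 1 else 0 := rfl

lemma e_add_period (j : ℤ) : e K (j + K) = (PowerSeries.X : ℂ⟦X⟧) • e K j := by
  ext1 r
  have hK : (K : ℤ) ≠ 0 := by
    have := r.pos
    omega
  rw [X_smul_apply, e_apply, e_apply, show j + K - 1 = j - 1 + K by ring,
    Int.add_emod_right, Int.add_ediv_of_dvd_right (dvd_refl _), Int.ediv_self hK]
  split_ifs
  · rw [single_mul_single_one, add_comm]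
  · rw [mul_zero]

lemma e_succ (r : Fin K) : e K ((r : ℕ) + 1) = Pi.single r 1 := by
  ext1 s
  have h1 : ((r : ℕ) + 1 - 1 : ℤ) % K = r := by
    rw [add_sub_cancel_right]
    exact Int.emod_eq_of_lt (by omega) (by omega)
  have h2 : ((r : ℕ) + 1 - 1 : ℤ) / K = 0 := by
    rw [add_sub_cancel_right]
    exact Int.ediv_eq_zero_of_lt (by omega) (by omega)
  rw [e_apply, h1, h2, Pi.single_apply]
  refine if_congr ?_ rfl rfl
  rw [Fin.ext_iff]
  omega

lemma isPeriodicBasis_e : IsPeriodicBasis (e K) := by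
  refine ⟨e_add_period, ?_⟩
  convert (Pi.basisFun ℂ⸨X⸩ (Fin K)).linearIndependent using 1
  ext1 r
  rw [e_succ, Pi.basisFun_apply]

/-- `e_j` is a scalar multiple of a standard basis vector. -/
lemma e_eq_smul (hK : 0 < K) (j : ℤ) : e K j =
    (HahnSeries.single ((j - 1) / (K : ℤ)) 1 : ℂ⸨X⸩) •
      (Pi.single ⟨((j - 1) % (K : ℤ)).toNat, by
        have := Int.emod_lt_of_pos (j - 1) (by omega : (0 : ℤ) < K)
        have := Int.emod_nonneg (j - 1) (by omega : (K : ℤ) ≠ 0)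
        omega⟩ 1 : LVec K) := by
  ext1 s
  have := Int.emod_nonneg (j - 1) (by omega : (K : ℤ) ≠ 0)
  rw [e_apply, Pi.smul_apply, Pi.single_apply, smul_eq_mul, mul_ite, mul_one, mul_zero]
  refine if_congr ?_ rfl rfl
  rw [Fin.ext_iff]
  simp only
  omega

lemma IsAffinePerm.add_mul {ω : Equiv.Perm ℤ} (hω : IsAffinePerm K ω) (i q : ℤ) :
    ω (i + K * q) = ω i + K * q := by
  induction q using Int.induction_on with
  | zero => simp
  | succ q ih => rw [mul_add, mul_one, ← add_assoc, hω, ih]; ring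
  | pred q ih =>
    have := hω (i + K * (-(q : ℤ) - 1))
    rw [show i + K * (-(q : ℤ) - 1) + K = i + K * -q by ring, ih] at this
    linarith

lemma isPeriodicBasis_e_comp {ω : Equiv.Perm ℤ} (hω : IsAffinePerm K ω) :
    IsPeriodicBasis (fun j => e K (ω j)) := by
  refine ⟨fun j => by rw [hω, e_add_period], ?_⟩
  rcases Nat.eq_zero_or_pos K with rfl | hK
  · exact linearIndependent_empty_type
  let ρ : Fin K → Fin K := fun r => ⟨((ω ((r : ℕ) + 1) - 1) % (K : ℤ)).toNat, by
    have := Int.emod_lt_of_pos (ω ((r : ℕ) + 1) - 1) (by omega : (0 : ℤ) < K)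
    have := Int.emod_nonneg (ω ((r : ℕ) + 1) - 1) (by omega : (K : ℤ) ≠ 0)
    omega⟩
  have hρ : Function.Injective ρ := by
    intro r s h
    simp only [ρ, Fin.mk.injEq] at h
    have h1 := Int.emod_nonneg (ω ((r : ℕ) + 1) - 1) (by omega : (K : ℤ) ≠ 0)
    have h2 := Int.emod_nonneg (ω ((s : ℕ) + 1) - 1) (by omega : (K : ℤ) ≠ 0)
    have h3 : (ω ((r : ℕ) + 1) - 1) % (K : ℤ) = (ω ((s : ℕ) + 1) - 1) % (K : ℤ) := by omega
    obtain ⟨q, hq⟩ := Int.ModEq.dvd (show (ω ((r : ℕ) + 1) - 1) ≡ _ [ZMOD K] from h3)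
    have h4 : ω ((s : ℕ) + 1) = ω ((r : ℕ) + 1 + K * q) := by
      rw [hω.add_mul]
      linarith
    have h5 := ω.injective h4
    have hr := r.2
    have hs := s.2
    have hq0 : q = 0 := by
      by_contra hq0
      rcases lt_or_gt_of_ne hq0 with h | h
      · have : (K : ℤ) * q ≤ -K := by nlinarith
        omega
      · have : (K : ℤ) ≤ K * q := by nlinarith
        omega
    subst hq0
    ext
    omega
  have hli := ((Pi.basisFun ℂ⸨X⸩ (Fin K)).linearIndependent.comp ρ hρ).units_smul
    (fun r => Units.mk0 (HahnSeries.single ((ω ((r : ℕ) + 1) - 1) / (K : ℤ)) 1 : ℂ⸨X⸩)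
      (by simp))
  convert hli using 1
  ext1 r
  rw [e_eq_smul hK]
  simp [ρ, Units.smul_def]

/-- The action of a matrix on vectors. -/
abbrev mulVecLin (g : GL (Fin K) ℂ⸨X⸩) : LVec K →ₗ[ℂ⸨X⸩] LVec K :=
  Matrix.toLin' (g : Matrix (Fin K) (Fin K) ℂ⸨X⸩)

lemma mulVecLin_X_smul (g : GL (Fin K) ℂ⸨X⸩) (x : LVec K) :
    mulVecLin g ((PowerSeries.X : ℂ⟦X⟧) • x) = (PowerSeries.X : ℂ⟦X⟧) • mulVecLin g x :=
  ((mulVecLin g).restrictScalars ℂ⟦X⟧).map_smul _ _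

lemma mulVecLin_injective (g : GL (Fin K) ℂ⸨X⸩) : Function.Injective (mulVecLin g) := by
  intro x y h
  have := congrArg (mulVecLin g⁻¹) h
  simpa [mulVecLin, ← Matrix.toLin'_mul_apply] using this

lemma IsPeriodicBasis.map {v : ℤ → LVec K} (hv : IsPeriodicBasis v) (g : GL (Fin K) ℂ⸨X⸩) :
    IsPeriodicBasis (fun j => mulVecLin g (v j)) := by
  refine ⟨fun j => by rw [hv.add_period, mulVecLin_X_smul], ?_⟩
  exact hv.linearIndependent.map' _ (LinearMap.ker_eq_bot.2 (mulVecLin_injective g))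

lemma translate_periodicLattice (g : GL (Fin K) ℂ⸨X⸩) (v : ℤ → LVec K) (i : ℤ) :
    translate g (periodicLattice v i) = periodicLattice (fun j => mulVecLin g (v j)) i := by
  rw [translate, periodicLattice, Submodule.map_span, ← Set.image_comp]
  rfl

lemma IsPeriodicBasis.eq_of_eq {v w : ℤ → LVec K} (hv : IsPeriodicBasis v)
    (hw : IsPeriodicBasis w) (hK : 0 < K) (h : ∀ r : Fin K, v ((r : ℕ) + 1) = w ((r : ℕ) + 1))
    (j : ℤ) (hj : 0 < j) : v j = w j := by
  have key : ∀ q a : ℕ, a < K → v (a + 1 + K * q) = w (a + 1 + K * q) := by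
    intro q a ha
    induction q with
    | zero => simpa using h ⟨a, ha⟩
    | succ q ih =>
      rw [Nat.cast_succ, mul_add, mul_one, ← add_assoc, hv.add_period, hw.add_period, ih]
  have h1 := key ((j.toNat - 1) / K) ((j.toNat - 1) % K) (Nat.mod_lt _ hK)
  have h2 : (((j.toNat - 1) % K : ℕ) : ℤ) + 1 + K * ((j.toNat - 1) / K : ℕ) = j := by
    have := Nat.mod_add_div (j.toNat - 1) K
    rw [add_right_comm]
    norm_cast
    rw [this]
    omega
  rwa [h2] at h1

/-- Every periodic basis is the image of the standard one under an invertible matrix. -/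
lemma IsPeriodicBasis.exists_eq_mulVecLin {v : ℤ → LVec K} (hv : IsPeriodicBasis v) (hK : 0 < K) :
    ∃ g : GL (Fin K) ℂ⸨X⸩, ∀ j, 0 < j → v j = mulVecLin g (e K j) := by
  let A : Matrix (Fin K) (Fin K) ℂ⸨X⸩ := Matrix.of fun s r => v ((r : ℕ) + 1) s
  have hA : IsUnit A := Matrix.linearIndependent_cols_iff_isUnit.1 hv.linearIndependent
  refine ⟨hA.unit, hv.eq_of_eq (isPeriodicBasis_e.map _) hK fun r => ?_⟩
  rw [e_succ]
  ext1 s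
  simp [A, mulVecLin]

lemma periodicLattice_congr {v w : ℤ → LVec K} (h : ∀ j, 0 < j → v j = w j) {i : ℤ} (hi : 0 ≤ i) :
    periodicLattice v i = periodicLattice w i := by
  unfold periodicLattice
  congr 1
  exact Set.image_congr fun j hj => h j (hi.trans_lt hj.1)


section Flag

variable {v : ℤ → LVec K}

lemma epsMul_periodicLattice (hv : IsPeriodicBasis v) (i : ℤ) :
    epsMul (periodicLattice v i) = periodicLattice v (i + K) := by
  rw [epsMul, periodicLattice, periodicLattice, Submodule.map_span]
  congr 1
  ext x
  constructor
  · rintro ⟨_, ⟨j, hj, rfl⟩, rfl⟩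
    exact ⟨j + K, ⟨by linarith [hj.1], by linarith [hj.2]⟩, hv.add_period j⟩
  · rintro ⟨j, hj, rfl⟩
    refine ⟨_, ⟨j - K, ⟨by linarith [hj.1], by linarith [hj.2]⟩, rfl⟩, ?_⟩
    have := hv.add_period (j - K)
    rw [sub_add_cancel] at this
    exact this.symm

lemma mem_periodicLattice_of_mem (v : ℤ → LVec K) {i j : ℤ} (hj : j ∈ Set.Ioc i (i + K)) :
    v j ∈ periodicLattice v i := Submodule.subset_span ⟨j, hj, rfl⟩

lemma periodicLattice_antitone (hv : IsPeriodicBasis v) {i i' : ℤ} (h : i ≤ i')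
    (h' : i' ≤ i + K) : periodicLattice v i' ≤ periodicLattice v i := by
  rw [periodicLattice, Submodule.span_le]
  rintro _ ⟨j, hj, rfl⟩
  by_cases hjK : j ≤ i + K
  · exact mem_periodicLattice_of_mem v ⟨h.trans_lt hj.1, hjK⟩
  · have := hv.add_period (j - K)
    rw [sub_add_cancel] at this
    rw [this]
    refine Submodule.smul_mem _ _ (mem_periodicLattice_of_mem v ⟨?_, ?_⟩) <;>
      linarith [hj.2]

/-- Modulo εΛ only the vectors with index at most K survive. The right side lies between εΛ and Λ,
hence is automatically a module over power series, so it suffices to check generators. -/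
lemma asC_periodicLattice (hv : IsPeriodicBasis v) {i : ℤ} (h0 : 0 ≤ i) (hK : i ≤ K) :
    asC (periodicLattice v i) = Submodule.span ℂ (v '' Set.Ioc i K) ⊔
      asC (epsMul (periodicLattice v 0)) := by
  have heps : epsMul (periodicLattice v 0) ≤ periodicLattice v i := by
    rw [epsMul_periodicLattice hv]
    exact periodicLattice_antitone hv (by omega) (by omega)
  apply le_antisymm
  · have h2 : Submodule.span ℂ (v '' Set.Ioc i K) ⊔ asC (epsMul (periodicLattice v 0)) ≤
        asC (periodicLattice v 0) := by
      refine sup_le (Submodule.span_le.2 ?_) (epsMul_le _)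
      rintro _ ⟨j, hj, rfl⟩
      exact mem_periodicLattice_of_mem v ⟨h0.trans_lt hj.1, by linarith [hj.2]⟩
    change periodicLattice v i ≤ latticeOfBetween _ le_sup_right h2
    rw [periodicLattice, Submodule.span_le]
    rintro _ ⟨j, hj, rfl⟩
    by_cases hjK : j ≤ K
    · exact Submodule.mem_sup_left (Submodule.subset_span ⟨j, ⟨hj.1, hjK⟩, rfl⟩)
    · refine Submodule.mem_sup_right ?_
      change v j ∈ epsMul (periodicLattice v 0)
      rw [epsMul_periodicLattice hv]
      exact mem_periodicLattice_of_mem v ⟨by linarith, by linarith [hj.2]⟩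
  · refine sup_le (Submodule.span_le.2 ?_) heps
    rintro _ ⟨j, hj, rfl⟩
    exact mem_periodicLattice_of_mem v ⟨hj.1, by linarith [hj.2]⟩

lemma mem_periodicLattice_zero {x : LVec K} :
    x ∈ periodicLattice v 0 ↔ ∃ c : Fin K → ℂ⟦X⟧, ∑ r, c r • v ((r : ℕ) + 1) = x := by
  have : v '' Set.Ioc 0 (0 + K) = Set.range (fun r : Fin K => v ((r : ℕ) + 1)) := by
    ext x
    constructor
    · rintro ⟨j, hj, rfl⟩
      have h1 := hj.1
      have h2 := hj.2
      refine ⟨⟨j.toNat - 1, by omega⟩, congrArg v ?_⟩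
      change ((j.toNat - 1 : ℕ) : ℤ) + 1 = j
      omega
    · rintro ⟨r, rfl⟩
      exact ⟨_, ⟨by omega, by omega⟩, rfl⟩
  rw [periodicLattice, this]
  exact Submodule.mem_span_range_iff_exists_fun _

/-- A relation modulo ε reads Σ (ε p_r - c_r) v_r = 0 with p_r integral. Independence over the
Laurent series field makes each coefficient vanish, and the constant term gives c_r = 0. -/
lemma linearIndependent_mkQ (hv : IsPeriodicBasis v) :
    LinearIndependent ℂ (fun r : Fin K =>
      (asC (epsMul (periodicLattice v 0))).mkQ (v ((r : ℕ) + 1))) := by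
  rw [Fintype.linearIndependent_iff]
  intro c hc r
  have hmem : ∑ r, c r • v ((r : ℕ) + 1) ∈ epsMul (periodicLattice v 0) := by
    change _ ∈ asC (epsMul (periodicLattice v 0))
    rw [← Submodule.Quotient.mk_eq_zero, ← hc, ← Submodule.mkQ_apply, map_sum]
    simp only [map_smul]
  obtain ⟨y, hy, hyx⟩ := hmem
  obtain ⟨p, rfl⟩ := mem_periodicLattice_zero.1 hy
  have hsmul : ∀ (p : ℂ⟦X⟧) (x : LVec K), p • x = (algebraMap ℂ⟦X⟧ ℂ⸨X⸩ p) • x :=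
    fun p x => (algebraMap_smul ℂ⸨X⸩ p x).symm
  have h : ∑ r, (algebraMap ℂ⟦X⟧ ℂ⸨X⸩ (PowerSeries.X * p r - PowerSeries.C (c r))) •
      v ((r : ℕ) + 1) = 0 := by
    simp only [← hsmul]
    have : ∀ r : Fin K, (PowerSeries.X * p r - PowerSeries.C (c r)) • v ((r : ℕ) + 1) =
        (PowerSeries.X : ℂ⟦X⟧) • p r • v ((r : ℕ) + 1) - c r • v ((r : ℕ) + 1) := fun r => by
      rw [← C_smul_eq, ← mul_smul]
      exact sub_smul (PowerSeries.X * p r) (PowerSeries.C (c r)) (v ((r : ℕ) + 1))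
    simp only [this]
    rw [Finset.sum_sub_distrib, ← hyx, sub_eq_zero]
    exact (map_sum (LinearMap.lsmul ℂ⟦X⟧ (LVec K) (PowerSeries.X : ℂ⟦X⟧))
      (fun r : Fin K => p r • v ((r : ℕ) + 1)) Finset.univ).symm
  have h0 := Fintype.linearIndependent_iff.1 hv.linearIndependent _ h r
  have h1 := (IsFractionRing.injective ℂ⟦X⟧ ℂ⸨X⸩) (h0.trans (map_zero _).symm)
  have h2 := congrArg PowerSeries.constantCoeff h1
  simpa using h2

lemma map_mkQ_periodicLattice (hv : IsPeriodicBasis v) {i : ℕ} (hK : i ≤ K) :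
    (asC (periodicLattice v i)).map (asC (epsMul (periodicLattice v 0))).mkQ =
      Submodule.span ℂ (Set.range fun a : Fin (K - i) =>
        (asC (epsMul (periodicLattice v 0))).mkQ (v ((i + a : ℕ) + 1))) := by
  rw [asC_periodicLattice hv (by omega) (by omega), Submodule.map_sup, Submodule.mkQ_map_self,
    sup_bot_eq, Submodule.map_span, ← Set.image_comp]
  congr 1
  ext x
  constructor
  · rintro ⟨j, hj, rfl⟩
    have h1 := hj.1
    have h2 := hj.2
    refine ⟨⟨j.toNat - 1 - i, by omega⟩, ?_⟩
    simp only [Function.comp_apply]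
    congr 2
    omega
  · rintro ⟨a, rfl⟩
    exact ⟨_, ⟨by omega, by omega⟩, rfl⟩

lemma finrank_map_mkQ_periodicLattice (hv : IsPeriodicBasis v) {i : ℕ} (hK : i ≤ K) :
    Module.finrank ℂ ((asC (periodicLattice v i)).map
      (asC (epsMul (periodicLattice v 0))).mkQ) = K - i := by
  have hinj : Function.Injective (fun a : Fin (K - i) => (⟨i + a, by omega⟩ : Fin K)) := by
    intro a b h
    simp only [Fin.mk.injEq] at h
    ext
    omega
  rw [map_mkQ_periodicLattice hv hK]
  exact (finrank_span_eq_card ((linearIndependent_mkQ hv).comp _ hinj)).trans (Fintype.card_fin _)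

lemma finiteDimensional_map_mkQ_periodicLattice (hv : IsPeriodicBasis v) :
    FiniteDimensional ℂ ((asC (periodicLattice v 0)).map
      (asC (epsMul (periodicLattice v 0))).mkQ) := by
  have := map_mkQ_periodicLattice hv (Nat.zero_le K)
  rw [Nat.cast_zero] at this
  rw [this]
  exact FiniteDimensional.span_of_finite ℂ (Set.finite_range _)

end Flag

end

/-! ### Echelon bases and the Iwahori decomposition of flags -/

section

variable {K : ℕ}

/-- A chain of subspaces of all dimensions has a basis in echelon form with respect to any ordering
of the coordinates. -/
lemma exists_echelon_basis {w : Fin K → ℤ} (hw : Function.Injective w)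
    {F : ℕ → Submodule ℂ (Fin K → ℂ)} (hF : Antitone F)
    (hdim : ∀ i ≤ K, Module.finrank ℂ (F i) = K - i) :
    ∃ (σ : Equiv.Perm (Fin K)) (x : Fin K → Fin K → ℂ), (∀ r, x r r = 1) ∧
      (∀ r s, w s < w r → x r s = 0) ∧
      ∀ i ≤ K, F i = Submodule.span ℂ ((fun a => x (σ a)) '' {a : Fin K | i ≤ a}) := by
  classical
  -- Leading position: the nonzero coordinate of least weight, normalized to 1.
  let Lead : (Fin K → ℂ) → Fin K → Prop := fun x r => x r = 1 ∧ ∀ s, w s < w r → x s = 0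
  have hlead : ∀ x : Fin K → ℂ, x ≠ 0 → ∃ (c : ℂ) (r : Fin K), c ≠ 0 ∧ Lead (c • x) r ∧
      x r ≠ 0 := by
    intro x hx
    obtain ⟨s, hs⟩ := Function.ne_iff.1 hx
    obtain ⟨r, hr, hmin⟩ := Finset.exists_min_image (Finset.univ.filter fun r => x r ≠ 0) w
      ⟨s, by simpa using hs⟩
    have hr' : x r ≠ 0 := by simpa using hr
    refine ⟨(x r)⁻¹, r, inv_ne_zero hr', ⟨?_, ?_⟩, hr'⟩
    · rw [Pi.smul_apply, smul_eq_mul, inv_mul_cancel₀ hr']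
    · intro s hs
      have : x s = 0 := by
        by_contra h
        exact absurd (hmin s (by simpa using h)) (not_le.2 hs)
      rw [Pi.smul_apply, this, smul_zero]
  have hlt : ∀ a : Fin K, ∃ x ∈ F a, x ∉ F (a + 1) := by
    intro a
    by_contra! h
    have h1 : F a = F (a + 1) := le_antisymm h (hF (Nat.le_succ _))
    have h2 := hdim a a.2.le
    have h3 := hdim (a + 1) a.2
    rw [h1, h3] at h2
    omega
  -- In each step of the flag choose a vector whose leading position is as late as possible. This
  -- maximality forces the leading positions to be distinct.
  have hchoose : ∀ a : Fin K, ∃ (x : Fin K → ℂ) (r : Fin K), x ∈ F a ∧ x ∉ F (a + 1) ∧ Lead x r ∧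
      ∀ y s, y ∈ F a → y ∉ F (a + 1) → Lead y s → w s ≤ w r := by
    intro a
    obtain ⟨x, hx, hx'⟩ := hlt a
    obtain ⟨c, r, hc, hr, -⟩ := hlead x (fun h => hx' (h ▸ zero_mem _))
    obtain ⟨s, hs, hmax⟩ := Finset.exists_max_image
      (Finset.univ.filter fun r => ∃ x, x ∈ F a ∧ x ∉ F (a + 1) ∧ Lead x r) w
      ⟨r, by
        simp only [Finset.mem_filter, Finset.mem_univ, true_and]
        exact ⟨c • x, Submodule.smul_mem _ _ hx,
          fun h => hx' ((Submodule.smul_mem_iff _ hc).1 h), hr⟩⟩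
    simp only [Finset.mem_filter, Finset.mem_univ, true_and] at hs hmax
    obtain ⟨y, hy, hy', hys⟩ := hs
    exact ⟨y, s, hy, hy', hys, fun z t hz hz' ht => hmax t ⟨z, hz, hz', ht⟩⟩
  choose x ρ hx hx' hxρ hmax using hchoose
  -- If two leading positions agreed, the difference of the two vectors would still be new in step a
  -- but have a later leading position.
  have hne : ∀ a b : Fin K, a < b → ρ a ≠ ρ b := by
    intro a b hab h
    have hb : x b ∈ F (a + 1) := hF (Nat.succ_le_of_lt hab) (hx b)
    have hd : x a - x b ∉ F (a + 1) := fun hd => hx' a (by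
      have := add_mem hd hb
      rwa [sub_add_cancel] at this)
    have hd' : x a - x b ∈ F a := sub_mem (hx a) (hF (Nat.le_succ _) hb)
    obtain ⟨c, r, hc, hr, hr'⟩ := hlead (x a - x b) (fun h => hd (h ▸ zero_mem _))
    have hle := hmax a _ r (Submodule.smul_mem _ c hd')
      (fun h => hd ((Submodule.smul_mem_iff _ hc).1 h)) hr
    apply hr'
    rw [Pi.sub_apply]
    rcases hle.lt_or_eq with hlt' | heq
    · rw [(hxρ a).2 r hlt', (hxρ b).2 r (h ▸ hlt'), sub_zero]
    · rw [hw heq, (hxρ a).1, h, (hxρ b).1, sub_self]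
  have hinj : Function.Injective ρ := by
    intro a b h
    by_contra hab
    rcases lt_or_gt_of_ne hab with h' | h'
    · exact hne a b h' h
    · exact hne b a h' h.symm
  let σ : Equiv.Perm (Fin K) := Equiv.ofBijective ρ (Finite.injective_iff_bijective.1 hinj)
  have hσ : ∀ a, σ a = ρ a := fun a => rfl
  refine ⟨σ, fun r => x (σ.symm r), fun r => ?_, fun r s h => ?_, ?_⟩
  · have := (hxρ (σ.symm r)).1
    rwa [← hσ, σ.apply_symm_apply] at this
  · refine (hxρ (σ.symm r)).2 s ?_
    rwa [← hσ, σ.apply_symm_apply]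
  · simp only [Equiv.symm_apply_apply]
    intro i hi
    apply le_antisymm
    · induction hi using Nat.decreasingInduction with
      | self =>
        have := hdim K le_rfl
        rw [Nat.sub_self, Submodule.finrank_eq_zero] at this
        rw [this]
        exact bot_le
      | @of_succ i hi ih =>
        have hxi := hx ⟨i, hi⟩
        have hxi' := hx' ⟨i, hi⟩
        have hle : F (i + 1) ⊔ Submodule.span ℂ {x ⟨i, hi⟩} ≤ F i :=
          sup_le (hF (Nat.le_succ _)) ((Submodule.span_singleton_le_iff_mem _ _).2 hxi)
        have hlt' : F (i + 1) < F (i + 1) ⊔ Submodule.span ℂ {x ⟨i, hi⟩} := by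
          refine lt_of_le_of_ne le_sup_left fun h => hxi' ?_
          change _ ∈ F (i + 1)
          rw [h]
          exact Submodule.mem_sup_right (Submodule.mem_span_singleton_self _)
        have h1 := Submodule.finrank_lt_finrank_of_lt hlt'
        have h2 := Submodule.finrank_mono hle
        rw [hdim i hi.le] at h2
        rw [hdim (i + 1) hi] at h1
        rw [← Submodule.eq_of_le_of_finrank_eq hle (by rw [hdim i hi.le]; omega)]
        refine sup_le (ih.trans (Submodule.span_mono (Set.image_mono ?_))) ?_
        · intro a ha
          exact (Nat.le_succ i).trans ha
        · rw [Submodule.span_singleton_le_iff_mem]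
          exact Submodule.subset_span ⟨⟨i, hi⟩, le_refl i, rfl⟩
    · rw [Submodule.span_le]
      rintro _ ⟨a, ha, rfl⟩
      exact hF ha (hx a)

/-- A partial flag of type `(K - n, 1^n)` can be completed. -/
lemma exists_full_flag {V : Type*} [AddCommGroup V] [Module ℂ V] [FiniteDimensional ℂ V]
    (hV : Module.finrank ℂ V = K) {n : ℕ} (hn : n ≤ K)
    {L : flagIndex K n → Submodule ℂ V} (hL : Antitone L)
    (hdim : ∀ i, Module.finrank ℂ (L i) = K - i) :
    ∃ F : ℕ → Submodule ℂ V, Antitone F ∧ (∀ i ≤ K, Module.finrank ℂ (F i) = K - i) ∧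
      ∀ i : flagIndex K n, F i = L i := by
  -- The missing members between the whole space and the second member are obtained by adding a
  -- descending chain inside a complement.
  obtain ⟨C, hC⟩ := Submodule.exists_isCompl (L (flagIndex.second K n))
  have hC1 : Module.finrank ℂ C = K - n := by
    have := Submodule.finrank_add_eq_of_isCompl hC
    rw [hdim, hV] at this
    simp only [flagIndex.second] at this
    omega
  let c := Module.finBasisOfFinrankEq ℂ C hC1
  let S : ℕ → Submodule ℂ V := fun i =>
    Submodule.span ℂ (Set.range fun a : Fin (K - n - i) => (c ⟨i + a, by omega⟩ : V))
  have hSC : ∀ i, S i ≤ C := by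
    intro i
    rw [Submodule.span_le]
    rintro _ ⟨a, rfl⟩
    exact (c _).2
  have hS : ∀ i, Module.finrank ℂ (S i) = K - n - i := by
    intro i
    have hli : LinearIndependent ℂ fun a : Fin (K - n - i) => (c ⟨i + a, by omega⟩ : V) :=
      (c.linearIndependent.map' C.subtype C.ker_subtype).comp
        (fun a : Fin (K - n - i) => (⟨i + a, by omega⟩ : Fin (K - n))) (by
          intro a b h
          simp only [Fin.mk.injEq] at h
          ext
          omega)
    exact (finrank_span_eq_card hli).trans (Fintype.card_fin _)
  have hSanti : Antitone S := by
    intro i j hij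
    rw [Submodule.span_le]
    rintro _ ⟨a, rfl⟩
    refine Submodule.subset_span ⟨⟨j - i + a, by omega⟩, ?_⟩
    simp only
    congr 3
    omega
  let F : ℕ → Submodule ℂ V := fun i =>
    if h : K - n ≤ i ∧ i ≤ K then L ⟨i, Or.inr h⟩
    else if i < K - n then L (flagIndex.second K n) ⊔ S i else ⊥
  have hFd : ∀ i ≤ K, Module.finrank ℂ (F i) = K - i := by
    intro i hi
    by_cases h : K - n ≤ i
    · have : F i = L ⟨i, Or.inr ⟨h, hi⟩⟩ := dif_pos ⟨h, hi⟩
      rw [this, hdim]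
    · have : F i = L (flagIndex.second K n) ⊔ S i := by
        simp only [F]
        rw [dif_neg (fun h' => h h'.1), if_pos (not_le.1 h)]
      have hinf : L (flagIndex.second K n) ⊓ S i = ⊥ :=
        le_bot_iff.1 ((inf_le_inf_left _ (hSC i)).trans hC.inf_eq_bot.le)
      have h2 := Submodule.finrank_sup_add_finrank_inf_eq (L (flagIndex.second K n)) (S i)
      rw [hinf, finrank_bot, hdim, hS, add_zero] at h2
      rw [this, h2]
      simp only [flagIndex.second]
      omega
  refine ⟨F, ?_, hFd, ?_⟩
  · intro i j hij
    simp only [F]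
    split_ifs with h1 h2 h3 h4 h5
    · exact hL hij
    · exact (hL (show _ ≤ _ from h1.1)).trans le_sup_left
    · omega
    · omega
    · exact sup_le_sup_left (hSanti hij) _
    · omega
    · exact bot_le
    · exact bot_le
    · exact bot_le
  · rintro ⟨i, hi⟩
    by_cases h : K - n ≤ i ∧ i ≤ K
    · exact dif_pos h
    · have hi0 : i = 0 := flagIndex_eq_zero hi fun h' => h ⟨h', flagIndex_subset K n hi⟩
      subst hi0
      have h1 : F 0 = ⊤ := Submodule.eq_top_of_finrank_eq (by rw [hFd 0 (Nat.zero_le _), hV]; rfl)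
      have h2 : L ⟨0, hi⟩ = ⊤ := Submodule.eq_top_of_finrank_eq (by rw [hdim, hV]; rfl)
      rw [h1, h2]


/-- The index in `Fin K` of the residue of `j`. -/
def residue (hK : 0 < K) (j : ℤ) : Fin K :=
  ⟨((j - 1) % (K : ℤ)).toNat, by
    have := Int.emod_lt_of_pos (j - 1) (by omega : (0 : ℤ) < K)
    have := Int.emod_nonneg (j - 1) (by omega : (K : ℤ) ≠ 0)
    omega⟩

lemma residue_add (hK : 0 < K) (j : ℤ) :
    ((residue hK j : ℕ) : ℤ) + K * ((j - 1) / (K : ℤ)) = j - 1 := by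
  have h := Int.emod_nonneg (j - 1) (by omega : (K : ℤ) ≠ 0)
  have h2 := Int.emod_add_mul_ediv (j - 1) K
  simp only [residue]
  omega

lemma e_eq_single (hK : 0 < K) (j : ℤ) : e K j =
    (HahnSeries.single ((j - 1) / (K : ℤ)) 1 : ℂ⸨X⸩) • (Pi.single (residue hK j) 1 : LVec K) :=
  e_eq_smul hK j

/-- Equal residues mean that the values of ω differ by a multiple of K, hence so do the arguments.
Within a window of length K they are then equal. -/
lemma residue_injective (hK : 0 < K) {ω : Equiv.Perm ℤ} (hω : IsAffinePerm K ω) :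
    Function.Injective (fun r : Fin K => residue hK (ω ((r : ℕ) + 1))) := by
  intro r s h
  have h1 := residue_add hK (ω ((r : ℕ) + 1))
  have h2 := residue_add hK (ω ((s : ℕ) + 1))
  simp only at h
  rw [h] at h1
  set q := (ω ((r : ℕ) + 1) - 1) / (K : ℤ)
  set q' := (ω ((s : ℕ) + 1) - 1) / (K : ℤ)
  have h4 : ω ((s : ℕ) + 1) = ω ((r : ℕ) + 1 + K * (q' - q)) := by
    rw [hω.add_mul]
    linarith
  have h5 := ω.injective h4
  have hq0 : q' - q = 0 := by
    by_contra hq0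
    have := r.2
    have := s.2
    rcases lt_or_gt_of_ne hq0 with h | h
    · have : (K : ℤ) * (q' - q) ≤ -K := by nlinarith
      omega
    · have : (K : ℤ) ≤ K * (q' - q) := by nlinarith
      omega
  rw [hq0] at h5
  ext
  omega

lemma iwahoriMinus_mul {g g' : GL (Fin K) ℂ⸨X⸩} (hg : g ∈ iwahoriMinus K)
    (hg' : g' ∈ iwahoriMinus K) : g * g' ∈ iwahoriMinus K := by
  obtain ⟨h, hl, rfl⟩ := hg
  obtain ⟨h', hl', rfl⟩ := hg'
  refine ⟨h * h', fun i j hij => ?_, (map_mul _ _ _).symm⟩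
  rw [Units.val_mul, Matrix.mul_apply, map_sum]
  refine Finset.sum_eq_zero fun l _ => ?_
  rw [map_mul]
  rcases lt_or_ge i l with h1 | h1
  · rw [hl i l h1, zero_mul]
  · rw [hl' l j (h1.trans_lt hij), mul_zero]

/-- An invertible matrix of the opposite Iwahori group with a given echelon shape. -/
lemma exists_iwahoriMinus (hK : 0 < K) {ω : Equiv.Perm ℤ} (hω : IsAffinePerm K ω)
    {x : Fin K → Fin K → ℂ} (hx1 : ∀ r, x r r = 1)
    (hx : ∀ r s : Fin K, ω ((s : ℕ) + 1) < ω ((r : ℕ) + 1) → x r s = 0) :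
    ∃ g ∈ iwahoriMinus K, ∀ r : Fin K,
      mulVecLin g (e K (ω ((r : ℕ) + 1))) = ∑ s, x r s • e K (ω ((s : ℕ) + 1)) := by
  let ρ : Equiv.Perm (Fin K) := Equiv.ofBijective _
    (Finite.injective_iff_bijective.1 (residue_injective hK hω))
  let q : Fin K → ℤ := fun r => (ω ((r : ℕ) + 1) - 1) / (K : ℤ)
  have hρ : ∀ r, ((ρ r : ℕ) : ℤ) + K * q r = ω ((r : ℕ) + 1) - 1 := fun r => residue_add hK _
  have he : ∀ r : Fin K, e K (ω ((r : ℕ) + 1)) =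
      (HahnSeries.single (q r) 1 : ℂ⸨X⸩) • (Pi.single (ρ r) 1 : LVec K) := fun r =>
    e_eq_single hK _
  -- With ω(r+1) - 1 = ρ(r) + K q(r), the prescribed images force the entry in row ρ(s), column ρ(r)
  -- to be x_{rs} ε^(q(s) - q(r)). The truncation `toNat` matters only where x_{rs} = 0.
  let H : Matrix (Fin K) (Fin K) ℂ⟦X⟧ := Matrix.of fun a b =>
    PowerSeries.C (x (ρ.symm b) (ρ.symm a)) *
      PowerSeries.X ^ (q (ρ.symm a) - q (ρ.symm b)).toNat
  have hq : ∀ r s, x r s ≠ 0 → q r ≤ q s := by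
    intro r s h
    refine Int.ediv_le_ediv (by omega) ?_
    have := not_lt.1 (mt (hx r s) h)
    omega
  -- Above the diagonal ρ(s) < ρ(r), while x_{rs} ≠ 0 requires ω(s+1) ≥ ω(r+1). Hence q(s) > q(r),
  -- and the entry is divisible by ε.
  have hlow : ∀ a b, a < b → PowerSeries.constantCoeff (H a b) = 0 := by
    intro a b hab
    obtain ⟨s, rfl⟩ := ρ.surjective a
    obtain ⟨r, rfl⟩ := ρ.surjective b
    simp only [H, Matrix.of_apply, Equiv.symm_apply_apply, map_mul, map_pow,
      PowerSeries.constantCoeff_C, PowerSeries.constantCoeff_X]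
    by_cases h : x r s = 0
    · rw [h, zero_mul]
    · have h1 := hq r s h
      have h2 := not_lt.1 (mt (hx r s) h)
      have h3 := hρ r
      have h4 := hρ s
      have h5 : q r < q s := by
        have : ((ρ s : ℕ) : ℤ) < (ρ r : ℕ) := by exact_mod_cast hab
        by_contra h6
        have h7 : q r = q s := le_antisymm h1 (not_lt.1 h6)
        rw [h7] at h3
        omega
      rw [zero_pow (by omega), mul_zero]
  have hdiag : ∀ a, PowerSeries.constantCoeff (H a a) = 1 := by
    intro a
    simp [H, hx1]
  have hdet : IsUnit H.det := by
    rw [PowerSeries.isUnit_iff_constantCoeff, RingHom.map_det, Matrix.det_of_isLowerTriangular]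
    · simp [hdiag]
    · intro a b hab
      exact hlow a b hab
  let h : GL (Fin K) ℂ⟦X⟧ := ((Matrix.isUnit_iff_isUnit_det H).2 hdet).unit
  refine ⟨Matrix.GeneralLinearGroup.map (algebraMap ℂ⟦X⟧ ℂ⸨X⸩) h, ⟨h, hlow, rfl⟩, fun r => ?_⟩
  have hcol : mulVecLin (Matrix.GeneralLinearGroup.map (algebraMap ℂ⟦X⟧ ℂ⸨X⸩) h)
      (Pi.single (ρ r) 1) = fun a => algebraMap ℂ⟦X⟧ ℂ⸨X⸩ (H a (ρ r)) := by
    ext1 a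
    simp [mulVecLin, h]
  rw [he r, map_smul, hcol]
  ext1 a
  obtain ⟨s, rfl⟩ := ρ.surjective a
  rw [Finset.sum_apply, Finset.sum_eq_single s]
  · rw [he s, Pi.smul_apply, Pi.smul_apply, Pi.smul_apply, Pi.single_eq_same]
    simp only [H, Matrix.of_apply, Equiv.symm_apply_apply, smul_eq_mul, mul_one, map_mul, map_pow]
    by_cases hxs : x r s = 0
    · rw [hxs, map_zero, map_zero, zero_mul, mul_zero]
      exact (zero_smul ℂ _).symm
    · have h1 := hq r s hxs
      rw [LaurentSeries.coe_algebraMap, HahnSeries.ofPowerSeries_C, HahnSeries.ofPowerSeries_X,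
        HahnSeries.single_pow, one_pow, mul_left_comm, single_mul_single_one,
        HahnSeries.C_mul_eq_smul]
      rw [nsmul_one, Int.toNat_of_nonneg (by omega), add_sub_cancel]
  · intro s' _ hs'
    rw [he s', Pi.smul_apply, Pi.smul_apply, Pi.single_eq_of_ne
      (fun h => hs' (ρ.injective h).symm), smul_eq_mul, mul_zero]
    exact smul_zero _
  · intro h
    exact absurd (Finset.mem_univ _) h

/-- The affine permutation permuting the residues. -/
lemma exists_affinePerm (hK : 0 < K) (σ : Equiv.Perm (Fin K)) :
    ∃ τ : Equiv.Perm ℤ, IsAffinePerm K τ ∧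
      ∀ r : Fin K, τ ((r : ℕ) + 1) = (σ r : ℕ) + 1 := by
  have : NeZero K := ⟨hK.ne'⟩
  let f : ℤ ≃ ℤ × Fin K := (Equiv.subRight (1 : ℤ)).trans (Int.divModEquiv K)
  have hf : ∀ (p : ℤ × Fin K), f.symm p = p.1 * K + (p.2 : ℕ) + 1 := by
    intro p
    simp [f, Int.divModEquiv]
  let τ : Equiv.Perm ℤ := f.trans (((Equiv.refl ℤ).prodCongr σ).trans f.symm)
  have hτ : ∀ q r, τ (f.symm (q, r)) = f.symm (q, σ r) := by
    intro q r
    simp [τ]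
  refine ⟨τ, fun i => ?_, fun r => ?_⟩
  · obtain ⟨⟨q, r⟩, rfl⟩ := f.symm.surjective i
    have : f.symm (q, r) + K = f.symm (q + 1, r) := by
      rw [hf, hf]
      ring
    rw [this, hτ, hτ, hf, hf]
    ring
  · have := hτ 0 r
    rw [hf, hf] at this
    simpa using this

end

section

variable {K : ℕ}

/-- Every flag of lattices between `Λ = g₀ ω₀ Λ₀` and `ε Λ` is of the form `g ω Λ_•` with `g` in the
opposite Iwahori group and `ω` obtained from `ω₀` by permuting `{1, …, K}`. -/
lemma exists_iwahori_flag (hK : 0 < K) {g₀ : GL (Fin K) ℂ⸨X⸩} (hg₀ : g₀ ∈ iwahoriMinus K)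
    {ω₀ : Equiv.Perm ℤ} (hω₀ : IsAffinePerm K ω₀) {P : Submodule ℂ⟦X⟧ (LVec K)}
    (hP : P = periodicLattice (fun j => mulVecLin g₀ (e K (ω₀ j))) 0) {n : ℕ} (hn : n ≤ K)
    {L : flagIndex K n → Submodule ℂ (LVec K)} (hL : Antitone L)
    (hLP : ∀ i, L i ≤ asC P) (hL' : ∀ i, asC (epsMul P) ≤ L i)
    (hdim : ∀ i, Module.finrank ℂ ((L i).map (asC (epsMul P)).mkQ) = K - i) :
    ∃ g ∈ iwahoriMinus K, ∃ ω : Equiv.Perm ℤ, IsAffinePerm K ω ∧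
      (∃ σ : Equiv.Perm (Fin K), ∀ r : Fin K, ω ((r : ℕ) + 1) = ω₀ ((σ r : ℕ) + 1)) ∧
      ∀ i : flagIndex K n,
        L i = asC (periodicLattice (fun j => mulVecLin g (e K (ω j))) (i : ℕ)) := by
  subst hP
  set v : ℤ → LVec K := fun j => mulVecLin g₀ (e K (ω₀ j)) with hv_def
  have hv : IsPeriodicBasis v := (isPeriodicBasis_e_comp hω₀).map g₀
  set P' := asC (epsMul (periodicLattice v 0)) with hP'
  let φ : (Fin K → ℂ) →ₗ[ℂ] LVec K :=
    Fintype.linearCombination ℂ (fun r : Fin K => v ((r : ℕ) + 1))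
  have hφ : ∀ c, φ c = ∑ r, c r • v ((r : ℕ) + 1) := fun c =>
    Fintype.linearCombination_apply ℂ _ c
  have hφinj : Function.Injective (P'.mkQ ∘ₗ φ) := by
    have := (linearIndependent_mkQ hv).fintypeLinearCombination_injective
    convert this using 1
    ext1 c
    rw [LinearMap.comp_apply, hφ, map_sum, Fintype.linearCombination_apply]
    simp only [map_smul]
    rfl
  have hPφ : asC (periodicLattice v 0) = LinearMap.range φ ⊔ P' := by
    have h := asC_periodicLattice hv le_rfl (by omega)
    rw [h, ← hP']
    congr 1
    rw [Fintype.range_linearCombination]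
    congr 1
    ext x
    constructor
    · rintro ⟨j, hj, rfl⟩
      have h1 := hj.1
      have h2 := hj.2
      refine ⟨⟨j.toNat - 1, by omega⟩, congrArg v ?_⟩
      change ((j.toNat - 1 : ℕ) : ℤ) + 1 = j
      omega
    · rintro ⟨r, rfl⟩
      exact ⟨_, ⟨by omega, by omega⟩, rfl⟩
  have hLφ : ∀ i, ((L i).comap φ).map φ ⊔ P' = L i := fun i =>
    JordanSection.map_comap_sup (hL' i) ((hLP i).trans hPφ.le)
  have hfr : ∀ i, Module.finrank ℂ ((L i).comap φ) = K - i := by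
    intro i
    rw [← hdim i]
    conv_rhs => rw [← hLφ i]
    rw [Submodule.map_sup, Submodule.mkQ_map_self, sup_bot_eq, ← Submodule.map_comp]
    exact (Submodule.equivMapOfInjective _ hφinj _).finrank_eq
  obtain ⟨F, hF, hFdim, hFL⟩ := exists_full_flag (Module.finrank_fin_fun ℂ) hn
    (L := fun i => (L i).comap φ) (fun i j hij => Submodule.comap_mono (hL hij)) hfr
  have hw : Function.Injective (fun r : Fin K => ω₀ ((r : ℕ) + 1)) := by
    intro r s h
    have := ω₀.injective h
    ext
    omega
  -- Coordinates are ordered by the values of `ω₀`, so that the echelon shape is exactly what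
  -- `exists_iwahoriMinus` turns into an opposite Iwahori matrix.
  obtain ⟨σ, x, hx1, hx0, hFx⟩ := exists_echelon_basis hw hF hFdim
  obtain ⟨h, hh, hhx⟩ := exists_iwahoriMinus hK hω₀ hx1 hx0
  obtain ⟨τ, hτ, hτσ⟩ := exists_affinePerm hK σ
  have hω : IsAffinePerm K (τ.trans ω₀) := fun i => by
    rw [Equiv.trans_apply, Equiv.trans_apply, hτ, hω₀]
  have hωσ : ∀ r : Fin K, (τ.trans ω₀) ((r : ℕ) + 1) = ω₀ ((σ r : ℕ) + 1) := fun r => by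
    rw [Equiv.trans_apply, hτσ]
  refine ⟨g₀ * h, iwahoriMinus_mul hg₀ hh, τ.trans ω₀, hω, ⟨σ, hωσ⟩, ?_⟩
  set v' : ℤ → LVec K := fun j => mulVecLin (g₀ * h) (e K ((τ.trans ω₀) j)) with hv'_def
  have hv' : IsPeriodicBasis v' := (isPeriodicBasis_e_comp hω).map _
  have hv'φ : ∀ a : Fin K, v' ((a : ℕ) + 1) = φ (x (σ a)) := by
    intro a
    have hmul : ∀ y, mulVecLin (g₀ * h) y = mulVecLin g₀ (mulVecLin h y) := fun y => by
      simp [mulVecLin, Matrix.toLin'_mul]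
    rw [hv'_def, hφ]
    simp only
    rw [hωσ, hmul, hhx, map_sum]
    exact Finset.sum_congr rfl fun s _ => ((mulVecLin g₀).restrictScalars ℂ).map_smul _ _
  have hspan : ∀ i : ℕ, i ≤ K → Submodule.span ℂ (v' '' Set.Ioc (i : ℤ) K) = (F i).map φ := by
    intro i hi
    rw [hFx i hi, Submodule.map_span, ← Set.image_comp]
    congr 1
    ext y
    constructor
    · rintro ⟨j, hj, rfl⟩
      have h1 := hj.1
      have h2 := hj.2
      refine ⟨⟨j.toNat - 1, by omega⟩, ?_, ?_⟩
      · change i ≤ j.toNat - 1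
        omega
      · rw [Function.comp_apply, ← hv'φ]
        refine congrArg v' ?_
        change ((j.toNat - 1 : ℕ) : ℤ) + 1 = j
        omega
    · rintro ⟨a, ha, rfl⟩
      have ha' : i ≤ (a : ℕ) := ha
      exact ⟨(a : ℕ) + 1, ⟨by omega, by omega⟩, hv'φ a⟩
  have hF0 : F 0 = ⊤ := Submodule.eq_top_of_finrank_eq (by
    rw [hFdim 0 (Nat.zero_le _), Module.finrank_fin_fun, Nat.sub_zero])
  -- The new basis changes the flag but not Λ, since the echelon vectors span all of ℂ^K.
  have hPP : periodicLattice v' 0 = periodicLattice v 0 := by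
    have h0 := hspan 0 (Nat.zero_le _)
    rw [hF0, ← LinearMap.range_eq_map, Nat.cast_zero] at h0
    apply le_antisymm
    · rw [periodicLattice, Submodule.span_le]
      rintro _ ⟨j, hj, rfl⟩
      change _ ∈ asC (periodicLattice v 0)
      rw [hPφ, ← h0]
      refine Submodule.mem_sup_left (Submodule.subset_span ⟨j, ?_, rfl⟩)
      rwa [zero_add] at hj
    · rw [periodicLattice, Submodule.span_le]
      rintro _ ⟨j, hj, rfl⟩
      have h1 := hj.1
      have h2 := hj.2
      have hr : v j ∈ LinearMap.range φ := by
        refine ⟨Pi.single ⟨j.toNat - 1, by omega⟩ 1, ?_⟩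
        refine (Fintype.linearCombination_apply_single ℂ _ _ _).trans ?_
        rw [one_smul]
        refine congrArg v ?_
        change ((j.toNat - 1 : ℕ) : ℤ) + 1 = j
        omega
      rw [← h0] at hr
      change _ ∈ asC (periodicLattice v' 0)
      rw [asC_periodicLattice hv' le_rfl (by omega)]
      exact Submodule.mem_sup_left hr
  intro i
  have hi := flagIndex_subset K n i.2
  simp only [Set.mem_ofPred_eq] at hi
  rw [asC_periodicLattice hv' (by omega) (by omega), hspan _ hi, hPP, hFL, ← hP', hLφ]

end

/-! ### The operator γ on 𝕆^K: nilpotency modulo ε and its cokernel -/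

/-- The coordinate `s` and the exponent `m` such that the `r`-th coordinate of `γ y` is
`ε^m y_s`. -/
def gammaSource (n k N r : ℕ) : ℕ × ℕ :=
  if k ≤ r then (r - k, 0) else if 1 ≤ r then (bigK n k - k + r - 1, 1)
  else (bigK n k - 1, N + 1)

lemma bigK_eq {n k : ℕ} : bigK n k = (n - k) * k + k := by
  rw [bigK]
  ring

lemma bigK_pos {n k : ℕ} (hk : 1 ≤ k) : 0 < bigK n k := by
  rw [bigK_eq]
  omega

lemma gammaSource_lt {n k N r : ℕ} (hk : 1 ≤ k) (hr : r < bigK n k) :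
    (gammaSource n k N r).1 < bigK n k := by
  have h := bigK_eq (n := n) (k := k)
  unfold gammaSource
  split_ifs <;> simp only <;> omega

/-- Division with remainder of γ(s+1) - 1 by K, in the three cases of the definition of γ: no
wrap-around, one wrap-around (exponent 1), and the last vector (exponent N + 1). -/
lemma gammaIndex_sub_one {n k N : ℕ} (hk : 1 ≤ k) {r s : ℕ} (hr : r < bigK n k)
    (hs : s < bigK n k) :
    ((r : ℤ) = ((gammaIndex n k N (s + 1) : ℕ) - 1 : ℤ) % (bigK n k : ℤ) ↔
      (gammaSource n k N r).1 = s) ∧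
    ((gammaSource n k N r).1 = s →
      ((gammaIndex n k N (s + 1) : ℕ) - 1 : ℤ) / (bigK n k : ℤ) = (gammaSource n k N r).2) := by
  have hK := bigK_eq (n := n) (k := k)
  set K := bigK n k
  have h0 : (0 : ℤ) < K := by omega
  obtain ⟨a, d, hd, ha, hval⟩ : ∃ a d : ℕ, gammaIndex n k N (s + 1) = a + K * d + 1 ∧ a < K ∧
      ((s + 1 ≤ (n - k) * k ∧ a = s + k ∧ d = 0) ∨
        ((n - k) * k < s + 1 ∧ s + 1 < K ∧ a + K = s + k + 1 ∧ d = 1) ∨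
        (s + 1 = K ∧ a = 0 ∧ d = N + 1)) := by
    unfold gammaIndex
    by_cases h1 : s + 1 ≤ (n - k) * k
    · exact ⟨s + k, 0, by rw [if_pos h1]; omega, by omega, Or.inl ⟨h1, rfl, rfl⟩⟩
    · by_cases h2 : s + 1 < K
      · exact ⟨s + k + 1 - K, 1, by rw [if_neg h1, if_pos h2]; omega, by omega,
          Or.inr (Or.inl ⟨not_le.1 h1, h2, by omega, rfl⟩)⟩
      · exact ⟨0, N + 1, by rw [if_neg h1, if_neg h2]; exact (by ring : 1 + K * (N + 1) = 0 + K * (N + 1) + 1), by omega,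
          Or.inr (Or.inr ⟨by omega, rfl, rfl⟩)⟩
  have hmod : ((gammaIndex n k N (s + 1) : ℕ) - 1 : ℤ) % K = a := by
    rw [hd]
    push_cast
    rw [add_sub_cancel_right, Int.add_mul_emod_self_left]
    exact Int.emod_eq_of_lt (by omega) (by omega)
  have hdiv : ((gammaIndex n k N (s + 1) : ℕ) - 1 : ℤ) / K = d := by
    rw [hd]
    push_cast
    rw [add_sub_cancel_right, Int.add_mul_ediv_left _ _ h0.ne',
      Int.ediv_eq_zero_of_lt (by omega) (by omega), zero_add]
  rw [hmod, hdiv]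
  unfold gammaSource
  constructor
  · split_ifs <;> simp only <;> omega
  · split_ifs <;> simp only <;> omega

lemma gamma_apply {n k N : ℕ} (hk : 1 ≤ k) (y : LVec (bigK n k)) (r : Fin (bigK n k)) :
    gamma n k N y r = HahnSeries.single ((gammaSource n k N r).2 : ℤ) 1 *
      y ⟨(gammaSource n k N r).1, gammaSource_lt hk r.2⟩ := by
  rw [gamma, Module.Basis.constr_apply_fintype, Finset.sum_apply,
    Finset.sum_eq_single ⟨(gammaSource n k N r).1, gammaSource_lt hk r.2⟩]
  · have h := gammaIndex_sub_one (N := N) hk r.2 (gammaSource_lt (N := N) hk r.2)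
    rw [Pi.smul_apply, e_apply, if_pos (h.1.2 rfl), h.2 rfl, Pi.basisFun_equivFun]
    simp [mul_comm]
  · intro s _ hs
    have h := gammaIndex_sub_one (N := N) hk r.2 s.2
    rw [Pi.smul_apply, e_apply, if_neg (fun h' => hs (Fin.ext (h.1.1 h').symm)), smul_eq_mul, mul_zero]
  · intro h
    exact absurd (Finset.mem_univ _) h

/-- The operator `γ` on `𝕆^K`. -/
def gammaO {n k : ℕ} (N : ℕ) (hk : 1 ≤ k) :
    (Fin (bigK n k) → ℂ⟦X⟧) →ₗ[ℂ⟦X⟧] (Fin (bigK n k) → ℂ⟦X⟧) where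
  toFun y r := PowerSeries.X ^ (gammaSource n k N r).2 *
    y ⟨(gammaSource n k N r).1, gammaSource_lt hk r.2⟩
  map_add' x y := by
    ext1 r
    simp [mul_add]
  map_smul' c y := by
    ext1 r
    simp [mul_left_comm]

lemma gammaO_apply {n k N : ℕ} (hk : 1 ≤ k) (y : Fin (bigK n k) → ℂ⟦X⟧) (r : Fin (bigK n k)) :
    gammaO N hk y r = PowerSeries.X ^ (gammaSource n k N r).2 *
      y ⟨(gammaSource n k N r).1, gammaSource_lt hk r.2⟩ := rfl

lemma gammaO_apply_of_le {n k N : ℕ} (hk : 1 ≤ k) (y : Fin (bigK n k) → ℂ⟦X⟧)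
    {r : Fin (bigK n k)} (hr : k ≤ r) : gammaO N hk y r = y ⟨r - k, by omega⟩ := by
  rw [gammaO_apply]
  have : gammaSource n k N r = (r - k, 0) := if_pos hr
  simp [this]

lemma gammaO_apply_of_lt {n k N : ℕ} (hk : 1 ≤ k) (y : Fin (bigK n k) → ℂ⟦X⟧)
    {r : Fin (bigK n k)} (hr : (r : ℕ) < k) (hr' : 1 ≤ (r : ℕ)) :
    gammaO N hk y r = PowerSeries.X * y ⟨bigK n k - k + r - 1, by omega⟩ := by
  rw [gammaO_apply]
  have : gammaSource n k N r = (bigK n k - k + r - 1, 1) := by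
    rw [gammaSource, if_neg (not_le.2 hr), if_pos hr']
  simp [this]

lemma gammaO_apply_zero {n k N : ℕ} (hk : 1 ≤ k) (y : Fin (bigK n k) → ℂ⟦X⟧) :
    gammaO N hk y ⟨0, bigK_pos hk⟩ =
      PowerSeries.X ^ (N + 1) * y ⟨bigK n k - 1, by have := bigK_pos (n := n) hk; omega⟩ := by
  rw [gammaO_apply]
  have : gammaSource n k N 0 = (bigK n k - 1, N + 1) := by
    rw [gammaSource, if_neg (by omega), if_neg (by omega)]
  simp [this]

/-- Each application of γ moves coordinates down by k rows and fills the top k rows with multiples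
of ε. After n - k + 1 applications all K rows are covered. -/
lemma gammaO_pow_dvd {n k N : ℕ} (hk : 1 ≤ k) (y : Fin (bigK n k) → ℂ⟦X⟧) (j : ℕ)
    (r : Fin (bigK n k)) (hr : (r : ℕ) < j * k) :
    (PowerSeries.X : ℂ⟦X⟧) ∣ (gammaO N hk ^ j) y r := by
  induction j generalizing r with
  | zero => simp at hr
  | succ j ih =>
    rw [pow_succ', Module.End.mul_apply]
    by_cases h : k ≤ r
    · rw [gammaO_apply_of_le hk _ h]
      refine ih _ ?_
      rw [Nat.succ_mul] at hr
      simp only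
      omega
    · by_cases h' : 1 ≤ (r : ℕ)
      · rw [gammaO_apply_of_lt hk _ (not_le.1 h) h']
        exact dvd_mul_right _ _
      · have : r = ⟨0, bigK_pos hk⟩ := Fin.ext (by simp only; omega)
        rw [this, gammaO_apply_zero]
        exact (dvd_pow_self _ (Nat.succ_ne_zero N)).mul_right _

/-- `γ^(n-k+1)` maps `𝕆^K` into `ε 𝕆^K`. -/
lemma exists_gammaO_pow_eq {n k N : ℕ} (hk : 1 ≤ k) (y : Fin (bigK n k) → ℂ⟦X⟧) :
    ∃ z, (gammaO N hk ^ (n - k + 1)) y = (PowerSeries.X : ℂ⟦X⟧) • z := by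
  choose z hz using fun r : Fin (bigK n k) => gammaO_pow_dvd (N := N) hk y (n - k + 1) r (by
    have := r.2
    have := bigK_eq (n := n) (k := k)
    rw [Nat.succ_mul]
    omega)
  exact ⟨z, funext fun r => hz r⟩

lemma exists_gammaO_pow_mul_eq {n k N : ℕ} (hk : 1 ≤ k) (y : Fin (bigK n k) → ℂ⟦X⟧) (c : ℕ) :
    ∃ z, (gammaO N hk ^ ((n - k + 1) * c)) y = (PowerSeries.X ^ c : ℂ⟦X⟧) • z := by
  induction c with
  | zero => exact ⟨y, by simp⟩
  | succ c ih =>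
    obtain ⟨z, hz⟩ := ih
    obtain ⟨z', hz'⟩ := exists_gammaO_pow_eq (N := N) hk z
    refine ⟨z', ?_⟩
    rw [Nat.mul_succ, Nat.add_comm, pow_add, Module.End.mul_apply, hz, map_smul, hz', smul_smul,
      ← pow_succ]

/-- The cokernel of `γ` on `𝕆^K` is spanned by `k + N` vectors. -/
lemma exists_gammaO_sub_mem {n k N : ℕ} (hk : 1 ≤ k) :
    ∃ w : Fin (N + 1) ⊕ Fin (k - 1) → Fin (bigK n k) → ℂ⟦X⟧, ∀ m : Fin (bigK n k) → ℂ⟦X⟧,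
      ∃ y, m - gammaO N hk y ∈ Submodule.span ℂ (Set.range w) := by
  have hK := bigK_eq (n := n) (k := k)
  -- What γ misses: powers of ε below N + 1 in the first coordinate, and constants in coordinates 2,
  -- …, k.
  let w : Fin (N + 1) ⊕ Fin (k - 1) → Fin (bigK n k) → ℂ⟦X⟧ := Sum.elim
    (fun j => Pi.single ⟨0, bigK_pos hk⟩ (PowerSeries.X ^ (j : ℕ)))
    (fun a => Pi.single ⟨a + 1, by omega⟩ 1)
  refine ⟨w, fun m => ?_⟩
  let sh : ℕ → ℂ⟦X⟧ → ℂ⟦X⟧ := fun i p => PowerSeries.mk fun j => PowerSeries.coeff (i + j) p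
  -- Invert γ row by row, dividing by the relevant power of ε and discarding the low-order terms.
  let y : Fin (bigK n k) → ℂ⟦X⟧ := fun s =>
    if h : s + k < bigK n k then m ⟨s + k, h⟩
    else if h' : s + 1 < bigK n k then sh 1 (m ⟨s + 1 + k - bigK n k, by omega⟩)
    else sh (N + 1) (m ⟨0, bigK_pos hk⟩)
  refine ⟨y, ?_⟩
  set S := Submodule.span ℂ (Set.range w)
  have hsh : ∀ i p, p - PowerSeries.X ^ i * sh i p =
      ∑ j : Fin i, PowerSeries.coeff (j : ℕ) p • (PowerSeries.X : ℂ⟦X⟧) ^ (j : ℕ) := by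
    intro i p
    ext d
    rw [map_sub, PowerSeries.coeff_X_pow_mul', map_sum]
    simp only [PowerSeries.coeff_smul, PowerSeries.coeff_X_pow, smul_eq_mul, mul_ite, mul_one,
      mul_zero]
    by_cases hd : i ≤ d
    · rw [if_pos hd, PowerSeries.coeff_mk, Nat.add_sub_cancel' hd, sub_self, eq_comm]
      exact Finset.sum_eq_zero fun j _ => if_neg (by omega)
    · rw [if_neg hd, sub_zero, Finset.sum_eq_single ⟨d, not_le.1 hd⟩]
      · simp
      · intro j _ hj
        exact if_neg fun h => hj (Fin.ext h.symm)
      · intro h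
        exact absurd (Finset.mem_univ _) h
  rw [← Finset.univ_sum_single (m - gammaO N hk y)]
  refine Submodule.sum_mem _ fun r _ => ?_
  rw [Pi.sub_apply]
  by_cases h1 : k ≤ r
  · have : y ⟨r - k, by omega⟩ = m r := by
      simp only [y]
      rw [dif_pos (by omega)]
      congr 2
      omega
    rw [gammaO_apply_of_le hk y h1, this, sub_self, Pi.single_zero]
    exact zero_mem _
  · by_cases h2 : 1 ≤ (r : ℕ)
    · have : y ⟨bigK n k - k + r - 1, by omega⟩ = sh 1 (m r) := by
        simp only [y]
        rw [dif_neg (by omega), dif_pos (by omega)]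
        congr 3
        omega
      have h3 := hsh 1 (m r)
      rw [pow_one, Fin.sum_univ_one] at h3
      rw [gammaO_apply_of_lt hk y (not_le.1 h1) h2, this, h3, Fin.val_zero, pow_zero,
        Pi.single_smul]
      refine Submodule.smul_mem _ _ (Submodule.subset_span ⟨Sum.inr ⟨r - 1, by omega⟩, ?_⟩)
      simp only [w, Sum.elim_inr]
      congr 1
      ext
      simp only
      omega
    · have hr : r = ⟨0, bigK_pos hk⟩ := Fin.ext (by simp only; omega)
      have : y ⟨bigK n k - 1, by omega⟩ = sh (N + 1) (m r) := by
        simp only [y]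
        rw [dif_neg (by omega), dif_neg (by omega), hr]
      rw [hr, gammaO_apply_zero hk y, this, hr, hsh, ← LinearMap.single_apply ℂ, map_sum]
      refine Submodule.sum_mem _ fun j _ => ?_
      rw [map_smul]
      exact Submodule.smul_mem _ _ (Submodule.subset_span ⟨Sum.inl j, rfl⟩)

/-- If `T` has a cokernel of dimension at most `m`, then so has its restriction to a stable
subspace. -/
lemma card_le_of_forall_eq_zero {D ι τ : Type*} [AddCommGroup D] [Module ℂ D]
    [FiniteDimensional ℂ D] [Fintype ι] [Fintype τ] (T : Module.End ℂ D) (w : τ → D)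
    (hw : LinearMap.range T ⊔ Submodule.span ℂ (Set.range w) = ⊤) {P : Submodule ℂ D}
    (hP : P ≤ P.comap T) (z : ι → D) (hz : ∀ i, z i ∈ P)
    (hz0 : ∀ a : ι → ℂ, ∑ i, a i • z i ∈ P.map T → a = 0) :
    Fintype.card ι ≤ Fintype.card τ := by
  have h1 := T.finrank_range_add_finrank_ker
  have h2 : Module.finrank ℂ D ≤ Module.finrank ℂ (LinearMap.range T) + Fintype.card τ := by
    rw [← finrank_top ℂ D, ← hw]
    exact (Submodule.finrank_add_le_finrank_add_finrank _ _).trans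
      (Nat.add_le_add_left (finrank_range_le_card w) _)
  have h3 := (T.domRestrict P).finrank_range_add_finrank_ker
  rw [LinearMap.range_domRestrict] at h3
  -- In finite dimension kernel and cokernel have equal dimension, and the kernel can only shrink on
  -- a subspace.
  have h4 : Module.finrank ℂ (LinearMap.ker (T.domRestrict P)) ≤
      Module.finrank ℂ (LinearMap.ker T) := by
    rw [← Submodule.finrank_map_subtype_eq]
    refine Submodule.finrank_mono ?_
    rintro _ ⟨x, hx, rfl⟩
    exact hx
  have hli : LinearIndependent ℂ z := Fintype.linearIndependent_iff.2 fun a ha =>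
    congrFun (hz0 a (ha ▸ zero_mem _))
  have hinf : Submodule.span ℂ (Set.range z) ⊓ P.map T = ⊥ := by
    rw [Submodule.eq_bot_iff]
    rintro x ⟨hx, hx'⟩
    obtain ⟨a, rfl⟩ := (Submodule.mem_span_range_iff_exists_fun ℂ).1 hx
    rw [hz0 a hx']
    simp
  have h5 := Submodule.finrank_sup_add_finrank_inf_eq (Submodule.span ℂ (Set.range z)) (P.map T)
  rw [hinf, finrank_bot, add_zero, finrank_span_eq_card hli] at h5
  have h6 : Submodule.span ℂ (Set.range z) ⊔ P.map T ≤ P :=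
    sup_le (Submodule.span_le.2 (by rintro _ ⟨i, rfl⟩; exact hz i)) (Submodule.map_le_iff_le_comap.2 hP)
  have h7 := Submodule.finrank_mono h6
  omega

/-- A `γ`-stable sublattice of `𝕆^K` containing a vector with invertible first coordinate is
generated modulo the image of `γ` and `ε` by at most `k` vectors. -/
lemma not_forall_eq_zero_of_gammaO {n k N : ℕ} (hk : 1 ≤ k)
    (P : Submodule ℂ⟦X⟧ (Fin (bigK n k) → ℂ⟦X⟧)) (hP : ∀ x ∈ P, gammaO N hk x ∈ P)
    {v : Fin (bigK n k) → ℂ⟦X⟧} (hv : v ∈ P)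
    (hv0 : PowerSeries.constantCoeff (v ⟨0, bigK_pos hk⟩) ≠ 0) (c : ℕ)
    (hc : ∀ m, (PowerSeries.X ^ c : ℂ⟦X⟧) • m ∈ P) (x : Fin (k + 1) → Fin (bigK n k) → ℂ⟦X⟧)
    (hx : ∀ i, x i ∈ P) :
    ¬ ∀ a : Fin (k + 1) → ℂ, ∀ y ∈ P, ∀ z ∈ P,
      ∑ i, a i • x i = gammaO N hk y + (PowerSeries.X : ℂ⟦X⟧) • z → a = 0 := by
  intro hind
  -- Truncate at a power of ε large enough that the error lies in εP (needs c + 1) and its first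
  -- coordinate is divisible by ε^(N+1).
  let c' := c + N + 1
  let Θ : (Fin (bigK n k) → ℂ⟦X⟧) →ₗ[ℂ] (Fin (bigK n k) × Fin c' → ℂ) :=
    { toFun := fun m p => PowerSeries.coeff (p.2 : ℕ) (m p.1)
      map_add' := fun _ _ => by ext1; simp
      map_smul' := fun _ _ => by ext1; simp }
  let B := LinearMap.ker Θ
  have hB : ∀ m, m ∈ B ↔ ∃ z, m = (PowerSeries.X ^ c' : ℂ⟦X⟧) • z := by
    intro m
    have h1 : m ∈ B ↔ ∀ r, (PowerSeries.X ^ c' : ℂ⟦X⟧) ∣ m r := by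
      rw [LinearMap.mem_ker]
      simp only [PowerSeries.X_pow_dvd_iff]
      constructor
      · intro h r j hj
        exact congrFun h (r, ⟨j, hj⟩)
      · intro h
        ext1 p
        exact h p.1 p.2 p.2.2
    rw [h1]
    constructor
    · intro h
      choose z hz using h
      exact ⟨z, funext hz⟩
    · rintro ⟨z, rfl⟩ r
      exact dvd_mul_right _ _
  let T₀ : Module.End ℂ (Fin (bigK n k) → ℂ⟦X⟧) := (gammaO N hk).restrictScalars ℂ
  have hT₀ : ∀ y, T₀ y = gammaO N hk y := fun y => rfl
  have hBT : B ≤ B.comap T₀ := by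
    intro m hm
    obtain ⟨z, rfl⟩ := (hB m).1 hm
    exact (hB _).2 ⟨gammaO N hk z, (gammaO N hk).map_smul _ _⟩
  let T : Module.End ℂ (_ ⧸ B) := B.mapQ B T₀ hBT
  have hT : ∀ m, T (B.mkQ m) = B.mkQ (gammaO N hk m) := fun m => rfl
  have hfin : FiniteDimensional ℂ ((Fin (bigK n k) → ℂ⟦X⟧) ⧸ B) :=
    Θ.quotKerEquivRange.symm.finiteDimensional
  obtain ⟨w, hw⟩ := exists_gammaO_sub_mem (n := n) (N := N) hk
  let Pq : Submodule ℂ (_ ⧸ B) := (P.restrictScalars ℂ).map B.mkQ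
  -- The k + 1 given vectors together with εv, …, ε^N v would be k + 1 + N independent elements of a
  -- cokernel of dimension at most k + N.
  let z : Fin (k + 1) ⊕ Fin N → Fin (bigK n k) → ℂ⟦X⟧ :=
    Sum.elim x (fun j => (PowerSeries.X ^ ((j : ℕ) + 1) : ℂ⟦X⟧) • v)
  have hcard := card_le_of_forall_eq_zero T (fun i => B.mkQ (w i)) (P := Pq) ?_ ?_
    (fun i => B.mkQ (z i)) ?_ ?_
  · simp only [Fintype.card_sum, Fintype.card_fin] at hcard
    omega
  · rw [eq_top_iff]
    intro m _
    obtain ⟨m, rfl⟩ := B.mkQ_surjective m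
    obtain ⟨y, hy⟩ := hw m
    rw [← sub_add_cancel m (gammaO N hk y), map_add]
    refine add_mem (Submodule.mem_sup_right ?_) (Submodule.mem_sup_left ⟨B.mkQ y, rfl⟩)
    have : B.mkQ (m - gammaO N hk y) ∈ (Submodule.span ℂ (Set.range w)).map B.mkQ := ⟨_, hy, rfl⟩
    rwa [Submodule.map_span, ← Set.range_comp] at this
  · rintro _ ⟨m, hm, rfl⟩
    exact ⟨gammaO N hk m, hP m hm, rfl⟩
  · rintro (i | j)
    · exact ⟨x i, hx i, rfl⟩
    · exact ⟨_, P.smul_mem _ hv, rfl⟩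
  · rintro a ⟨_, ⟨y, hy, rfl⟩, hay⟩
    rw [hT] at hay
    have hmem : ∑ i, a i • z i - gammaO N hk y ∈ B := by
      rw [← Submodule.Quotient.mk_eq_zero, ← Submodule.mkQ_apply, map_sub, hay, map_sum]
      simp only [map_smul, sub_self]
    obtain ⟨m, hm⟩ := (hB _).1 hmem
    rw [Fintype.sum_sum_type] at hm
    simp only [z, Sum.elim_inl, Sum.elim_inr] at hm
    have hsm : ∀ (b : ℂ) (p : ℂ⟦X⟧), b • p • v = (b • p) • v := fun b p => (smul_assoc _ _ _).symm
    -- Modulo ε the multiples of v and the truncation error vanish, so the hypothesis on the given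
    -- vectors applies.
    have h1 : (fun i => a (Sum.inl i)) = 0 := by
      refine hind _ y hy ((PowerSeries.X ^ (c + N) : ℂ⟦X⟧) • m -
        (∑ j : Fin N, a (Sum.inr j) • (PowerSeries.X ^ (j : ℕ) : ℂ⟦X⟧)) • v)
        (sub_mem ?_ (P.smul_mem _ hv)) ?_
      · rw [add_comm c N, pow_add, mul_smul]
        exact P.smul_mem _ (hc m)
      · rw [smul_sub, smul_smul, smul_smul, ← pow_succ', Finset.mul_sum]
        simp only [hsm, ← Finset.sum_smul] at hm
        simp only [mul_smul_comm, ← pow_succ']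
        rw [← hm]
        abel
    -- Compare first coordinates. The right side is divisible by ε^(N+1) and the first coordinate of
    -- v is a unit, so the polynomial Σ a_j ε^(j+1), of degree at most N, vanishes.
    have h2 : ∀ j, a (Sum.inr j) = 0 := by
      have h3 : ∀ i, a (Sum.inl i) = 0 := congrFun h1
      simp only [h3, zero_smul, Finset.sum_const_zero, zero_add, hsm, ← Finset.sum_smul] at hm
      have h4 := congrFun hm ⟨0, bigK_pos hk⟩
      rw [Pi.sub_apply, gammaO_apply_zero, Pi.smul_apply, Pi.smul_apply, smul_eq_mul,
        smul_eq_mul, sub_eq_iff_eq_add] at h4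
      have h5 : (PowerSeries.X ^ (N + 1) : ℂ⟦X⟧) ∣
          (∑ j : Fin N, a (Sum.inr j) • (PowerSeries.X : ℂ⟦X⟧) ^ ((j : ℕ) + 1)) *
            v ⟨0, bigK_pos hk⟩ := by
        rw [h4]
        refine dvd_add (Dvd.dvd.mul_right (pow_dvd_pow _ (by omega)) _) (dvd_mul_right _ _)
      have hunit : IsUnit (v ⟨0, bigK_pos hk⟩) :=
        PowerSeries.isUnit_iff_constantCoeff.2 (isUnit_iff_ne_zero.2 hv0)
      rw [hunit.dvd_mul_right, PowerSeries.X_pow_dvd_iff] at h5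
      intro j
      have h6 := h5 (j + 1) (by omega)
      rw [map_sum, Finset.sum_eq_single j] at h6
      · simpa using h6
      · intro i _ hi
        rw [PowerSeries.coeff_smul, PowerSeries.coeff_X_pow, if_neg (by
          intro h
          exact hi (Fin.ext (by omega))), smul_zero]
      · intro h
        exact absurd (Finset.mem_univ _) h
    funext i
    rcases i with i | j
    · exact congrFun h1 i
    · exact h2 j

/-! ### Integral vectors and commensurability of lattices -/

/-- The inclusion of `𝕆^K` in `𝕂^K`. -/
def ofIntegral (K : ℕ) : (Fin K → ℂ⟦X⟧) →ₗ[ℂ⟦X⟧] LVec K :=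
  LinearMap.compLeft (Algebra.linearMap ℂ⟦X⟧ ℂ⸨X⸩) (Fin K)

section

variable {K : ℕ}

lemma ofIntegral_apply (y : Fin K → ℂ⟦X⟧) (r : Fin K) :
    ofIntegral K y r = algebraMap ℂ⟦X⟧ ℂ⸨X⸩ (y r) := rfl

lemma algebraMap_X_pow (m : ℕ) :
    algebraMap ℂ⟦X⟧ ℂ⸨X⸩ (PowerSeries.X ^ m) = HahnSeries.single (m : ℤ) 1 := by
  rw [map_pow, LaurentSeries.coe_algebraMap, HahnSeries.ofPowerSeries_X, HahnSeries.single_pow,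
    one_pow, nsmul_one]

lemma stdLattice_eq (i : ℤ) : stdLattice K i = periodicLattice (e K) i := rfl

lemma e_add_mul (j m : ℤ) (r : Fin K) : e K (j + m * K) r = HahnSeries.single m 1 * e K j r := by
  have hK : (K : ℤ) ≠ 0 := by
    have := r.pos
    omega
  rw [e_apply, e_apply, show j + m * K - 1 = j - 1 + m * K by ring, Int.add_mul_emod_self_right,
    Int.add_mul_ediv_right _ _ hK, mul_ite, mul_zero, single_mul_single_one, add_comm m]

lemma mem_stdLattice_mul {m : ℤ} {x : LVec K} : x ∈ stdLattice K (m * K) ↔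
    ∃ c : Fin K → ℂ⟦X⟧, ∀ r, x r = HahnSeries.single m 1 * algebraMap ℂ⟦X⟧ ℂ⸨X⸩ (c r) := by
  have hset : e K '' Set.Ioc (m * K) (m * K + K) =
      Set.range (fun r : Fin K => e K (((r : ℕ) : ℤ) + 1 + m * K)) := by
    ext x
    constructor
    · rintro ⟨j, hj, rfl⟩
      have h1 := hj.1
      have h2 := hj.2
      refine ⟨⟨(j - m * K).toNat - 1, by omega⟩, congrArg (e K) ?_⟩
      change (((j - m * K).toNat - 1 : ℕ) : ℤ) + 1 + m * K = j
      omega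
    · rintro ⟨r, rfl⟩
      exact ⟨_, ⟨by omega, by omega⟩, rfl⟩
  rw [stdLattice, hset, Submodule.mem_span_range_iff_exists_fun]
  refine exists_congr fun c => ?_
  rw [funext_iff]
  refine forall_congr' fun r => ?_
  rw [Finset.sum_apply, Finset.sum_eq_single r]
  · rw [Pi.smul_apply, e_add_mul, e_succ, Pi.single_eq_same, mul_one, Algebra.smul_def, mul_comm,
      eq_comm]
  · intro s _ hs
    rw [Pi.smul_apply, e_add_mul, e_succ, Pi.single_eq_of_ne hs.symm, mul_zero]
    exact smul_zero (c s)
  · intro h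
    exact absurd (Finset.mem_univ _) h

lemma mem_stdLattice_zero {x : LVec K} : x ∈ stdLattice K 0 ↔ ∃ c, ofIntegral K c = x := by
  have := mem_stdLattice_mul (K := K) (m := 0) (x := x)
  rw [zero_mul] at this
  rw [this]
  refine exists_congr fun c => ?_
  rw [funext_iff]
  refine forall_congr' fun r => ?_
  rw [ofIntegral_apply, HahnSeries.single_zero_one, one_mul, eq_comm]

lemma mem_stdLattice_iff_coeff {m : ℤ} {x : LVec K} : x ∈ stdLattice K (m * K) ↔
    ∀ r, ∀ j < m, (x r).coeff j = 0 := by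
  rw [mem_stdLattice_mul]
  constructor
  · rintro ⟨c, hc⟩ r j hj
    rw [hc, HahnSeries.coeff_single_mul, one_mul, LaurentSeries.coe_algebraMap,
      PowerSeries.coeff_coe, if_pos (by omega)]
  · intro h
    refine ⟨fun r => PowerSeries.mk fun n => (x r).coeff (m + n), fun r => ?_⟩
    ext j
    rw [HahnSeries.coeff_single_mul, one_mul, LaurentSeries.coe_algebraMap, PowerSeries.coeff_coe]
    split_ifs with hj
    · exact h r j (by omega)
    · rw [PowerSeries.coeff_mk]
      congr 1
      omega

/-- Any lattice contains a multiple of any other one. -/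
lemma exists_X_pow_smul_mem {v w : ℤ → LVec K} (hv : IsPeriodicBasis v) :
    ∃ c : ℕ, ∀ x ∈ periodicLattice w 0, (PowerSeries.X ^ c : ℂ⟦X⟧) • x ∈ periodicLattice v 0 := by
  have hspan : ∀ x : LVec K, ∃ a : Fin K → ℂ⸨X⸩, ∑ r, a r • v ((r : ℕ) + 1) = x := by
    intro x
    have h : Submodule.span ℂ⸨X⸩ (Set.range fun r : Fin K => v ((r : ℕ) + 1)) = ⊤ :=
      hv.linearIndependent.span_eq_top_of_card_eq_finrank' (by simp)
    exact (Submodule.mem_span_range_iff_exists_fun _).1 (h ▸ Submodule.mem_top : x ∈ _)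
  choose a ha using fun s : Fin K => hspan (w ((s : ℕ) + 1))
  -- Clear the denominators of all K² transition coefficients by one power of ε.
  obtain ⟨⟨_, c, rfl⟩, hc⟩ := IsLocalization.exist_integer_multiples
    (Submonoid.powers (PowerSeries.X : ℂ⟦X⟧)) Finset.univ
    (fun p : Fin K × Fin K => a p.1 p.2)
  refine ⟨c, fun x hx => ?_⟩
  obtain ⟨p, rfl⟩ := mem_periodicLattice_zero.1 hx
  refine Submodule.sum_mem (p := (periodicLattice v 0).comap
    (LinearMap.lsmul ℂ⟦X⟧ (LVec K) (PowerSeries.X ^ c : ℂ⟦X⟧))) fun s _ => ?_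
  refine ((periodicLattice v 0).comap
    (LinearMap.lsmul ℂ⟦X⟧ (LVec K) (PowerSeries.X ^ c : ℂ⟦X⟧))).smul_mem (p s) ?_
  change (PowerSeries.X ^ c : ℂ⟦X⟧) • w _ ∈ periodicLattice v 0
  choose b hb using fun r => hc (s, r) (Finset.mem_univ _)
  rw [mem_periodicLattice_zero]
  refine ⟨b, ?_⟩
  rw [← ha]
  refine Eq.trans ?_ (map_sum (LinearMap.lsmul ℂ⟦X⟧ (LVec K) (PowerSeries.X ^ c : ℂ⟦X⟧))
    (fun r => a s r • v ((r : ℕ) + 1)) Finset.univ).symm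
  refine Finset.sum_congr rfl fun r _ => ?_
  have h1 := hb r
  ext1 q
  change b r • v ((r : ℕ) + 1) q = (PowerSeries.X ^ c : ℂ⟦X⟧) • (a s r * v ((r : ℕ) + 1) q)
  rw [Algebra.smul_def, h1]
  exact smul_mul_assoc (PowerSeries.X ^ c : ℂ⟦X⟧) (a s r) _

end

lemma gamma_ofIntegral {n k N : ℕ} (hk : 1 ≤ k) (y : Fin (bigK n k) → ℂ⟦X⟧) :
    gamma n k N (ofIntegral _ y) = ofIntegral _ (gammaO N hk y) := by
  ext1 r
  rw [gamma_apply hk, ofIntegral_apply, ofIntegral_apply, gammaO_apply, map_mul, algebraMap_X_pow]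

lemma gamma_pow_ofIntegral {n k N : ℕ} (hk : 1 ≤ k) (y : Fin (bigK n k) → ℂ⟦X⟧) (m : ℕ) :
    (gammaC n k N ^ m) (ofIntegral _ y) = ofIntegral _ ((gammaO N hk ^ m) y) := by
  induction m with
  | zero => rfl
  | succ m ih =>
    rw [pow_succ', pow_succ', Module.End.mul_apply, Module.End.mul_apply, ih]
    exact gamma_ofIntegral hk _

/-! ### Positive lattices and the number of Jordan blocks -/

section

variable {K : ℕ}

lemma exists_of_mem_positivePartialCells {n : ℕ} {L : AffineFlag K (flagIndex K n)}
    (hL : L ∈ positivePartialCells K n) :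
    ∃ g ∈ iwahoriMinus K, ∃ ω : Equiv.Perm ℤ, IsAffinePerm K ω ∧ IsPositive K ω ∧
      IsNormalized K ω ∧
      ∀ i, L.1 i = periodicLattice (fun j => mulVecLin g (e K (ω j))) (i : ℕ) := by
  obtain ⟨F, ⟨ω, hω, hpos, hnorm, g, hg, hF⟩, rfl⟩ := hL
  refine ⟨g, hg, ω, hω, hpos, hnorm, fun i => ?_⟩
  exact (hF ⟨i, _⟩).trans (translate_periodicLattice g (fun j => e K (ω j)) _)

/-- The matrix has columns v_1, …, v_K. It matches the periodic families at positive indices, which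
is all that the lattices with i ≥ 0 use. -/
lemma exists_translate (hK : 0 < K) {v : ℤ → LVec K} (hv : IsPeriodicBasis v) :
    ∃ g : GL (Fin K) ℂ⸨X⸩, ∀ i : ℕ, periodicLattice v i = translate g (stdLattice K i) := by
  obtain ⟨g, hg⟩ := hv.exists_eq_mulVecLin hK
  refine ⟨g, fun i => ?_⟩
  rw [stdLattice_eq, translate_periodicLattice]
  exact periodicLattice_congr hg (by positivity)

lemma mem_positivePartialCells (hK : 0 < K) {n : ℕ} {g : GL (Fin K) ℂ⸨X⸩}
    (hg : g ∈ iwahoriMinus K) {ω : Equiv.Perm ℤ} (hω : IsAffinePerm K ω) (hpos : IsPositive K ω)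
    (hnorm : IsNormalized K ω) {L : AffineFlag K (flagIndex K n)}
    (hL : ∀ i, L.1 i = periodicLattice (fun j => mulVecLin g (e K (ω j))) (i : ℕ)) :
    L ∈ positivePartialCells K n := by
  obtain ⟨g', hg'⟩ := exists_translate hK ((isPeriodicBasis_e_comp hω).map g)
  refine ⟨⟨fun i => periodicLattice (fun j => mulVecLin g (e K (ω j))) (i : ℕ),
    g', fun i => hg' i⟩, ⟨ω, hω, hpos, hnorm, g, hg, fun i => ?_⟩, Subtype.ext ?_⟩
  · exact (translate_periodicLattice g (fun j => e K (ω j)) _).symm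
  · funext i
    exact (hL i).symm

lemma e_mem_ofIntegral {j : ℤ} (hj : 0 < j) : ∃ y, e K j = ofIntegral K y := by
  refine ⟨fun r => if (r : ℤ) = (j - 1) % (K : ℤ) then PowerSeries.X ^ ((j - 1) / (K : ℤ)).toNat
    else 0, funext fun r => ?_⟩
  have hK : 0 < (K : ℤ) := by
    have := r.pos
    omega
  rw [e_apply, ofIntegral_apply]
  split_ifs with h
  · rw [algebraMap_X_pow, Int.toNat_of_nonneg (Int.ediv_nonneg (by omega) hK.le)]
  · rw [map_zero]

lemma mulVecLin_map_ofIntegral (h : GL (Fin K) ℂ⟦X⟧) (y : Fin K → ℂ⟦X⟧) :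
    mulVecLin (Matrix.GeneralLinearGroup.map (algebraMap ℂ⟦X⟧ ℂ⸨X⸩) h) (ofIntegral K y) =
      ofIntegral K (h.1.mulVec y) := by
  funext r
  rw [ofIntegral_apply, RingHom.map_mulVec]
  rfl

lemma exists_mulVecLin_e_eq_ofIntegral {g : GL (Fin K) ℂ⸨X⸩} (hg : g ∈ iwahoriMinus K) {j : ℤ}
    (hj : 0 < j) : ∃ y, mulVecLin g (e K j) = ofIntegral K y := by
  obtain ⟨h, -, rfl⟩ := hg
  obtain ⟨y, hy⟩ := e_mem_ofIntegral (K := K) hj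
  rw [hy]
  exact ⟨_, mulVecLin_map_ofIntegral h y⟩

/-- Modulo ε the matrix is lower triangular and invertible, so its upper left entry, the first
coordinate of the image of e_1, is nonzero. -/
lemma exists_mulVecLin_e_one (hK : 0 < K) {g : GL (Fin K) ℂ⸨X⸩} (hg : g ∈ iwahoriMinus K) :
    ∃ y, mulVecLin g (e K 1) = ofIntegral K y ∧
      PowerSeries.constantCoeff (y ⟨0, hK⟩) ≠ 0 := by
  obtain ⟨h, hh, rfl⟩ := hg
  have he : e K 1 = ofIntegral K (Pi.single ⟨0, hK⟩ 1) := by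
    have h1 := e_succ (⟨0, hK⟩ : Fin K)
    simp only [Nat.cast_zero, zero_add] at h1
    rw [h1]
    funext r
    rw [ofIntegral_apply, Pi.single_apply, Pi.single_apply]
    split_ifs
    · rw [map_one]
    · rw [map_zero]
  refine ⟨_, by rw [he, mulVecLin_map_ofIntegral], ?_⟩
  rw [Matrix.mulVec_single_one]
  have hdet : (h.1.map PowerSeries.constantCoeff).det ≠ 0 := by
    have := (Matrix.GeneralLinearGroup.map (n := Fin K)
      (PowerSeries.constantCoeff (R := ℂ)) h).isUnit.map Matrix.detMonoidHom
    exact this.ne_zero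
  rw [Matrix.det_of_isLowerTriangular (h.1.map PowerSeries.constantCoeff) (fun i j hij => hh i j hij)] at hdet
  exact Finset.prod_ne_zero_iff.1 hdet ⟨0, hK⟩ (Finset.mem_univ _)

/-- The lattices `Λ` over which there are flags in `C'`. -/
structure IsPositiveLattice (P : Submodule ℂ⟦X⟧ (LVec K)) (g : GL (Fin K) ℂ⸨X⸩)
    (ω : Equiv.Perm ℤ) : Prop where
  mem_iwahori : g ∈ iwahoriMinus K
  isAffinePerm : IsAffinePerm K ω
  isPositive : IsPositive K ω
  isNormalized : IsNormalized K ω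
  eq : P = periodicLattice (fun j => mulVecLin g (e K (ω j))) 0

namespace IsPositiveLattice

variable {P : Submodule ℂ⟦X⟧ (LVec K)} {g : GL (Fin K) ℂ⸨X⸩} {ω : Equiv.Perm ℤ}

lemma isPeriodicBasis (h : IsPositiveLattice P g ω) :
    IsPeriodicBasis (fun j => mulVecLin g (e K (ω j))) :=
  (isPeriodicBasis_e_comp h.isAffinePerm).map g

lemma le_stdLattice (h : IsPositiveLattice P g ω) : P ≤ stdLattice K 0 := by
  rw [h.eq, periodicLattice, Submodule.span_le]
  rintro _ ⟨j, hj, rfl⟩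
  obtain ⟨y, hy⟩ := exists_mulVecLin_e_eq_ofIntegral h.mem_iwahori
    (h.isPositive j (by have := hj.1; omega) (by have := hj.2; omega))
  exact mem_stdLattice_zero.2 ⟨y, hy.symm⟩

/-- Normalization places 1 among the window values of ω, so g e_1 is one of the generators of Λ. -/
lemma exists_mem (h : IsPositiveLattice P g ω) (hK : 0 < K) : ∃ y, ofIntegral K y ∈ P ∧
    PowerSeries.constantCoeff (y ⟨0, hK⟩) ≠ 0 := by
  obtain ⟨y, hy, hy0⟩ := exists_mulVecLin_e_one hK h.mem_iwahori
  refine ⟨y, ?_, hy0⟩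
  rw [← hy, h.eq]
  have := mem_periodicLattice_of_mem (fun j => mulVecLin g (e K (ω j))) (i := 0) (j := ω.symm 1)
    ⟨by have := h.isNormalized.1; omega, by have := h.isNormalized.2; omega⟩
  simpa using this

lemma exists_X_pow_smul_mem (h : IsPositiveLattice P g ω) :
    ∃ c : ℕ, ∀ x ∈ stdLattice K 0, (PowerSeries.X ^ c : ℂ⟦X⟧) • x ∈ P := by
  obtain ⟨c, hc⟩ := AffineDelta.exists_X_pow_smul_mem (w := e K) h.isPeriodicBasis
  exact ⟨c, fun x hx => h.eq ▸ hc x hx⟩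

lemma finrank (h : IsPositiveLattice P g ω) :
    Module.finrank ℂ ((asC P).map (asC (epsMul P)).mkQ) = K := by
  rw [h.eq]
  exact finrank_map_mkQ_periodicLattice h.isPeriodicBasis (Nat.zero_le K)

lemma finiteDimensional (h : IsPositiveLattice P g ω) :
    FiniteDimensional ℂ ((asC P).map (asC (epsMul P)).mkQ) := by
  rw [h.eq]
  exact finiteDimensional_map_mkQ_periodicLattice h.isPeriodicBasis

end IsPositiveLattice

end

/-- The tops of the Jordan chains are linearly independent modulo the image. -/
lemma exists_lift_of_hasJordanType {E : Type*} [AddCommGroup E] [Module ℂ E] {T : Module.End ℂ E}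
    {P P' : Submodule ℂ E} {hP : P ≤ P.comap T} {hP' : P' ≤ P'.comap T} {lam : ℕ → ℕ}
    (hT : HasJordanType (inducedEnd T P P' hP hP') lam) {m : ℕ} (hm : ∀ i < m, 0 < lam i) :
    ∃ x : Fin m → E, (∀ i, x i ∈ P) ∧
      ∀ (a : Fin m → ℂ), ∀ y ∈ P, ∑ i, a i • x i - T y ∈ P' → a = 0 := by
  obtain ⟨-, b, h0, h1⟩ := hT
  have hpos : ∀ i : Fin m, lam i - 1 < lam i := fun i => Nat.sub_lt (hm i i.2) one_pos
  choose x hx using fun i : Fin m =>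
    Submodule.Quotient.mk_surjective _ (b ⟨i, ⟨lam i - 1, hpos i⟩⟩)
  refine ⟨fun i => x i, fun i => (x i).2, fun a y hy heq => ?_⟩
  -- The image of the operator is spanned by chain vectors below the top, so the coordinate
  -- functionals of the tops vanish on it.
  have h3 : ∑ i, a i • b ⟨i, ⟨lam i - 1, hpos i⟩⟩ ∈ LinearMap.range
      (inducedEnd T P P' hP hP' ^ 1) := by
    refine ⟨Submodule.Quotient.mk ⟨_, hy⟩, ?_⟩
    rw [pow_one, inducedEnd_mk, eq_comm]
    simp_rw [← hx, ← Submodule.mkQ_apply, ← map_smul, ← map_sum]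
    rw [← sub_eq_zero, ← map_sub, Submodule.mkQ_apply, Submodule.Quotient.mk_eq_zero]
    change ((∑ i, a i • x i - ⟨T y, hP hy⟩ : P) : E) ∈ P'
    simpa using heq
  rw [jordan_range_pow b h0 h1] at h3
  funext i
  have h5 : ∀ w ∈ Submodule.span ℂ {x | ∃ i j, ∃ h : j < lam i, j + 1 < lam i ∧
      b ⟨i, ⟨j, h⟩⟩ = x}, b.coord ⟨i, ⟨lam i - 1, hpos i⟩⟩ w = 0 := by
    intro w hw
    refine (Submodule.span_le (p := LinearMap.ker (b.coord ⟨i, ⟨lam i - 1, hpos i⟩⟩))).2 ?_ hw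
    rintro _ ⟨i', j', hj, hj', rfl⟩
    rw [SetLike.mem_coe, LinearMap.mem_ker, Module.Basis.coord_apply, b.repr_self,
      Finsupp.single_apply_eq_zero]
    intro heq
    rw [Sigma.mk.injEq] at heq
    obtain ⟨rfl, heq⟩ := heq
    have := congrArg Fin.val (eq_of_heq heq)
    simp only at this
    omega
  have h6 := h5 _ h3
  rw [map_sum, Finset.sum_eq_single i] at h6
  · simpa using h6
  · intro i' _ hi'
    rw [map_smul, Module.Basis.coord_apply, b.repr_self, Finsupp.single_eq_of_ne, smul_zero]
    intro heq
    exact hi' (Fin.ext (congrArg Sigma.fst heq).symm)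
  · intro h
    exact absurd (Finset.mem_univ _) h

lemma finrank_quotient_submoduleOf {E : Type*} [AddCommGroup E] [Module ℂ E]
    {P P' : Submodule ℂ E} (hP' : P' ≤ P) [FiniteDimensional ℂ (P.map P'.mkQ)] :
    Module.finrank ℂ (P ⧸ P'.submoduleOf P) = Module.finrank ℂ (P.map P'.mkQ) := by
  have h1 := finrank_subquotient (le_refl P') hP'
  rw [Submodule.mkQ_map_self, finrank_bot, add_zero] at h1
  exact h1

lemma gammaC_X_smul {n k N : ℕ} (x : LVec (bigK n k)) :
    gammaC n k N ((PowerSeries.X : ℂ⟦X⟧) • x) = (PowerSeries.X : ℂ⟦X⟧) • gammaC n k N x :=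
  (gamma n k N).map_smul_of_tower _ _

lemma epsMul_le_comap {n k N : ℕ} {P : Submodule ℂ⟦X⟧ (LVec (bigK n k))}
    (hP : asC P ≤ (asC P).comap (gammaC n k N)) :
    asC (epsMul P) ≤ (asC (epsMul P)).comap (gammaC n k N) := by
  intro x hx
  obtain ⟨y, hy, rfl⟩ := mem_epsMul.1 hx
  exact mem_epsMul.2 ⟨_, hP hy, (gammaC_X_smul y).symm⟩

namespace IsPositiveLattice

variable {n k N : ℕ} {P : Submodule ℂ⟦X⟧ (LVec (bigK n k))} {g : GL (Fin (bigK n k)) ℂ⸨X⸩}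
  {ω : Equiv.Perm ℤ}

/-- If ε^c 𝕆^K ⊆ Λ ⊆ 𝕆^K, then γ^((n-k+1)(c+1)) maps Λ into ε^(c+1) 𝕆^K ⊆ εΛ. -/
lemma isNilpotent_inducedEnd (h : IsPositiveLattice P g ω) (hk : 1 ≤ k)
    (hP : asC P ≤ (asC P).comap (gammaC n k N))
    (hP' : asC (epsMul P) ≤ (asC (epsMul P)).comap (gammaC n k N)) :
    IsNilpotent (inducedEnd (gammaC n k N) (asC P) (asC (epsMul P)) hP hP') := by
  obtain ⟨c, hc⟩ := h.exists_X_pow_smul_mem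
  refine ⟨(n - k + 1) * (c + 1), LinearMap.ext fun q => ?_⟩
  obtain ⟨⟨x, hx⟩, rfl⟩ := Submodule.Quotient.mk_surjective _ q
  rw [inducedEnd_pow_mk, LinearMap.zero_apply, Submodule.Quotient.mk_eq_zero]
  change (gammaC n k N ^ ((n - k + 1) * (c + 1))) x ∈ epsMul P
  obtain ⟨y, rfl⟩ := mem_stdLattice_zero.1 (h.le_stdLattice hx)
  obtain ⟨z, hz⟩ := exists_gammaO_pow_mul_eq (N := N) hk y (c + 1)
  rw [gamma_pow_ofIntegral hk, hz, pow_succ', mul_smul, map_smul, map_smul]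
  exact X_smul_mem_epsMul (hc _ (mem_stdLattice_zero.2 ⟨z, rfl⟩))

/-- With k + 1 blocks, the tops of the chains would lift to k + 1 vectors of Λ independent modulo γΛ
+ εΛ, against the cokernel bound. -/
lemma hasJordanType_eq_zero (h : IsPositiveLattice P g ω) (hk : 1 ≤ k)
    {hP : asC P ≤ (asC P).comap (gammaC n k N)}
    {hP' : asC (epsMul P) ≤ (asC (epsMul P)).comap (gammaC n k N)} {lam : ℕ → ℕ}
    (hT : HasJordanType (inducedEnd (gammaC n k N) (asC P) (asC (epsMul P)) hP hP') lam) :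
    lam k = 0 := by
  by_contra hlam
  obtain ⟨x, hxP, hx⟩ := exists_lift_of_hasJordanType hT (m := k + 1) fun i hi =>
    (Nat.pos_of_ne_zero hlam).trans_le (hT.1 (Nat.lt_succ_iff.1 hi))
  choose X hX using fun i => mem_stdLattice_zero.1 (h.le_stdLattice (hxP i))
  obtain ⟨v, hv, hv0⟩ := h.exists_mem (bigK_pos hk)
  obtain ⟨c, hc⟩ := h.exists_X_pow_smul_mem
  refine not_forall_eq_zero_of_gammaO (N := N) hk (P.comap (ofIntegral _)) ?_ hv hv0 c ?_ X ?_ ?_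
  · intro y hy
    rw [Submodule.mem_comap, ← gamma_ofIntegral hk]
    exact hP hy
  · intro m
    rw [Submodule.mem_comap, map_smul]
    exact hc _ (mem_stdLattice_zero.2 ⟨m, rfl⟩)
  · intro i
    rw [Submodule.mem_comap, hX]
    exact hxP i
  intro a y hy z hz heq
  refine hx a _ hy (mem_epsMul.2 ⟨ofIntegral _ z, hz, ?_⟩)
  have h2 := congrArg (ofIntegral _) heq
  rw [map_add, map_smul, ← gamma_ofIntegral hk, map_sum] at h2
  rw [eq_sub_iff_add_eq, add_comm]
  refine h2.symm.trans (Finset.sum_congr rfl fun i _ => ?_)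
  rw [← hX, LinearMap.map_smul_of_tower]

end IsPositiveLattice

/-! ### The partition μ and its numerical constraints -/

lemma exists_youngDiagram {f : ℕ → ℕ} (hf : Antitone f) {k : ℕ} (hk : f k = 0) :
    ∃ μ : YoungDiagram, μ.colLen 0 ≤ k ∧ (∀ i, μ.rowLen i = f i) ∧
      μ.card = ∑ i ∈ Finset.range k, f i := by
  have hlt : ∀ {i j : ℕ}, j < f i → i < k := by
    intro i j h
    by_contra hi
    have := hf (not_lt.1 hi)
    omega
  let μ : YoungDiagram :=
    { cells := (Finset.range k ×ˢ Finset.range (f 0)).filter fun x => x.2 < f x.1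
      isLowerSet := by
        intro x y hle hx
        have h1 : y.1 ≤ x.1 := hle.1
        have h2 : y.2 ≤ x.2 := hle.2
        have h3 := hf h1
        have h4 := hf (Nat.zero_le y.1)
        simp only [Finset.coe_filter, Finset.mem_product, Finset.mem_range,
          Set.mem_ofPred_eq] at hx ⊢
        omega }
  have hmem : ∀ i j, (i, j) ∈ μ ↔ j < f i := by
    intro i j
    rw [← YoungDiagram.mem_cells, Finset.mem_filter, Finset.mem_product, Finset.mem_range,
      Finset.mem_range]
    have h4 := hf (Nat.zero_le i)
    exact ⟨fun h => h.2, fun h => ⟨⟨hlt h, h.trans_le h4⟩, h⟩⟩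
  have hrow : ∀ i, μ.rowLen i = f i := by
    refine fun i => eq_of_forall_lt_iff fun j => ?_
    rw [← YoungDiagram.mem_iff_lt_rowLen, hmem]
  refine ⟨μ, ?_, hrow, ?_⟩
  · by_contra h
    have := (hmem k 0).1 (YoungDiagram.mem_iff_lt_colLen.2 (not_le.1 h))
    omega
  · rw [YoungDiagram.card, Finset.card_eq_sum_card_fiberwise (f := Prod.fst) (t := Finset.range k)]
    · refine Finset.sum_congr rfl fun i _ => ?_
      rw [← hrow, YoungDiagram.rowLen_eq_card]
      rfl
    · rintro ⟨i, j⟩ hx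
      exact Finset.mem_range.2 (hlt ((hmem i j).1 hx))

section

variable {n k : ℕ} {lam : ℕ → ℕ}

/-- This is |μ| ≥ k, equivalently u = n - |μ| ≤ n - k = r. Cutting each of the k parts at n - k
leaves at least the surplus k. -/
lemma le_sum_tsub (hsum : ∑ i ∈ Finset.range k, lam i = (n - k) * k + k) :
    k ≤ ∑ i ∈ Finset.range k, (lam i - (n - k)) := by
  have h : ∑ i ∈ Finset.range k, lam i ≤ ∑ i ∈ Finset.range k, (lam i - (n - k) + (n - k)) :=
    Finset.sum_le_sum fun i _ => by omega
  rw [Finset.sum_add_distrib, Finset.sum_const, Finset.card_range, smul_eq_mul, hsum,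
    mul_comm] at h
  omega

/-- This is u ≤ λ_i: the other k - 1 parts total at most (k-1)(n-k) + |μ|, while K = (k-1)(n-k) + n.
-/
lemma le_add_sum_tsub (hkn : k ≤ n) (hsum : ∑ i ∈ Finset.range k, lam i = (n - k) * k + k)
    {i : ℕ} (hi : i < k) : n ≤ lam i + ∑ i ∈ Finset.range k, (lam i - (n - k)) := by
  have hmem := Finset.mem_range.2 hi
  have h : ∑ j ∈ (Finset.range k).erase i, lam j ≤
      ∑ j ∈ (Finset.range k).erase i, (lam j - (n - k) + (n - k)) :=
    Finset.sum_le_sum fun i _ => by omega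
  rw [Finset.sum_add_distrib, Finset.sum_const, Finset.card_erase_of_mem hmem, Finset.card_range,
    smul_eq_mul] at h
  have h1 := Finset.add_sum_erase _ lam hmem
  have h2 := Finset.add_sum_erase _ (fun i => lam i - (n - k)) hmem
  obtain ⟨j, rfl⟩ : ∃ j, k = j + 1 := ⟨k - 1, by omega⟩
  rw [Nat.add_sub_cancel] at h
  have h3 : (n - (j + 1)) * (j + 1) = j * (n - (j + 1)) + (n - (j + 1)) := by ring
  omega

lemma nuSize_le {μ : YoungDiagram} (hk : 1 ≤ k) (hkn : k ≤ n) (hμ : k ≤ μ.card)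
    (hμ' : μ.card ≤ n) : nuSize n k μ ≤ bigK n k := by
  obtain ⟨j, rfl⟩ : ∃ j, k = j + 1 := ⟨k - 1, by omega⟩
  rw [nuSize, bigK_eq]
  have h : j * (n - μ.card) ≤ j * (n - (j + 1)) := Nat.mul_le_mul_left _ (by omega)
  have h3 : (n - (j + 1)) * (j + 1) = j * (n - (j + 1)) + (n - (j + 1)) := by ring
  have h4 : (j + 1) * (n - μ.card) = j * (n - μ.card) + (n - μ.card) := by ring
  omega

/-- In this form the top quotient of a Δ-Springer flag visibly has the size (k-1)(n-|μ|) of its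
bounding rectangle. -/
lemma nuSize_eq {μ : YoungDiagram} (hk : 1 ≤ k) (hμ : μ.card ≤ n) :
    nuSize n k μ = (k - 1) * (n - μ.card) + n := by
  obtain ⟨j, rfl⟩ : ∃ j, k = j + 1 := ⟨k - 1, by omega⟩
  rw [nuSize, Nat.add_sub_cancel]
  have h4 : (j + 1) * (n - μ.card) = j * (n - μ.card) + (n - μ.card) := by ring
  omega

lemma bigK_eq_add (hk : 1 ≤ k) (hkn : k ≤ n) : bigK n k = (k - 1) * (n - k) + n := by
  obtain ⟨j, rfl⟩ : ∃ j, k = j + 1 := ⟨k - 1, by omega⟩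
  rw [bigK_eq, Nat.add_sub_cancel]
  have h3 : (n - (j + 1)) * (j + 1) = j * (n - (j + 1)) + (n - (j + 1)) := by ring
  omega

end

/-- The sum is the rank of T^r on P/P', whose image sits in the n-dimensional second member. -/
lemma IsSubquotientFlag.sum_le {E : Type*} [AddCommGroup E] [Module ℂ E] {T : Module.End ℂ E}
    {P P' : Submodule ℂ E} {hP : P ≤ P.comap T} {hP' : P' ≤ P'.comap T} {K n r k : ℕ}
    {L : flagIndex K n → Submodule ℂ E} (hL : IsSubquotientFlag T P P' K n r L) (hn : n ≤ K)
    [FiniteDimensional ℂ (P.map P'.mkQ)] {lam : ℕ → ℕ}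
    (hT : HasJordanType (inducedEnd T P P' hP hP') lam) (hk : lam k = 0) :
    ∑ i ∈ Finset.range k, (lam i - r) ≤ n := by
  obtain ⟨hanti, b, h0, h1⟩ := hT
  rw [← finrank_range_jordan_pow b h0 h1 hanti hk]
  have hle : L (flagIndex.second K n) ≤ P := hL.first ▸ hL.antitone (Nat.zero_le (K - n))
  have hfin := finrank_map_submoduleOf (P' := P') hle
  rw [hL.finrank] at hfin
  have := finiteDimensional_subquotient (le_refl P') (W := P)
  refine (Submodule.finrank_mono
    (t := ((L (flagIndex.second K n)).submoduleOf P).map (P'.submoduleOf P).mkQ) ?_).trans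
    (hfin.le.trans ?_)
  · rintro _ ⟨q, rfl⟩
    obtain ⟨x, rfl⟩ := Submodule.Quotient.mk_surjective _ q
    rw [inducedEnd_pow_mk]
    exact ⟨_, hL.pow_mem x x.2, rfl⟩
  · change K - (K - n) ≤ n
    omega

lemma finrank_quotient_submoduleOf_add {V : Type*} [AddCommGroup V] [Module ℂ V]
    [FiniteDimensional ℂ V] {W W' : Submodule ℂ V} (h : W' ≤ W) :
    Module.finrank ℂ (W ⧸ W'.submoduleOf W) + Module.finrank ℂ W' = Module.finrank ℂ W := by
  rw [← (Submodule.submoduleOfEquivOfLe h).finrank_eq, Submodule.finrank_quotient_add_finrank]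

/-- Points of a Delta-Springer fiber in terms of `IsStableFlag`. -/
lemma isStableFlag_iff {n k : ℕ} {μ : YoungDiagram} (hk : 1 ≤ k) (hμ : μ.card ≤ n)
    {T : Module.End ℂ (Fin (nuSize n k μ) → ℂ)}
    {F : flagIndex (nuSize n k μ) n → Submodule ℂ (Fin (nuSize n k μ) → ℂ)} :
    (Antitone F ∧ (∀ i, Module.finrank ℂ (F i) = nuSize n k μ - (i : ℕ)) ∧
      ∃ h : ∀ i, F i ≤ (F i).comap T, JordanTypeLE
        (inducedEnd T (F (flagIndex.first _ n)) (F (flagIndex.second _ n)) (h _) (h _))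
        (rectangle (n - μ.card) (k - 1))) ↔
    IsStableFlag T (nuSize n k μ) n (n - μ.card) F := by
  have key : ∀ (_ : Antitone F) (_ : ∀ i, Module.finrank ℂ (F i) = nuSize n k μ - (i : ℕ))
      (h : ∀ i, F i ≤ (F i).comap T), JordanTypeLE
        (inducedEnd T (F (flagIndex.first _ n)) (F (flagIndex.second _ n)) (h _) (h _))
        (rectangle (n - μ.card) (k - 1)) ↔
      ∀ z, (T ^ (n - μ.card)) z ∈ F (flagIndex.second _ n) := by
    intro hanti hfin h
    rw [jordanTypeLE_inducedEnd_iff]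
    · have htop : F (flagIndex.first _ n) = ⊤ := by
        refine Submodule.eq_top_of_finrank_eq ?_
        rw [hfin, Module.finrank_fin_fun]
        rfl
      simp [htop]
    · have h1 := finrank_quotient_submoduleOf_add
        (hanti (show flagIndex.first (nuSize n k μ) n ≤ flagIndex.second _ n from Nat.zero_le _))
      rw [hfin, hfin] at h1
      change _ + (nuSize n k μ - (nuSize n k μ - n)) = nuSize n k μ - 0 at h1
      have h2 := nuSize_eq hk hμ
      omega
  constructor
  · rintro ⟨hanti, hfin, h, hJ⟩
    exact ⟨hanti, hfin, h, (key hanti hfin h).1 hJ⟩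
  · rintro ⟨hanti, hfin, h, hJ⟩
    exact ⟨hanti, hfin, h, (key hanti hfin h).2 hJ⟩

/-! ### The fiber as a space of flags between Λ and εΛ -/

namespace IsPositiveLattice

variable {n k N : ℕ} {P : Submodule ℂ⟦X⟧ (LVec (bigK n k))} {g : GL (Fin (bigK n k)) ℂ⸨X⸩}
  {ω : Equiv.Perm ℤ}

lemma jordanTypeLE_iff (h : IsPositiveLattice P g ω) (hk : 1 ≤ k) (hkn : k ≤ n)
    {W W' : Submodule ℂ (LVec (bigK n k))} (hW : W ≤ W.comap (gammaC n k N))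
    (hW' : W' ≤ W'.comap (gammaC n k N)) (hWP : W = asC P) (hle : W' ≤ W)
    (hP' : asC (epsMul P) ≤ W') (hfin : Module.finrank ℂ (W'.map (asC (epsMul P)).mkQ) = n) :
    JordanTypeLE (inducedEnd (gammaC n k N) W W' hW hW') (rectangle (n - k) (k - 1)) ↔
      ∀ x ∈ asC P, (gammaC n k N ^ (n - k)) x ∈ W' := by
  subst hWP
  have := h.finiteDimensional
  have := finiteDimensional_subquotient hP' (W := asC P)
  refine jordanTypeLE_inducedEnd_iff _ _ _ _ _ _ _ ?_
  have h1 := finrank_subquotient hP' hle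
  rw [hfin, h.finrank] at h1
  exact Nat.add_right_cancel (h1.trans (bigK_eq_add hk hkn))

lemma isSubquotientFlag (h : IsPositiveLattice P g ω) (hk : 1 ≤ k) (hkn : k ≤ n)
    {L : AffineFlag (bigK n k) (flagIndex (bigK n k) n)} (hL : L ∈ borhoMacPherson n k N)
    (hfirst : L.1 (flagIndex.first _ n) = P) :
    IsSubquotientFlag (gammaC n k N) (asC P) (asC (epsMul P)) (bigK n k) n (n - k)
      (fun i => asC (L.1 i)) := by
  obtain ⟨hst, hJ⟩ := hL
  obtain ⟨g', hg'⟩ := L.2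
  have hv : IsPeriodicBasis (fun j => mulVecLin g' (e (bigK n k) j)) := isPeriodicBasis_e.map g'
  have hL' : ∀ i, L.1 i = periodicLattice (fun j => mulVecLin g' (e (bigK n k) j)) (i : ℕ) :=
    fun i => (hg' i).trans (translate_periodicLattice g' _ _)
  have hP : P = periodicLattice (fun j => mulVecLin g' (e (bigK n k) j)) (0 : ℕ) :=
    hfirst.symm.trans (hL' _)
  have hi : ∀ i : flagIndex (bigK n k) n, (i : ℕ) ≤ bigK n k := fun i =>
    flagIndex_subset _ _ i.2
  have hanti : Antitone fun i => asC (L.1 i) := by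
    intro i j hij
    change L.1 j ≤ L.1 i
    rw [hL', hL']
    have h1 := hi j
    have h2 : (i : ℕ) ≤ (j : ℕ) := hij
    exact periodicLattice_antitone hv (by omega) (by omega)
  have hle : ∀ i, asC (epsMul P) ≤ asC (L.1 i) := by
    intro i
    change epsMul P ≤ L.1 i
    rw [hP, hL', epsMul_periodicLattice hv]
    have h1 := hi i
    exact periodicLattice_antitone hv (by omega) (by omega)
  have hfin : ∀ i, Module.finrank ℂ ((asC (L.1 i)).map (asC (epsMul P)).mkQ) =
      bigK n k - (i : ℕ) := by
    intro i
    rw [hL', hP]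
    exact finrank_map_mkQ_periodicLattice hv (hi i)
  refine ⟨hanti, congrArg asC hfirst, hle, hfin, hst, ?_⟩
  refine (h.jordanTypeLE_iff hk hkn _ _ (congrArg asC hfirst) (hanti (Nat.zero_le _)) (hle _)
    ?_).1 hJ
  rw [hfin]
  change bigK n k - (bigK n k - n) = n
  have := bigK_eq_add hk hkn
  omega

/-- Positivity and normalization depend only on the set of window values {ω(1), …, ω(K)}, which a
permutation of the window preserves. -/
lemma of_perm {K : ℕ} {P P₁ : Submodule ℂ⟦X⟧ (LVec K)} {g g₁ : GL (Fin K) ℂ⸨X⸩}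
    {ω ω₁ : Equiv.Perm ℤ} (h : IsPositiveLattice P g ω) (hg₁ : g₁ ∈ iwahoriMinus K)
    (hω₁ : IsAffinePerm K ω₁)
    (hσ : ∃ σ : Equiv.Perm (Fin K), ∀ r : Fin K, ω₁ ((r : ℕ) + 1) = ω ((σ r : ℕ) + 1))
    (hP₁ : P₁ = periodicLattice (fun j => mulVecLin g₁ (e K (ω₁ j))) 0) :
    IsPositiveLattice P₁ g₁ ω₁ := by
  obtain ⟨σ, hσ⟩ := hσ
  refine ⟨hg₁, hω₁, fun i hi hi' => ?_, ?_, hP₁⟩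
  · have h1 := hσ ⟨i.toNat - 1, by omega⟩
    have h2 : (((⟨i.toNat - 1, by omega⟩ : Fin K) : ℕ) : ℤ) + 1 = i := by
      change ((i.toNat - 1 : ℕ) : ℤ) + 1 = i
      omega
    rw [h2] at h1
    rw [h1]
    exact h.isPositive _ (by omega) (by have := (σ ⟨i.toNat - 1, by omega⟩).2; omega)
  · obtain ⟨ha, hb⟩ := h.isNormalized
    set s : Fin K := ⟨(ω.symm 1).toNat - 1, by omega⟩ with hs
    have h2 : ((s : ℕ) : ℤ) + 1 = ω.symm 1 := by
      change (((ω.symm 1).toNat - 1 : ℕ) : ℤ) + 1 = _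
      omega
    have h1 := hσ (σ.symm s)
    rw [Equiv.apply_symm_apply, h2, Equiv.apply_symm_apply] at h1
    have h3 : ω₁.symm 1 = ((σ.symm s : Fin K) : ℕ) + 1 := by
      rw [Equiv.symm_apply_eq, h1]
    rw [IsNormalized, h3]
    have := (σ.symm s).2
    omega

/-- The echelon argument shows that C' places no condition on the flag beyond positivity of Λ
itself. -/
lemma exists_affineDeltaSpringer (h : IsPositiveLattice P g ω) (hk : 1 ≤ k) (hkn : k ≤ n)
    {F : flagIndex (bigK n k) n → Submodule ℂ (LVec (bigK n k))}
    (hF : IsSubquotientFlag (gammaC n k N) (asC P) (asC (epsMul P)) (bigK n k) n (n - k) F) :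
    ∃ L ∈ affineDeltaSpringer n k N, ∀ i, asC (L.1 i) = F i := by
  have hn : n ≤ bigK n k := by
    have := bigK_eq_add hk hkn
    omega
  obtain ⟨g₁, hg₁, ω₁, hω₁, hσ, hL⟩ := exists_iwahori_flag (bigK_pos hk) h.mem_iwahori
    h.isAffinePerm h.eq hn hF.antitone
    (fun i => hF.first ▸ hF.antitone (Nat.zero_le (i : ℕ))) hF.le hF.finrank
  have h₁ := h.of_perm hg₁ hω₁ hσ rfl
  obtain ⟨g', hg'⟩ := exists_translate (bigK_pos hk) h₁.isPeriodicBasis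
  let L : AffineFlag (bigK n k) (flagIndex (bigK n k) n) :=
    ⟨fun i => periodicLattice (fun j => mulVecLin g₁ (e (bigK n k) (ω₁ j))) (i : ℕ),
      g', fun i => hg' i⟩
  have hLF : ∀ i, asC (L.1 i) = F i := fun i => (hL i).symm
  have hst : ∀ i, asC (L.1 i) ≤ (asC (L.1 i)).comap (gammaC n k N) := by
    intro i
    rw [hLF]
    exact hF.stable i
  refine ⟨L, ⟨⟨hst, ?_⟩, ?_⟩, hLF⟩
  · refine (h.jordanTypeLE_iff hk hkn _ _ ((hLF _).trans hF.first) ?_ ?_ ?_).2 ?_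
    · rw [hLF, hLF]
      exact hF.antitone (Nat.zero_le _)
    · rw [hLF]
      exact hF.le _
    · rw [hLF, hF.finrank]
      change bigK n k - (bigK n k - n) = n
      omega
    · rw [hLF]
      exact hF.pow_mem
  · exact mem_positivePartialCells (bigK_pos hk) hg₁ hω₁ h₁.isPositive h₁.isNormalized
      fun i => rfl

end IsPositiveLattice

namespace IsPositiveLattice

section

variable {K : ℕ} {P : Submodule ℂ⟦X⟧ (LVec K)} {g : GL (Fin K) ℂ⸨X⸩} {ω : Equiv.Perm ℤ}

/-- Provides one truncation level at which the whole interval from εΛ to Λ is visible. -/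
lemma exists_stdLattice_le (h : IsPositiveLattice P g ω) :
    ∃ a : ℕ, stdLattice K ((a : ℤ) * K) ≤ epsMul P ∧ P ≤ stdLattice K (-((a : ℤ) * K)) := by
  obtain ⟨c, hc⟩ := h.exists_X_pow_smul_mem
  refine ⟨c + 1, fun x hx => ?_, fun x hx => ?_⟩
  · obtain ⟨y, hy⟩ := mem_stdLattice_mul.1 hx
    refine mem_epsMul.2 ⟨_, hc _ (mem_stdLattice_zero.2 ⟨y, rfl⟩), ?_⟩
    rw [← map_smul, ← map_smul, smul_smul, ← pow_succ']
    funext r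
    rw [ofIntegral_apply, hy, Pi.smul_apply, smul_eq_mul, map_mul, algebraMap_X_pow]
  · have h1 := h.le_stdLattice hx
    rw [← zero_mul (K : ℤ), mem_stdLattice_iff_coeff] at h1
    rw [← neg_mul, mem_stdLattice_iff_coeff]
    intro r j hj
    exact h1 r j (by omega)

end

end IsPositiveLattice

/-- Coefficients below -a vanish by the upper bound and those from -a to a - 1 by assumption. So
truncation loses nothing of Λ modulo εΛ. -/
lemma mem_of_truncation_eq_zero {K a : ℕ} {P : Submodule ℂ⟦X⟧ (LVec K)}
    (h : stdLattice K ((a : ℤ) * K) ≤ epsMul P) (h' : P ≤ stdLattice K (-((a : ℤ) * K)))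
    {x : LVec K} (hx : x ∈ asC P) (hx0 : truncation K a x = 0) : x ∈ asC (epsMul P) := by
  refine h (mem_stdLattice_iff_coeff.2 fun r j hj => ?_)
  have h1 := h' hx
  rw [← neg_mul, mem_stdLattice_iff_coeff] at h1
  by_cases hj' : j < -a
  · exact h1 r j hj'
  · have h2 := congrFun hx0 (r, ⟨(j + a).toNat, by omega⟩)
    change (x r).coeff (((j + a).toNat : ℕ) - (a : ℤ)) = 0 at h2
    rwa [Int.toNat_of_nonneg (by omega), add_sub_cancel_right] at h2

/-! ### The isomorphism with the Δ-Springer fiber -/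

section

variable {n k N : ℕ} {Λ : AffineGrassmannian (bigK n k)}

lemma lattice_of_mem_fiber {L : AffineFlag (bigK n k) (flagIndex (bigK n k) n)}
    (hL : L ∈ fiber n k N Λ) : L.1 (flagIndex.first _ n) = Λ.lattice := by
  rw [← hL.2]
  rfl

lemma mem_fiber_of_first_eq {L : AffineFlag (bigK n k) (flagIndex (bigK n k) n)}
    (hL : L ∈ affineDeltaSpringer n k N) (h : L.1 (flagIndex.first _ n) = Λ.lattice) :
    L ∈ fiber n k N Λ := by
  refine ⟨hL, Subtype.ext (funext ?_)⟩
  rintro ⟨_, rfl⟩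
  exact h

lemma exists_isPositiveLattice (hne : (fiber n k N Λ).Nonempty) :
    ∃ g ω, IsPositiveLattice Λ.lattice g ω := by
  obtain ⟨L, hL⟩ := hne
  obtain ⟨g, hg, ω, hω, hpos, hnorm, h⟩ := exists_of_mem_positivePartialCells hL.1.2
  exact ⟨g, ω, hg, hω, hpos, hnorm, (lattice_of_mem_fiber hL).symm.trans (h _)⟩

lemma le_comap_of_nonempty (hne : (fiber n k N Λ).Nonempty) :
    asC Λ.lattice ≤ (asC Λ.lattice).comap (gammaC n k N) := by
  obtain ⟨L, hL⟩ := hne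
  obtain ⟨hst, -⟩ := hL.1.1
  have := hst (flagIndex.first _ n)
  rwa [lattice_of_mem_fiber hL] at this

variable {g : GL (Fin (bigK n k)) ℂ⸨X⸩} {ω : Equiv.Perm ℤ}

/-- All members lie between the first, Λ, and the last, εΛ, so the bound depends on Λ alone. -/
lemma IsPositiveLattice.mem_bounded_iff (h : IsPositiveLattice Λ.lattice g ω) (hk : 1 ≤ k)
    (hkn : k ≤ n) {L : AffineFlag (bigK n k) (flagIndex (bigK n k) n)}
    (hL : L ∈ fiber n k N Λ) (a : ℕ) :
    L ∈ AffineFlag.bounded (bigK n k) (flagIndex (bigK n k) n) a ↔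
      stdLattice (bigK n k) ((a : ℤ) * bigK n k) ≤ epsMul Λ.lattice ∧
        Λ.lattice ≤ stdLattice (bigK n k) (-((a : ℤ) * bigK n k)) := by
  have hF := h.isSubquotientFlag hk hkn hL.1.1 (lattice_of_mem_fiber hL)
  have hle : ∀ i, L.1 i ≤ Λ.lattice := fun i =>
    lattice_of_mem_fiber hL ▸ hF.antitone (Nat.zero_le (i : ℕ))
  constructor
  · intro hb
    let i : flagIndex (bigK n k) n := ⟨bigK n k, Or.inr ⟨Nat.sub_le _ _, le_rfl⟩⟩
    -- The member in position K has dimension 0 modulo εΛ.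
    have hlast : L.1 i ≤ epsMul Λ.lattice := by
      have := h.finiteDimensional
      have : FiniteDimensional ℂ ((asC (L.1 i)).map (asC (epsMul Λ.lattice)).mkQ) :=
        Submodule.finiteDimensional_of_le (Submodule.map_mono (show asC (L.1 i) ≤ asC Λ.lattice from hle i))
      have h1 := hF.finrank i
      rw [show bigK n k - (i : ℕ) = 0 from Nat.sub_self _, Submodule.finrank_eq_zero] at h1
      intro x hx
      have h2 : (asC (epsMul Λ.lattice)).mkQ x = 0 :=
        (Submodule.mem_bot ℂ).1 (h1 ▸ Submodule.mem_map_of_mem hx)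
      exact (Submodule.Quotient.mk_eq_zero _).1 h2
    exact ⟨(hb i).1.trans hlast, lattice_of_mem_fiber hL ▸ (hb (flagIndex.first _ n)).2⟩
  · rintro ⟨h1, h2⟩ i
    exact ⟨h1.trans (hF.le i), (hle i).trans h2⟩

lemma IsPositiveLattice.isomorphic (h : IsPositiveLattice Λ.lattice g ω) (hk : 1 ≤ k)
    (hkn : k ≤ n) (hst : asC Λ.lattice ≤ (asC Λ.lattice).comap (gammaC n k N))
    {μ : YoungDiagram} (hμ : k ≤ μ.card) (hμ' : μ.card ≤ n)
    {T : Module.End ℂ (Fin (nuSize n k μ) → ℂ)}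
    {σ : (Fin (nuSize n k μ) → ℂ) →ₗ[ℂ] LVec (bigK n k)}
    (hσ : JordanSection (gammaC n k N) (asC Λ.lattice) (asC (epsMul Λ.lattice)) T n (n - k)
      (n - μ.card) σ) :
    (AffineFlag.subvariety (fiber n k N Λ)).Isomorphic (DeltaSpringer.variety n k μ T) := by
  have hMK : nuSize n k μ ≤ bigK n k := nuSize_le hk hkn hμ hμ'
  have hnM : n ≤ nuSize n k μ := by
    rw [nuSize_eq hk hμ']
    omega
  have hM : Module.finrank ℂ (Fin (nuSize n k μ) → ℂ) = nuSize n k μ := Module.finrank_fin_fun ℂ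
  have := h.finiteDimensional
  have hL : ∀ L : fiber n k N Λ, IsSubquotientFlag (gammaC n k N) (asC Λ.lattice)
      (asC (epsMul Λ.lattice)) (bigK n k) n (n - k) (fun i => asC (L.1.1 i)) := fun L =>
    h.isSubquotientFlag hk hkn L.2.1.1 (lattice_of_mem_fiber L.2)
  have hF : ∀ F : DeltaSpringer n k μ T,
      IsStableFlag T (nuSize n k μ) n (n - μ.card) F.1 := fun F =>
    (isStableFlag_iff hk hμ').1 F.2
  have hpush := fun F : DeltaSpringer n k μ T => JordanSection.isSubquotientFlag_pushFlag hσ hnM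
    hMK (epsMul_le Λ.lattice) hst (epsMul_le_comap hst) h.finrank (hF F)
  choose G hG hGF using fun F : DeltaSpringer n k μ T =>
    h.exists_affineDeltaSpringer hk hkn (hpush F)
  have hasC : ∀ A B : Submodule ℂ⟦X⟧ (LVec (bigK n k)), asC A = asC B → A = B := fun A B hAB =>
    Submodule.restrictScalars_injective ℂ _ _ hAB
  have hG' : ∀ F, G F ∈ fiber n k N Λ := fun F =>
    mem_fiber_of_first_eq (hG F) (hasC _ _ ((hGF F _).trans (hpush F).first))
  let e : fiber n k N Λ ≃ DeltaSpringer n k μ T :=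
    { toFun := fun L => ⟨pullFlag σ hMK (fun i => asC (L.1.1 i)), (isStableFlag_iff hk hμ').2
        (JordanSection.isStableFlag_pullFlag hσ hnM hMK hM (hL L))⟩
      invFun := fun F => ⟨G F, hG' F⟩
      left_inv := fun L => Subtype.ext <| Subtype.ext <| funext fun i => hasC _ _ <|
        (hGF _ i).trans (congrFun (JordanSection.pushFlag_pullFlag hσ hnM hMK (hL L)) i)
      right_inv := fun F => Subtype.ext <| by
        have h1 : (fun i => asC ((G F).1 i)) = pushFlag σ (asC Λ.lattice)
          (asC (epsMul Λ.lattice)) hnM hMK F.1 := funext (hGF F)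
        change pullFlag σ hMK (fun i => asC ((G F).1 i)) = F.1
        rw [h1]
        exact JordanSection.pullFlag_pushFlag hσ hnM hMK hM (hF F) }
  -- Each truncation level contains either the whole fiber or no point of it, so the ind-structure
  -- reduces to a single embedding in Grassmannians.
  have hA : ∀ a, (Subtype.val ⁻¹' AffineFlag.bounded (bigK n k) (flagIndex (bigK n k) n) a :
        Set (fiber n k N Λ)) = ∅ ∨
      (Subtype.val ⁻¹' AffineFlag.bounded (bigK n k) (flagIndex (bigK n k) n) a :
        Set (fiber n k N Λ)) = Set.univ ∧
      stdLattice (bigK n k) ((a : ℤ) * bigK n k) ≤ epsMul Λ.lattice ∧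
        Λ.lattice ≤ stdLattice (bigK n k) (-((a : ℤ) * bigK n k)) := by
    intro a
    by_cases ha : stdLattice (bigK n k) ((a : ℤ) * bigK n k) ≤ epsMul Λ.lattice ∧
        Λ.lattice ≤ stdLattice (bigK n k) (-((a : ℤ) * bigK n k))
    · exact Or.inr ⟨Set.eq_univ_of_forall fun L => (h.mem_bounded_iff hk hkn L.2 a).2 ha, ha⟩
    · exact Or.inl (Set.eq_empty_of_forall_notMem fun L hLa =>
        ha ((h.mem_bounded_iff hk hkn L.2 a).1 hLa))
  have hiff := fun (a : ℕ)
      (ha : stdLattice (bigK n k) ((a : ℤ) * bigK n k) ≤ epsMul Λ.lattice ∧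
        Λ.lattice ≤ stdLattice (bigK n k) (-((a : ℤ) * bigK n k))) =>
    JordanSection.grassmann_iff hσ hnM hMK (epsMul_le Λ.lattice) hM (truncation (bigK n k) a)
      (fun x => mem_of_truncation_eq_zero ha.1 ha.2) (fun (L : fiber n k N Λ) i => asC (L.1.1 i))
      hL (fun F : DeltaSpringer n k μ T => F.1) hF e (fun L => rfl) (fun F => funext (hGF F))
  obtain ⟨a₀, ha₀⟩ := h.exists_stdLattice_le
  have hA₀ : (Subtype.val ⁻¹' AffineFlag.bounded (bigK n k) (flagIndex (bigK n k) n) a₀ :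
        Set (fiber n k N Λ)) = Set.univ :=
    Set.eq_univ_of_forall fun L => (h.mem_bounded_iff hk hkn L.2 a₀).2 ha₀
  refine ⟨e, fun U => ?_, fun U _ f => ?_⟩
  · change IsOpen[grassmannTopology Set.univ fun F : DeltaSpringer n k μ T => F.1] U ↔
      IsOpen[⨆ a : ℕ, grassmannTopology (Subtype.val ⁻¹' AffineFlag.bounded _ _ a)
        (fun L : fiber n k N Λ => AffineFlag.subspaces a L.1)] (e ⁻¹' U)
    refine Iff.trans ?_ (isOpen_iSup_iff (t := fun a : ℕ =>
      grassmannTopology (Subtype.val ⁻¹' AffineFlag.bounded _ _ a)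
        (fun L : fiber n k N Λ => AffineFlag.subspaces a L.1))).symm
    constructor
    · intro hU a
      rcases hA a with ha | ⟨ha, ha'⟩
      · rw [ha]
        exact isOpen_grassmannTopology_empty _ _
      · rw [ha]
        exact (hiff a ha' U).1.1 hU
    · intro hU
      have h1 := hU a₀
      rw [hA₀] at h1
      exact (hiff a₀ ha₀ U).1.2 h1
  · constructor
    · intro hf a
      rcases hA a with ha | ⟨ha, ha'⟩
      · rw [ha]
        exact grassmannRegular_empty _ _ _
      · rw [ha]
        exact ((hiff a ha' U).2 f).1 hf
    · intro hf
      have h1 := hf a₀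
      rw [hA₀] at h1
      exact ((hiff a₀ ha₀ U).2 f).2 h1

end

end AffineDelta

end

theorem theorem1p7 (n k N : ℕ) (hk : 1 ≤ k) (hkn : k ≤ n)
    (Λ : AffineDelta.AffineGrassmannian (AffineDelta.bigK n k))
    (hne : (AffineDelta.fiber n k N Λ).Nonempty) :
    (∃ (h₀ : AffineDelta.asC Λ.lattice ≤
          (AffineDelta.asC Λ.lattice).comap (AffineDelta.gammaC n k N))
        (h₁ : AffineDelta.asC (AffineDelta.epsMul Λ.lattice) ≤
          (AffineDelta.asC (AffineDelta.epsMul Λ.lattice)).comap (AffineDelta.gammaC n k N))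
        (lam : ℕ → ℕ),
        AffineDelta.HasJordanType
          (AffineDelta.inducedEnd (AffineDelta.gammaC n k N) (AffineDelta.asC Λ.lattice)
            (AffineDelta.asC (AffineDelta.epsMul Λ.lattice)) h₀ h₁) lam ∧
        lam k = 0) ∧
    ∃ μ : YoungDiagram, μ.colLen 0 ≤ k ∧ μ.card ≤ n ∧
      ∀ T : Module.End ℂ (Fin (AffineDelta.nuSize n k μ) → ℂ),
        AffineDelta.HasJordanType T (AffineDelta.nuRow n k μ) →
        (AffineDelta.AffineFlag.subvariety (AffineDelta.fiber n k N Λ)).Isomorphic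
          (AffineDelta.DeltaSpringer.variety n k μ T) := by
  obtain ⟨g, ω, h⟩ := AffineDelta.exists_isPositiveLattice hne
  have h₀ := AffineDelta.le_comap_of_nonempty hne
  have h₁ := AffineDelta.epsMul_le_comap h₀
  have hnil := h.isNilpotent_inducedEnd hk h₀ h₁
  have hfd := h.finiteDimensional
  have hfd' := AffineDelta.finiteDimensional_subquotient
    (le_refl (AffineDelta.asC (AffineDelta.epsMul Λ.lattice)))
    (W := AffineDelta.asC Λ.lattice)
  obtain ⟨lam, hlam⟩ := AffineDelta.exists_hasJordanType _ hnil
  have hlam0 := h.hasJordanType_eq_zero hk hlam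
  refine ⟨⟨h₀, h₁, lam, hlam, hlam0⟩, ?_⟩
  -- |λ| = dim Λ/εΛ = K, all parts being among the first k.
  have hsum : ∑ i ∈ Finset.range k, lam i = (n - k) * k + k := by
    obtain ⟨b, -, -⟩ := hlam.2
    rw [AffineDelta.sum_range_eq_finrank hlam.1 b k hlam0]
    exact (AffineDelta.finrank_quotient_submoduleOf (AffineDelta.epsMul_le Λ.lattice)).trans
      (h.finrank.trans AffineDelta.bigK_eq)
  -- μ is the part of λ to the right of column n - k, i.e. the Jordan type of γ on the image of
  -- γ^(n-k).
  obtain ⟨μ, hμk, hrow, hcard⟩ := AffineDelta.exists_youngDiagram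
    (f := fun i => lam i - (n - k)) (fun i j hij => Nat.sub_le_sub_right (hlam.1 hij) _)
    (k := k) (by simp only [hlam0, Nat.zero_sub])
  have hμn : μ.card ≤ n := by
    obtain ⟨L, hL⟩ := hne
    rw [hcard]
    refine (h.isSubquotientFlag hk hkn hL.1.1 (AffineDelta.lattice_of_mem_fiber hL)).sum_le ?_
      hlam hlam0
    rw [AffineDelta.bigK_eq_add hk hkn]
    exact Nat.le_add_left _ _
  have hkμ : k ≤ μ.card := hcard ▸ AffineDelta.le_sum_tsub hsum
  refine ⟨μ, hμk, hμn, fun T hT => ?_⟩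
  obtain ⟨σ, hσ⟩ := AffineDelta.exists_jordanSection (n := n) (u := n - μ.card) (r := n - k)
    h₀ h₁ hlam hnil hT hlam0
    (fun i hi => by rw [AffineDelta.nuRow, if_pos hi, hrow])
    (fun i hi => by rw [AffineDelta.nuRow, if_neg (not_lt.2 hi)]) (Nat.sub_le_sub_left hkμ n)
    (fun i hi => by
      have := AffineDelta.le_add_sum_tsub hkn hsum hi
      rw [hcard]
      omega)
    (by
      rw [← hcard]
      omega)
  exact h.isomorphic hk hkn h₀ hkμ hμn hσ
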